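/- For $a,b,c\in\mathbb C$ let $$H_5(a,b,c|x,y)=\sum_{m,n\ge 0}\frac{(a)_{2m+n}(b)_{n-m}}{(c)_n\,m!\,n!}x^my^n,\qquad (b)_k=\frac{\Gamma(b+k)}{\Gamma(b)}\ (k\in\mathbb Z),$$ and, with $\theta_x=x\,\partial/\partial x$ and $\theta_y=y\,\partial/\partial y$, consider for $r\in\mathbb C$ the Horn system of $H_5(r,-r,\tfrac12|x,y)$: $$\bigl(\theta_x(-\theta_x+\theta_y-r)-x(2\theta_x+\theta_y+r)(2\theta_x+\theta_y+r+1)\bigr)F=0,$$ $$\bigl(\theta_y(\theta_y-\tfrac12)-y(2\theta_x+\theta_y+r)(-\theta_x+\theta_y-r)\bigr)F=0.$$ (1) Let $f$ be a holomorphic function on an open set $U\subseteq\mathbb C^2$ with $$x^2f^4+2xf^3+(1-2x)f^2+(4y-2)f+1=0 ,$$ and let $L$ be a holomorphic logarithm of $f$ on $U$. Then for every $r\in\mathbb C$ the function $f^r=e^{rL}$ solves the Horn system on $U$. (2) There is an $\varepsilon>0$, independent of $r$, such that the following holds; powers and square roots are principal branches. (a) On $D=\{(x,y): |x|,|y|<\varepsilon,\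 y\notin(-\infty,0]\}$ there is exactly one holomorphic solution $f$ of the quartic with $f=1+2i\sqrt y+O(|x|+|y|)$ as $(x,y)\to(0,0)$ in $D$. (b) Let $r\in\mathbb C$ with $2r\notin\mathbb Z$, and put $$\Phi_1=H_5(r,-r,\tfrac12|x,y),\qquad \Phi_2=\sqrt y\,H_5(r+\tfrac12,-r+\tfrac12,\tfrac32|x,y),$$ $$\Phi_3=x^{-r}\sum_{m,n\ge0}\frac{(-r)_{2m+3n}}{(\frac12)_n(1-r)_{m+n}\,m!\,n!}(-x)^m(xy)^n,$$ $$\Phi_4=x^{-r+\frac12}\sqrt y\sum_{m,n\ge0}\frac{(\frac32-r)_{2m+3n}}{(\frac32-r)_{m+n}(\frac32)_n\,m!\,n!}(-x)^m(xy)^n .$$ The four double series converge absolutely for $|x|,|y|<\varepsilon$. On every non-empty connected open set $U\subseteq\{(x,y)\in D: x\notin(-\infty,0]\}$ the functions $\Phi_1,\Phi_2,\Phi_3,\Phi_4$ form a basis of the space of holomorphic solutions of the Horn system, which therefore has rank $4$. With $f$ as in (a), the function $f^r$ solves the Horn system on $D$, and $$f^r=\Phi_1+2ir\,\Phi_2\qquad\text{on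 } D.$$ -/

import Mathlib

namespace HornH5

/-- The Euler operator `θ_x = x ∂/∂x`. -/
noncomputable def thetaX (F : ℂ × ℂ → ℂ) (p : ℂ × ℂ) : ℂ :=
  p.1 * deriv (fun t => F (t, p.2)) p.1

/-- The Euler operator `θ_y = y ∂/∂y`. -/
noncomputable def thetaY (F : ℂ × ℂ → ℂ) (p : ℂ × ℂ) : ℂ :=
  p.2 * deriv (fun t => F (p.1, t)) p.2

/-- The first order operator `α θ_x + β θ_y + γ`. -/
noncomputable def thetaLin (α β γ : ℂ) (F : ℂ × ℂ → ℂ) (p : ℂ × ℂ) : ℂ :=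
  α * thetaX F p + β * thetaY F p + γ * F p

/-- `F` is a holomorphic solution on `U` of the Horn system of `H₅(a, b, c | x, y)`:
`(θ_x (-θ_x + θ_y + b) - x (2θ_x + θ_y + a) (2θ_x + θ_y + a + 1)) F = 0` and
`(θ_y (θ_y + c - 1) - y (2θ_x + θ_y + a) (-θ_x + θ_y + b)) F = 0`. -/
structure IsHornSolution (a b c : ℂ) (U : Set (ℂ × ℂ)) (F : ℂ × ℂ → ℂ) : Prop where
  analytic : AnalyticOnNhd ℂ F U
  eq_x : ∀ p ∈ U, thetaX (thetaLin (-1) 1 b F) p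
    - p.1 * thetaLin 2 1 a (thetaLin 2 1 (a + 1) F) p = 0
  eq_y : ∀ p ∈ U, thetaY (thetaLin 0 1 (c - 1) F) p
    - p.2 * thetaLin 2 1 a (thetaLin (-1) 1 b F) p = 0

/-- The Pochhammer symbol `(b)_n = b (b + 1) ⋯ (b + n - 1)`. -/
noncomputable def poch (b : ℂ) (n : ℕ) : ℂ := (ascPochhammer ℂ n).eval b

/-- The Pochhammer symbol `(b)_k = Γ(b + k) / Γ(b)` for an integer `k`; in particular
`(b)_{-k} = 1 / ((b - k) (b - k + 1) ⋯ (b - 1)) = 1 / (b - k)_k` for `k > 0`. -/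
noncomputable def pochInt (b : ℂ) : ℤ → ℂ
  | Int.ofNat n => poch b n
  | Int.negSucc n => (poch (b - (n + 1)) (n + 1))⁻¹

/-- The `(m, n)` term of the Horn series `H₅(a, b, c | x, y)`. -/
noncomputable def H5Term (a b c x y : ℂ) (k : ℕ × ℕ) : ℂ :=
  poch a (2 * k.1 + k.2) * pochInt b ((k.2 : ℤ) - (k.1 : ℤ))
    / (poch c k.2 * (k.1.factorial : ℂ) * (k.2.factorial : ℂ)) * x ^ k.1 * y ^ k.2

/-- The Horn function `H₅(a, b, c | x, y)`. -/
noncomputable def H5 (a b c x y : ℂ) : ℂ := ∑' k : ℕ × ℕ, H5Term a b c x y k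

/-- The `(m, n)` term of the series in `Φ₃`. -/
noncomputable def Phi3Term (r x y : ℂ) (k : ℕ × ℕ) : ℂ :=
  poch (-r) (2 * k.1 + 3 * k.2)
    / (poch (1 / 2) k.2 * poch (1 - r) (k.1 + k.2) * (k.1.factorial : ℂ) * (k.2.factorial : ℂ))
    * (-x) ^ k.1 * (x * y) ^ k.2

/-- The `(m, n)` term of the series in `Φ₄`. -/
noncomputable def Phi4Term (r x y : ℂ) (k : ℕ × ℕ) : ℂ :=
  poch (3 / 2 - r) (2 * k.1 + 3 * k.2)
    / (poch (3 / 2 - r) (k.1 + k.2) * poch (3 / 2) k.2 * (k.1.factorial : ℂ)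
      * (k.2.factorial : ℂ))
    * (-x) ^ k.1 * (x * y) ^ k.2

/-- `Φ₁ = H₅(r, -r, 1/2 | x, y)`. -/
noncomputable def Phi1 (r : ℂ) (p : ℂ × ℂ) : ℂ := H5 r (-r) (1 / 2) p.1 p.2

/-- `Φ₂ = √y H₅(r + 1/2, -r + 1/2, 3/2 | x, y)`, with the principal square root. -/
noncomputable def Phi2 (r : ℂ) (p : ℂ × ℂ) : ℂ :=
  p.2 ^ (1 / 2 : ℂ) * H5 (r + 1 / 2) (-r + 1 / 2) (3 / 2) p.1 p.2

/-- `Φ₃`, with the principal branch of `x ^ (-r)`. -/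
noncomputable def Phi3 (r : ℂ) (p : ℂ × ℂ) : ℂ :=
  p.1 ^ (-r) * ∑' k : ℕ × ℕ, Phi3Term r p.1 p.2 k

/-- `Φ₄`, with the principal branches of `x ^ (-r + 1/2)` and `√y`. -/
noncomputable def Phi4 (r : ℂ) (p : ℂ × ℂ) : ℂ :=
  p.1 ^ (-r + 1 / 2) * p.2 ^ (1 / 2 : ℂ) * ∑' k : ℕ × ℕ, Phi4Term r p.1 p.2 k

/-- The four functions `Φ₁, Φ₂, Φ₃, Φ₄`. -/
noncomputable def Phi (r : ℂ) : Fin 4 → ℂ × ℂ → ℂ := ![Phi1 r, Phi2 r, Phi3 r, Phi4 r]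

/-- `z` is a root of `x² z⁴ + 2 x z³ + (1 - 2x) z² + (4y - 2) z + 1`. -/
def IsQuarticRoot (p : ℂ × ℂ) (z : ℂ) : Prop :=
  p.1 ^ 2 * z ^ 4 + 2 * p.1 * z ^ 3 + (1 - 2 * p.1) * z ^ 2 + (4 * p.2 - 2) * z + 1 = 0

/-- The points `(x, y)` with `|x|, |y| < ε` at which the principal `√y` is holomorphic. -/
def domY (ε : ℝ) : Set (ℂ × ℂ) :=
  {p | ‖p.1‖ < ε ∧ ‖p.2‖ < ε ∧ p.2 ∈ Complex.slitPlane}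

/-- The points of `domY ε` at which the principal powers of `x` are holomorphic as well. -/
def domXY (ε : ℝ) : Set (ℂ × ℂ) :=
  {p | p ∈ domY ε ∧ p.1 ∈ Complex.slitPlane}

/-- `f` is the holomorphic root of the quartic on `domY ε` with
`f = 1 + 2i√y + O(|x| + |y|)` at the origin. The quartic has two roots near `1` when
`(x, y)` is small, and they are exchanged by `√y ↦ -√y`. -/
structure IsRootBranch (ε : ℝ) (f : ℂ × ℂ → ℂ) : Prop where
  analytic : AnalyticOnNhd ℂ f (domY ε)
  root : ∀ p ∈ domY ε, IsQuarticRoot p (f p)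
  expansion : (fun p : ℂ × ℂ => f p - (1 + 2 * Complex.I * p.2 ^ (1 / 2 : ℂ)))
    =O[nhdsWithin 0 (domY ε)] (fun p : ℂ × ℂ => ‖p.1‖ + ‖p.2‖)

end HornH5

/-! The quartic reads `w² + 4 y z = 0` with `w = x z² + z - 1`. Implicit differentiation gives the
logarithmic derivatives of a root `f`: `θ_x L = -2 x f² / S` and `θ_y L = w / S`, where `S = 3 x f²
+ f + 1`. Since `x f²`, `w` and `y` are rational in `f` and `S`, applying the Horn operators to `exp
(r L)` leaves two identities of rational functions, for every `r` (`isHornSolution_root_power`).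

Each `Φᵢ` is a Frobenius series `x^ρ y^σ ∑ a_{m,n} x^m y^n`, on which the system becomes two first
order recurrences (`isHornSolution_frobenius`). Here `σ` is `0` or `1/2`. Taking `ρ = 0` gives the
`H₅` series; taking `ρ = σ - r` gives series supported on the cone `n ≤ m`. The coefficients grow at
most like `256^(m+n)` up to a constant; only that constant depends on `r`, so the domain of
convergence is uniform in `r`.

The solution space has dimension at most four because the system and its first derivatives express
`θ_x` and `θ_y` of `(F, θ_x F, θ_y F, θ_x θ_y F)` linearly through that vector. Grönwall's
inequality along a segment then shows that a solution is determined by this jet at one point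
(`IsHornSolution.eq_zero_of_jet_eq_zero`). Independence of the `Φᵢ` comes from continuation in `x`
around the origin, which separates the exponents `0`, `-r`, `-r + 1/2` when `2r` is not an integer
(`eq_zero_of_monodromy`); parity in `s = √y` does not suffice for this.

For the closed formula, put `f = v²`. The quartic splits over `s`, and one factor, `x v⁴ + v² - 1 -
2 i s v`, has a root `v` holomorphic in `(x, s)` with `v (0, 0) = 1`. Hence `f^r` is holomorphic in
`(x, s)` at the origin, so the coefficients of `Φ₃` and `Φ₄` vanish (`coefficients_of_holomorphic`).
The other two are the value `1` and the `s`-derivative `2 i r` of `f^r` at the origin. -/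

namespace HornH5

open Filter Topology

/-! ### Calculus of the Euler operators. -/

section Theta

variable {F G : ℂ × ℂ → ℂ} {p : ℂ × ℂ}

theorem hasDerivAt_slice_fst (h : DifferentiableAt ℂ F p) :
    HasDerivAt (fun t => F (t, p.2)) (fderiv ℂ F p (1, 0)) p.1 :=
  HasFDerivAt.comp_hasDerivAt (x := p.1) (f := fun t => (t, p.2)) h.hasFDerivAt
    ((hasDerivAt_id p.1).prodMk (hasDerivAt_const p.1 p.2))

theorem hasDerivAt_slice_snd (h : DifferentiableAt ℂ F p) :
    HasDerivAt (fun t => F (p.1, t)) (fderiv ℂ F p (0, 1)) p.2 :=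
  HasFDerivAt.comp_hasDerivAt (x := p.2) (f := fun t => (p.1, t)) h.hasFDerivAt
    ((hasDerivAt_const p.2 p.1).prodMk (hasDerivAt_id p.2))

theorem thetaX_eq_fderiv (h : DifferentiableAt ℂ F p) :
    thetaX F p = p.1 * fderiv ℂ F p (1, 0) := by
  rw [thetaX, (hasDerivAt_slice_fst h).deriv]

theorem thetaY_eq_fderiv (h : DifferentiableAt ℂ F p) :
    thetaY F p = p.2 * fderiv ℂ F p (0, 1) := by
  rw [thetaY, (hasDerivAt_slice_snd h).deriv]

theorem thetaX_eventuallyEq_fderiv (h : AnalyticAt ℂ F p) :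
    thetaX F =ᶠ[𝓝 p] fun q => q.1 * fderiv ℂ F q (1, 0) :=
  h.eventually_analyticAt.mono fun _ hq => thetaX_eq_fderiv hq.differentiableAt

theorem thetaY_eventuallyEq_fderiv (h : AnalyticAt ℂ F p) :
    thetaY F =ᶠ[𝓝 p] fun q => q.2 * fderiv ℂ F q (0, 1) :=
  h.eventually_analyticAt.mono fun _ hq => thetaY_eq_fderiv hq.differentiableAt

theorem thetaX_congr (h : F =ᶠ[𝓝 p] G) : thetaX F p = thetaX G p := by
  have hc : Tendsto (fun t : ℂ => (t, p.2)) (𝓝 p.1) (𝓝 p) :=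
    Continuous.tendsto (by fun_prop) p.1
  exact congrArg (p.1 * ·) (h.comp_tendsto hc).deriv_eq

theorem thetaY_congr (h : F =ᶠ[𝓝 p] G) : thetaY F p = thetaY G p := by
  have hc : Tendsto (fun t : ℂ => (p.1, t)) (𝓝 p.2) (𝓝 p) :=
    Continuous.tendsto (by fun_prop) p.2
  exact congrArg (p.2 * ·) (h.comp_tendsto hc).deriv_eq

theorem thetaLin_congr (α β γ : ℂ) (h : F =ᶠ[𝓝 p] G) :
    thetaLin α β γ F p = thetaLin α β γ G p := by
  rw [thetaLin, thetaLin, thetaX_congr h, thetaY_congr h, h.eq_of_nhds]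

theorem thetaLin_eventuallyEq (α β γ : ℂ) (h : F =ᶠ[𝓝 p] G) :
    thetaLin α β γ F =ᶠ[𝓝 p] thetaLin α β γ G :=
  h.eventuallyEq_nhds.mono fun _ hq => thetaLin_congr α β γ hq

theorem analyticAt_thetaX (h : AnalyticAt ℂ F p) : AnalyticAt ℂ (thetaX F) p := by
  refine AnalyticAt.congr ?_ (thetaX_eventuallyEq_fderiv h).symm
  exact analyticAt_fst.mul ((ContinuousLinearMap.apply ℂ ℂ ((1 : ℂ), (0 : ℂ))).analyticAt _
    |>.comp h.fderiv)

theorem analyticAt_thetaY (h : AnalyticAt ℂ F p) : AnalyticAt ℂ (thetaY F) p := by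
  refine AnalyticAt.congr ?_ (thetaY_eventuallyEq_fderiv h).symm
  exact analyticAt_snd.mul ((ContinuousLinearMap.apply ℂ ℂ ((0 : ℂ), (1 : ℂ))).analyticAt _
    |>.comp h.fderiv)

theorem analyticAt_thetaLin (α β γ : ℂ) (h : AnalyticAt ℂ F p) :
    AnalyticAt ℂ (thetaLin α β γ F) p :=
  ((analyticAt_const.mul (analyticAt_thetaX h)).add
    (analyticAt_const.mul (analyticAt_thetaY h))).add (analyticAt_const.mul h)

theorem thetaX_add (hF : DifferentiableAt ℂ F p) (hG : DifferentiableAt ℂ G p) :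
    thetaX (fun q => F q + G q) p = thetaX F p + thetaX G p := by
  simp only [thetaX]
  rw [((hasDerivAt_slice_fst hF).fun_add (hasDerivAt_slice_fst hG)).deriv,
    (hasDerivAt_slice_fst hF).deriv, (hasDerivAt_slice_fst hG).deriv]
  ring

theorem thetaY_add (hF : DifferentiableAt ℂ F p) (hG : DifferentiableAt ℂ G p) :
    thetaY (fun q => F q + G q) p = thetaY F p + thetaY G p := by
  simp only [thetaY]
  rw [((hasDerivAt_slice_snd hF).fun_add (hasDerivAt_slice_snd hG)).deriv,
    (hasDerivAt_slice_snd hF).deriv, (hasDerivAt_slice_snd hG).deriv]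
  ring

theorem thetaX_mul (hF : DifferentiableAt ℂ F p) (hG : DifferentiableAt ℂ G p) :
    thetaX (fun q => F q * G q) p = thetaX F p * G p + F p * thetaX G p := by
  simp only [thetaX]
  rw [((hasDerivAt_slice_fst hF).fun_mul (hasDerivAt_slice_fst hG)).deriv,
    (hasDerivAt_slice_fst hF).deriv, (hasDerivAt_slice_fst hG).deriv]
  ring

theorem thetaY_mul (hF : DifferentiableAt ℂ F p) (hG : DifferentiableAt ℂ G p) :
    thetaY (fun q => F q * G q) p = thetaY F p * G p + F p * thetaY G p := by
  simp only [thetaY]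
  rw [((hasDerivAt_slice_snd hF).fun_mul (hasDerivAt_slice_snd hG)).deriv,
    (hasDerivAt_slice_snd hF).deriv, (hasDerivAt_slice_snd hG).deriv]
  ring

theorem thetaX_const (c : ℂ) : thetaX (fun _ => c) p = 0 := by simp [thetaX]

theorem thetaY_const (c : ℂ) : thetaY (fun _ => c) p = 0 := by simp [thetaY]

theorem thetaX_fst : thetaX (fun q => q.1) p = p.1 := by simp [thetaX]

theorem thetaY_fst : thetaY (fun q => q.1) p = 0 := by simp [thetaY]

theorem thetaX_snd : thetaX (fun q => q.2) p = 0 := by simp [thetaX]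

theorem thetaY_snd : thetaY (fun q => q.2) p = p.2 := by simp [thetaY]

theorem thetaX_const_mul (c : ℂ) (hF : DifferentiableAt ℂ F p) :
    thetaX (fun q => c * F q) p = c * thetaX F p := by
  rw [thetaX_mul (by fun_prop) hF, thetaX_const]; ring

theorem thetaY_const_mul (c : ℂ) (hF : DifferentiableAt ℂ F p) :
    thetaY (fun q => c * F q) p = c * thetaY F p := by
  rw [thetaY_mul (by fun_prop) hF, thetaY_const]; ring

theorem thetaX_cexp (hF : DifferentiableAt ℂ F p) :
    thetaX (fun q => Complex.exp (F q)) p = thetaX F p * Complex.exp (F p) := by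
  simp only [thetaX]
  rw [(hasDerivAt_slice_fst hF).cexp.deriv, (hasDerivAt_slice_fst hF).deriv]
  ring

theorem thetaY_cexp (hF : DifferentiableAt ℂ F p) :
    thetaY (fun q => Complex.exp (F q)) p = thetaY F p * Complex.exp (F p) := by
  simp only [thetaY]
  rw [(hasDerivAt_slice_snd hF).cexp.deriv, (hasDerivAt_slice_snd hF).deriv]
  ring

/-- Both sides are `x y` times a mixed second derivative, because `θ_y x = θ_x y = 0`; symmetry of
the second derivative concludes. -/
theorem thetaY_thetaX (h : AnalyticAt ℂ F p) :
    thetaY (thetaX F) p = thetaX (thetaY F) p := by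
  have hs : IsSymmSndFDerivAt ℂ F p :=
    (h.contDiffAt (n := ⊤)).isSymmSndFDerivAt (by simp)
  have hd : DifferentiableAt ℂ (fderiv ℂ F) p := h.fderiv.differentiableAt
  have key : ∀ v w : ℂ × ℂ, HasFDerivAt (fun q => fderiv ℂ F q v)
      ((fderiv ℂ (fderiv ℂ F) p).flip v) p := fun v _ => by
    simpa using hd.hasFDerivAt.clm_apply (hasFDerivAt_const v p)
  have k1 := key (1, 0) 0
  have k2 := key (0, 1) 0
  rw [thetaY_congr (thetaX_eventuallyEq_fderiv h), thetaX_congr (thetaY_eventuallyEq_fderiv h),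
    thetaY_mul (by fun_prop) k1.differentiableAt, thetaX_mul (by fun_prop) k2.differentiableAt,
    thetaY_fst, thetaX_snd, thetaY_eq_fderiv k1.differentiableAt,
    thetaX_eq_fderiv k2.differentiableAt, k1.fderiv, k2.fderiv]
  have := hs (0, 1) (1, 0)
  simp only [ContinuousLinearMap.flip_apply]
  rw [this]
  ring

theorem thetaX_thetaLin (α β γ : ℂ) (h : AnalyticAt ℂ F p) :
    thetaX (thetaLin α β γ F) p
      = α * thetaX (thetaX F) p + β * thetaX (thetaY F) p + γ * thetaX F p := by
  have h1 := (analyticAt_thetaX h).differentiableAt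
  have h2 := (analyticAt_thetaY h).differentiableAt
  have h3 := h.differentiableAt
  change thetaX (fun q => α * thetaX F q + β * thetaY F q + γ * F q) p = _
  rw [thetaX_add ((h1.const_mul α).fun_add (h2.const_mul β)) (h3.const_mul γ),
    thetaX_add (h1.const_mul α) (h2.const_mul β), thetaX_const_mul _ h1, thetaX_const_mul _ h2,
    thetaX_const_mul _ h3]

theorem thetaY_thetaLin (α β γ : ℂ) (h : AnalyticAt ℂ F p) :
    thetaY (thetaLin α β γ F) p
      = α * thetaX (thetaY F) p + β * thetaY (thetaY F) p + γ * thetaY F p := by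
  have h1 := (analyticAt_thetaX h).differentiableAt
  have h2 := (analyticAt_thetaY h).differentiableAt
  have h3 := h.differentiableAt
  change thetaY (fun q => α * thetaX F q + β * thetaY F q + γ * F q) p = _
  rw [thetaY_add ((h1.const_mul α).fun_add (h2.const_mul β)) (h3.const_mul γ),
    thetaY_add (h1.const_mul α) (h2.const_mul β), thetaY_const_mul _ h1, thetaY_const_mul _ h2,
    thetaY_const_mul _ h3, thetaY_thetaX h]

/-- The first Horn operator, expanded in the monomials in `θ_x` and `θ_y`. -/
theorem horn_x_expand (a b : ℂ) (h : AnalyticAt ℂ F p) :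
    thetaX (thetaLin (-1) 1 b F) p - p.1 * thetaLin 2 1 a (thetaLin 2 1 (a + 1) F) p
      = -thetaX (thetaX F) p + thetaX (thetaY F) p + b * thetaX F p
        - p.1 * (4 * thetaX (thetaX F) p + 4 * thetaX (thetaY F) p + thetaY (thetaY F) p
          + (4 * a + 2) * thetaX F p + (2 * a + 1) * thetaY F p + a * (a + 1) * F p) := by
  rw [thetaX_thetaLin _ _ _ h]
  simp only [thetaLin.eq_1 2 1 a, thetaX_thetaLin _ _ _ h, thetaY_thetaLin _ _ _ h]
  simp only [thetaLin]
  ring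

/-- The second Horn operator, expanded in the monomials in `θ_x` and `θ_y`. -/
theorem horn_y_expand (a b c : ℂ) (h : AnalyticAt ℂ F p) :
    thetaY (thetaLin 0 1 (c - 1) F) p - p.2 * thetaLin 2 1 a (thetaLin (-1) 1 b F) p
      = thetaY (thetaY F) p + (c - 1) * thetaY F p
        - p.2 * (-2 * thetaX (thetaX F) p + thetaX (thetaY F) p + thetaY (thetaY F) p
          + (2 * b - a) * thetaX F p + (a + b) * thetaY F p + a * b * F p) := by
  rw [thetaY_thetaLin _ _ _ h]
  simp only [thetaLin.eq_1 2 1 a, thetaX_thetaLin _ _ _ h, thetaY_thetaLin _ _ _ h]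
  simp only [thetaLin]
  ring

end Theta

/-! ### Linearity and locality of the solution property. -/

theorem IsHornSolution.congr {a b c : ℂ} {U : Set (ℂ × ℂ)} (hU : IsOpen U) {F G : ℂ × ℂ → ℂ}
    (hF : IsHornSolution a b c U F) (h : Set.EqOn F G U) : IsHornSolution a b c U G := by
  have key : ∀ p ∈ U, F =ᶠ[𝓝 p] G := fun p hp => h.eventuallyEq_of_mem (hU.mem_nhds hp)
  refine ⟨hF.analytic.congr hU h, fun p hp => ?_, fun p hp => ?_⟩
  · have := hF.eq_x p hp
    rwa [thetaX_congr (thetaLin_eventuallyEq _ _ _ (key p hp)),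
      thetaLin_congr _ _ _ (thetaLin_eventuallyEq _ _ _ (key p hp))] at this
  · have := hF.eq_y p hp
    rwa [thetaY_congr (thetaLin_eventuallyEq _ _ _ (key p hp)),
      thetaLin_congr _ _ _ (thetaLin_eventuallyEq _ _ _ (key p hp))] at this

theorem IsHornSolution.mono {a b c : ℂ} {U V : Set (ℂ × ℂ)} {F : ℂ × ℂ → ℂ}
    (hF : IsHornSolution a b c U F) (h : V ⊆ U) : IsHornSolution a b c V F :=
  ⟨hF.analytic.mono h, fun p hp => hF.eq_x p (h hp), fun p hp => hF.eq_y p (h hp)⟩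

theorem thetaX_sum {F : Fin 4 → ℂ × ℂ → ℂ} {p : ℂ × ℂ} (c : Fin 4 → ℂ)
    (hF : ∀ i, DifferentiableAt ℂ (F i) p) :
    thetaX (fun q => ∑ i, c i * F i q) p = ∑ i, c i * thetaX (F i) p := by
  simp only [thetaX]
  rw [(HasDerivAt.fun_sum fun i _ => (hasDerivAt_slice_fst (hF i)).const_mul (c i)).deriv,
    Finset.mul_sum]
  refine Finset.sum_congr rfl fun i _ => ?_
  rw [(hasDerivAt_slice_fst (hF i)).deriv]; ring

theorem thetaY_sum {F : Fin 4 → ℂ × ℂ → ℂ} {p : ℂ × ℂ} (c : Fin 4 → ℂ)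
    (hF : ∀ i, DifferentiableAt ℂ (F i) p) :
    thetaY (fun q => ∑ i, c i * F i q) p = ∑ i, c i * thetaY (F i) p := by
  simp only [thetaY]
  rw [(HasDerivAt.fun_sum fun i _ => (hasDerivAt_slice_snd (hF i)).const_mul (c i)).deriv,
    Finset.mul_sum]
  refine Finset.sum_congr rfl fun i _ => ?_
  rw [(hasDerivAt_slice_snd (hF i)).deriv]; ring

theorem thetaLin_sum {F : Fin 4 → ℂ × ℂ → ℂ} {p : ℂ × ℂ} (α β γ : ℂ) (c : Fin 4 → ℂ)
    (hF : ∀ i, DifferentiableAt ℂ (F i) p) :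
    thetaLin α β γ (fun q => ∑ i, c i * F i q) p = ∑ i, c i * thetaLin α β γ (F i) p := by
  simp only [thetaLin, thetaX_sum c hF, thetaY_sum c hF, Finset.mul_sum, mul_add,
    Finset.sum_add_distrib]
  congr 1
  · congr 1 <;> exact Finset.sum_congr rfl fun i _ => by ring
  · exact Finset.sum_congr rfl fun i _ => by ring

theorem IsHornSolution.sum {a b c : ℂ} {U : Set (ℂ × ℂ)} {F : Fin 4 → ℂ × ℂ → ℂ}
    (hF : ∀ i, IsHornSolution a b c U (F i)) (d : Fin 4 → ℂ) :
    IsHornSolution a b c U (fun q => ∑ i, d i * F i q) := by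
  have key : ∀ p ∈ U, ∀ α β γ : ℂ, thetaLin α β γ (fun q => ∑ i, d i * F i q) =ᶠ[𝓝 p]
      fun q => ∑ i, d i * thetaLin α β γ (F i) q := fun p hp α β γ => by
    have : ∀ᶠ q in 𝓝 p, ∀ i, AnalyticAt ℂ (F i) q :=
      eventually_all.2 fun i => ((hF i).analytic p hp).eventually_analyticAt
    exact this.mono fun q hq => thetaLin_sum α β γ d fun i => (hq i).differentiableAt
  have hdiff : ∀ p ∈ U, ∀ α β γ : ℂ, ∀ i, DifferentiableAt ℂ (thetaLin α β γ (F i)) p :=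
    fun p hp α β γ i => (analyticAt_thetaLin α β γ ((hF i).analytic p hp)).differentiableAt
  refine ⟨fun p hp => ?_, fun p hp => ?_, fun p hp => ?_⟩
  · exact Finset.analyticAt_fun_sum _ fun i _ => analyticAt_const.mul ((hF i).analytic p hp)
  · rw [thetaX_congr (key p hp _ _ _), thetaLin_congr _ _ _ (key p hp _ _ _),
      thetaX_sum d (hdiff p hp _ _ _), thetaLin_sum _ _ _ d (hdiff p hp _ _ _), Finset.mul_sum,
      ← Finset.sum_sub_distrib]
    refine Finset.sum_eq_zero fun i _ => ?_
    linear_combination d i * (hF i).eq_x p hp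
  · rw [thetaY_congr (key p hp _ _ _), thetaLin_congr _ _ _ (key p hp _ _ _),
      thetaY_sum d (hdiff p hp _ _ _), thetaLin_sum _ _ _ d (hdiff p hp _ _ _), Finset.mul_sum,
      ← Finset.sum_sub_distrib]
    refine Finset.sum_eq_zero fun i _ => ?_
    linear_combination d i * (hF i).eq_y p hp

theorem IsHornSolution.sub {a b c : ℂ} {U : Set (ℂ × ℂ)} {F G : ℂ × ℂ → ℂ}
    (hU : IsOpen U) (hF : IsHornSolution a b c U F) (hG : IsHornSolution a b c U G) :
    IsHornSolution a b c U (fun q => F q - G q) := by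
  -- The difference is padded by zero coefficients to a combination of four solutions.
  refine (IsHornSolution.sum (F := ![F, G, F, G]) ?_ ![1, -1, 0, 0]).congr hU ?_
  · intro i; fin_cases i <;> assumption
  · intro p _
    simp [Fin.sum_univ_four, sub_eq_add_neg]

end HornH5

/-! ### Powers of a root of the quartic. -/

namespace HornH5

open Filter Topology

section RootPower

variable {f L : ℂ × ℂ → ℂ} {p : ℂ × ℂ}

/-- This form makes `y` rational in `x` and `z`, and it splits into two factors once square roots of
`y` and `z` are adjoined. -/
theorem isQuarticRoot_iff (p : ℂ × ℂ) (z : ℂ) :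
    IsQuarticRoot p z ↔ (p.1 * z ^ 2 + z - 1) ^ 2 + 4 * p.2 * z = 0 := by
  rw [IsQuarticRoot]
  constructor <;> intro h <;> linear_combination h

theorem hasDerivAt_quartic_fst {g : ℂ → ℂ} {d x : ℂ} (y : ℂ) (h : HasDerivAt g d x) :
    HasDerivAt (fun t => (t * g t ^ 2 + g t - 1) ^ 2 + 4 * y * g t)
      (2 * (x * g x ^ 2 + g x - 1) * (g x ^ 2 + 2 * x * g x * d + d) + 4 * y * d) x := by
  have := (((((hasDerivAt_id x).fun_mul (h.fun_pow 2)).fun_add h).sub_const 1).fun_pow 2).fun_add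
    (h.const_mul (4 * y))
  refine this.congr_deriv ?_
  simp only [id_eq]
  push_cast
  ring

theorem hasDerivAt_quartic_snd {g : ℂ → ℂ} {d y : ℂ} (x : ℂ) (h : HasDerivAt g d y) :
    HasDerivAt (fun t => (x * g t ^ 2 + g t - 1) ^ 2 + 4 * t * g t)
      (2 * (x * g y ^ 2 + g y - 1) * (2 * x * g y * d + d) + 4 * g y + 4 * y * d) y := by
  have := (((((h.fun_pow 2).const_mul x).fun_add h).sub_const 1).fun_pow 2).fun_add
    (((hasDerivAt_id y).const_mul 4).fun_mul h)
  refine this.congr_deriv ?_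
  simp only [id_eq]
  push_cast
  ring

/-- Let `Q` be the quartic, `w = x z² + z - 1`, `S = 3 x z² + z + 1`. Then `z ∂_z Q = Q + w S`, so
`w S` stands for `z ∂_z Q` on the curve. The `y`-derivative gives `fy w S = -4 z² ≠ 0`: the mere
existence of a holomorphic nonzero root keeps `w` and `S` away from zero, and no discriminant
condition is needed. -/
theorem root_logDeriv_algebra {x y z fx fy LX LY : ℂ} (hz : z ≠ 0)
    (hR0 : (x * z ^ 2 + z - 1) ^ 2 + 4 * y * z = 0)
    (zX : 2 * (x * z ^ 2 + z - 1) * (z ^ 2 + 2 * x * z * fx + fx) + 4 * y * fx = 0)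
    (zY : 2 * (x * z ^ 2 + z - 1) * (2 * x * z * fy + fy) + 4 * z + 4 * y * fy = 0)
    (hX : x * fx = LX * z) (hY : y * fy = LY * z) :
    3 * x * z ^ 2 + z + 1 ≠ 0 ∧ LX * (3 * x * z ^ 2 + z + 1) = -2 * x * z ^ 2 ∧
    LY * (3 * x * z ^ 2 + z + 1) = x * z ^ 2 + z - 1 := by
  have kY : fy * (x * z ^ 2 + z - 1) * (3 * x * z ^ 2 + z + 1) = -4 * z ^ 2 := by
    linear_combination z * zY - fy * hR0
  have kX : fx * (x * z ^ 2 + z - 1) * (3 * x * z ^ 2 + z + 1) = -2 * (x * z ^ 2 + z - 1) * z ^ 3 := by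
    linear_combination z * zX - fx * hR0
  have hne : fy * (x * z ^ 2 + z - 1) * (3 * x * z ^ 2 + z + 1) ≠ 0 := by
    rw [kY]; exact mul_ne_zero (by norm_num) (pow_ne_zero 2 hz)
  have hS := right_ne_zero_of_mul hne
  have hw0 := right_ne_zero_of_mul (left_ne_zero_of_mul hne)
  refine ⟨hS, ?_, ?_⟩
  · apply mul_right_cancel₀ (mul_ne_zero hw0 hz)
    linear_combination x * kX - (x * z ^ 2 + z - 1) * (3 * x * z ^ 2 + z + 1) * hX
  · apply mul_right_cancel₀ (mul_ne_zero hw0 hz)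
    linear_combination y * kY - (x * z ^ 2 + z - 1) * (3 * x * z ^ 2 + z + 1) * hY - z * hR0

/-- Logarithmic derivatives of a holomorphic root of the quartic. -/
theorem root_logDeriv (hf : AnalyticAt ℂ f p) (hL : AnalyticAt ℂ L p)
    (hroot : ∀ᶠ q in 𝓝 p, IsQuarticRoot q (f q)) (hexp : ∀ᶠ q in 𝓝 p, Complex.exp (L q) = f q) :
    3 * p.1 * f p ^ 2 + f p + 1 ≠ 0 ∧
    thetaX L p * (3 * p.1 * f p ^ 2 + f p + 1) = -2 * p.1 * f p ^ 2 ∧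
    thetaY L p * (3 * p.1 * f p ^ 2 + f p + 1) = p.1 * f p ^ 2 + f p - 1 ∧
    thetaX f p = thetaX L p * f p ∧ thetaY f p = thetaY L p * f p := by
  have hfd := hf.differentiableAt
  have hLd := hL.differentiableAt
  have hz : f p ≠ 0 := by
    rw [← hexp.self_of_nhds]; exact Complex.exp_ne_zero _
  have hX : thetaX f p = thetaX L p * f p := by
    rw [← thetaX_congr hexp, thetaX_cexp hLd, hexp.self_of_nhds]
  have hY : thetaY f p = thetaY L p * f p := by
    rw [← thetaY_congr hexp, thetaY_cexp hLd, hexp.self_of_nhds]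
  have hR : (fun q : ℂ × ℂ => (q.1 * f q ^ 2 + f q - 1) ^ 2 + 4 * q.2 * f q) =ᶠ[𝓝 p] fun _ => 0 :=
    hroot.mono fun q hq => (isQuarticRoot_iff q _).1 hq
  have hR0 : (p.1 * f p ^ 2 + f p - 1) ^ 2 + 4 * p.2 * f p = 0 := hR.self_of_nhds
  have dX := hasDerivAt_slice_fst hfd
  have dY := hasDerivAt_slice_snd hfd
  have eX := hasDerivAt_quartic_fst p.2 dX
  have eY := hasDerivAt_quartic_snd p.1 dY
  have hcX : Tendsto (fun t : ℂ => (t, p.2)) (𝓝 p.1) (𝓝 p) :=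
    Continuous.tendsto (by fun_prop) p.1
  have hcY : Tendsto (fun t : ℂ => (p.1, t)) (𝓝 p.2) (𝓝 p) :=
    Continuous.tendsto (by fun_prop) p.2
  have zX := eX.unique ((hasDerivAt_const p.1 (0 : ℂ)).congr_of_eventuallyEq
    (hcX.eventually (p := fun q => (q.1 * f q ^ 2 + f q - 1) ^ 2 + 4 * q.2 * f q = 0) hR))
  have zY := eY.unique ((hasDerivAt_const p.2 (0 : ℂ)).congr_of_eventuallyEq
    (hcY.eventually (p := fun q => (q.1 * f q ^ 2 + f q - 1) ^ 2 + 4 * q.2 * f q = 0) hR))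
  rw [thetaX_eq_fderiv hfd] at hX
  rw [thetaY_eq_fderiv hfd] at hY
  simp only [Prod.mk.eta] at zX zY
  rw [thetaX_eq_fderiv hfd, thetaY_eq_fderiv hfd]
  obtain ⟨h1, h2, h3⟩ := root_logDeriv_algebra hz hR0 zX zY hX hY
  exact ⟨h1, h2, h3, hX, hY⟩

/-- The algebraic identities behind `isHornSolution_root_power`, in terms of the root `z` and
`S = 3 x z² + z + 1`. -/
theorem root_power_identities {r x y z S E A B XA XB YB : ℂ} (hz : z ≠ 0) (hS : S ≠ 0)
    (hx : 3 * x * z ^ 2 + z + 1 = S) (hy : (x * z ^ 2 + z - 1) ^ 2 + 4 * y * z = 0)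
    (hA : A * S = -2 * x * z ^ 2) (hB : B * S = x * z ^ 2 + z - 1)
    (hXA : XA * S = -2 * x * z ^ 2 * (1 + 2 * A) - A * (3 * x * z ^ 2 * (1 + 2 * A) + A * z))
    (hXB : XB * S = x * z ^ 2 * (1 + 2 * A) + A * z - B * (3 * x * z ^ 2 * (1 + 2 * A) + A * z))
    (hYB : YB * S = x * z ^ 2 * (2 * B) + B * z - B * (3 * x * z ^ 2 * (2 * B) + B * z)) :
    (-((r * XA + r ^ 2 * A ^ 2) * E) + (r * XB + r ^ 2 * A * B) * E + -r * (r * A * E)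
        - x * (4 * ((r * XA + r ^ 2 * A ^ 2) * E) + 4 * ((r * XB + r ^ 2 * A * B) * E)
          + (r * YB + r ^ 2 * B ^ 2) * E + (4 * r + 2) * (r * A * E) + (2 * r + 1) * (r * B * E)
          + r * (r + 1) * E) = 0) ∧
    ((r * YB + r ^ 2 * B ^ 2) * E + (1 / 2 - 1) * (r * B * E)
        - y * (-2 * ((r * XA + r ^ 2 * A ^ 2) * E) + (r * XB + r ^ 2 * A * B) * E
          + (r * YB + r ^ 2 * B ^ 2) * E + (2 * -r - r) * (r * A * E) + (r + -r) * (r * B * E)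
          + r * -r * E) = 0) := by
  -- The curve is parametrized rationally by `(z, S)`: `x z² = (S - z - 1) / 3`, `w = (S + 2 z - 4)
  -- / 3`, `y = -w² / (4 z)`. After substitution only identities of rational functions in `z`, `S`
  -- and `r` remain.
  have hx' : x = (S - z - 1) / (3 * z ^ 2) := by
    rw [eq_div_iff (by simpa using hz)]; linear_combination hx
  have hu : x * z ^ 2 = (S - z - 1) / 3 := by linear_combination hx / 3
  have hy' : y = -((S + 2 * z - 4) / 3) ^ 2 / (4 * z) := by
    rw [eq_div_iff (by simpa using hz)]
    linear_combination hy - (x * z ^ 2 + z - 1 + (S + 2 * z - 4) / 3) * hu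
  have hA' : A = -2 * ((S - z - 1) / 3) / S := by
    rw [eq_div_iff hS]; linear_combination hA - 2 * hu
  have hB' : B = ((S + 2 * z - 4) / 3) / S := by
    rw [eq_div_iff hS]; linear_combination hB + hu
  rw [mul_assoc (-2), hu, mul_assoc 3, hu] at hXA
  rw [hu, mul_assoc 3, hu] at hXB hYB
  rw [← eq_div_iff hS] at hXA hXB hYB
  rw [hXA, hXB, hYB, hA', hB', hy', hx']
  constructor
  · field_simp
    ring
  · field_simp
    ring

end RootPower

/-- Every branch of a power of a holomorphic root of the quartic solves the Horn system. -/
theorem isHornSolution_root_power (r : ℂ) (U : Set (ℂ × ℂ)) (f L : ℂ × ℂ → ℂ) (hU : IsOpen U)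
    (hf : AnalyticOnNhd ℂ f U) (hroot : ∀ p ∈ U, IsQuarticRoot p (f p))
    (hL : AnalyticOnNhd ℂ L U) (hexp : ∀ p ∈ U, Complex.exp (L p) = f p) :
    IsHornSolution r (-r) (1 / 2) U (fun p => Complex.exp (r * L p)) := by
  have hF : AnalyticOnNhd ℂ (fun p => Complex.exp (r * L p)) U :=
    fun p hp => (analyticAt_const.mul (hL p hp)).cexp
  have key : ∀ p ∈ U, _ := fun p hp => root_logDeriv (hf p hp) (hL p hp)
    (eventually_of_mem (hU.mem_nhds hp) hroot) (eventually_of_mem (hU.mem_nhds hp) hexp)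
  -- `A`, `B` are `θ_x L`, `θ_y L`, and `XA`, `XB`, `YB` are their θ-derivatives. The latter come
  -- from differentiating `A S = -2 x f²` and `B S = x f² + f - 1` once more, with `θ_x f = A f` and
  -- `θ_y f = B f`.
  have main : ∀ p ∈ U, ∀ E : ℂ × ℂ → ℂ, E = (fun p => Complex.exp (r * L p)) → ∃ A B XA XB YB : ℂ,
      A * (3 * p.1 * f p ^ 2 + f p + 1) = -2 * p.1 * f p ^ 2 ∧
      B * (3 * p.1 * f p ^ 2 + f p + 1) = p.1 * f p ^ 2 + f p - 1 ∧
      XA * (3 * p.1 * f p ^ 2 + f p + 1)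
        = -2 * p.1 * f p ^ 2 * (1 + 2 * A) - A * (3 * p.1 * f p ^ 2 * (1 + 2 * A) + A * f p) ∧
      XB * (3 * p.1 * f p ^ 2 + f p + 1)
        = p.1 * f p ^ 2 * (1 + 2 * A) + A * f p
          - B * (3 * p.1 * f p ^ 2 * (1 + 2 * A) + A * f p) ∧
      YB * (3 * p.1 * f p ^ 2 + f p + 1)
        = p.1 * f p ^ 2 * (2 * B) + B * f p - B * (3 * p.1 * f p ^ 2 * (2 * B) + B * f p) ∧
      thetaX E p = r * A * E p ∧ thetaY E p = r * B * E p ∧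
      thetaX (thetaX E) p = (r * XA + r ^ 2 * A ^ 2) * E p ∧
      thetaX (thetaY E) p = (r * XB + r ^ 2 * A * B) * E p ∧
      thetaY (thetaY E) p = (r * YB + r ^ 2 * B ^ 2) * E p := by
    rintro p hp E rfl
    have hfd := (hf p hp).differentiableAt
    have hXL := (analyticAt_thetaX (hL p hp)).differentiableAt
    have hYL := (analyticAt_thetaY (hL p hp)).differentiableAt
    have hEd := (hF p hp).differentiableAt
    obtain ⟨hS, hA, hB, hfX, hfY⟩ := key p hp
    have h1 : ∀ q ∈ U, thetaX (fun p => Complex.exp (r * L p)) q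
        = r * (thetaX L q * Complex.exp (r * L q)) := fun q hq => by
      have := (hL q hq).differentiableAt
      rw [thetaX_cexp (this.const_mul r), thetaX_const_mul _ this]; ring
    have h2 : ∀ q ∈ U, thetaY (fun p => Complex.exp (r * L p)) q
        = r * (thetaY L q * Complex.exp (r * L q)) := fun q hq => by
      have := (hL q hq).differentiableAt
      rw [thetaY_cexp (this.const_mul r), thetaY_const_mul _ this]; ring
    have e1 := eventually_of_mem (hU.mem_nhds hp) h1
    have e2 := eventually_of_mem (hU.mem_nhds hp) h2
    have hA' : (fun q => thetaX L q * (3 * (q.1 * (f q * f q)) + f q + 1)) =ᶠ[𝓝 p]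
        fun q => -2 * (q.1 * (f q * f q)) :=
      eventually_of_mem (hU.mem_nhds hp) fun q hq => by
        have := (key q hq).2.1
        simp only; linear_combination this
    have hB' : (fun q => thetaY L q * (3 * (q.1 * (f q * f q)) + f q + 1)) =ᶠ[𝓝 p]
        fun q => (q.1 * (f q * f q) + f q) + (-1) :=
      eventually_of_mem (hU.mem_nhds hp) fun q hq => by
        have := (key q hq).2.2.1
        simp only; linear_combination this
    have hff : DifferentiableAt ℂ (fun q => f q * f q) p := by fun_prop
    have hu : DifferentiableAt ℂ (fun q : ℂ × ℂ => q.1 * (f q * f q)) p := by fun_prop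
    have huf : DifferentiableAt ℂ (fun q : ℂ × ℂ => q.1 * (f q * f q) + f q) p := by fun_prop
    have h3u : DifferentiableAt ℂ (fun q : ℂ × ℂ => 3 * (q.1 * (f q * f q))) p := by fun_prop
    have h3uf : DifferentiableAt ℂ (fun q : ℂ × ℂ => 3 * (q.1 * (f q * f q)) + f q) p := by
      fun_prop
    have hSd : DifferentiableAt ℂ (fun q : ℂ × ℂ => 3 * (q.1 * (f q * f q)) + f q + 1) p := by
      fun_prop
    have hfst : DifferentiableAt ℂ (fun q : ℂ × ℂ => q.1) p := by fun_prop
    have hc : ∀ c : ℂ, DifferentiableAt ℂ (fun _ : ℂ × ℂ => c) p := fun c => by fun_prop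
    have hXA := thetaX_congr hA'
    have hXB := thetaX_congr hB'
    have hYB := thetaY_congr hB'
    rw [thetaX_mul hXL hSd, thetaX_add h3uf (hc 1), thetaX_add h3u hfd, thetaX_const_mul _ hu,
      thetaX_const_mul _ hu, thetaX_mul hfst hff, thetaX_mul hfd hfd, thetaX_fst, thetaX_const,
      hfX] at hXA
    rw [thetaX_mul hYL hSd, thetaX_add h3uf (hc 1), thetaX_add huf (hc _), thetaX_add h3u hfd,
      thetaX_add hu hfd, thetaX_const_mul _ hu,
      thetaX_mul hfst hff, thetaX_mul hfd hfd, thetaX_fst, thetaX_const, thetaX_const,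
      hfX] at hXB
    rw [thetaY_mul hYL hSd, thetaY_add h3uf (hc 1), thetaY_add huf (hc _), thetaY_add h3u hfd,
      thetaY_add hu hfd, thetaY_const_mul _ hu,
      thetaY_mul hfst hff, thetaY_mul hfd hfd, thetaY_fst, thetaY_const, thetaY_const,
      hfY] at hYB
    refine ⟨thetaX L p, thetaY L p, thetaX (thetaX L) p, thetaX (thetaY L) p,
      thetaY (thetaY L) p, hA, hB, ?_, ?_, ?_, ?_, ?_, ?_, ?_, ?_⟩
    · linear_combination hXA
    · linear_combination hXB
    · linear_combination hYB
    · rw [h1 p hp]; ring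
    · rw [h2 p hp]; ring
    · rw [thetaX_congr e1, thetaX_const_mul _ (hXL.fun_mul hEd), thetaX_mul hXL hEd, h1 p hp]
      ring
    · rw [thetaX_congr e2, thetaX_const_mul _ (hYL.fun_mul hEd), thetaX_mul hYL hEd, h1 p hp]
      ring
    · rw [thetaY_congr e2, thetaY_const_mul _ (hYL.fun_mul hEd), thetaY_mul hYL hEd, h2 p hp]
      ring
  refine ⟨hF, fun p hp => ?_, fun p hp => ?_⟩
  · rw [horn_x_expand _ _ (hF p hp)]
    obtain ⟨A, B, XA, XB, YB, hA, hB, hXA, hXB, hYB, h1, h2, h3, h4, h5⟩ := main p hp _ rfl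
    rw [h1, h2, h3, h4, h5]
    exact (root_power_identities (hexp p hp ▸ Complex.exp_ne_zero _) (key p hp).1 rfl
      ((isQuarticRoot_iff p _).1 (hroot p hp)) hA hB hXA hXB hYB).1
  · rw [horn_y_expand _ _ _ (hF p hp)]
    obtain ⟨A, B, XA, XB, YB, hA, hB, hXA, hXB, hYB, h1, h2, h3, h4, h5⟩ := main p hp _ rfl
    rw [h1, h2, h3, h4, h5]
    exact (root_power_identities (hexp p hp ▸ Complex.exp_ne_zero _) (key p hp).1 rfl
      ((isQuarticRoot_iff p _).1 (hroot p hp)) hA hB hXA hXB hYB).2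

end HornH5

/-! ### Double power series: convergence, analyticity, termwise differentiation. -/

namespace HornH5

open Filter Topology
open Finset.HasAntidiagonal (antidiagonal)

/-- The sum of the double power series with coefficients `a`. -/
noncomputable def doubleSeries (a : ℕ × ℕ → ℂ) (p : ℂ × ℂ) : ℂ :=
  ∑' k : ℕ × ℕ, a k * p.1 ^ k.1 * p.2 ^ k.2

/-- The double power series with coefficients `a` converges absolutely for `|x|, |y| < R`. -/
def ConvergesBelow (R : ℝ) (a : ℕ × ℕ → ℂ) : Prop :=
  ∀ ρ : ℝ, 0 < ρ → ρ < R → Summable fun k : ℕ × ℕ => ‖a k‖ * ρ ^ (k.1 + k.2)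

theorem summable_geometric_double {ρ : ℝ} (h0 : 0 ≤ ρ) (h1 : ρ < 1) :
    Summable fun k : ℕ × ℕ => ρ ^ (k.1 + k.2) := by
  have := (summable_geometric_of_lt_one h0 h1).mul_of_nonneg (summable_geometric_of_lt_one h0 h1)
    (fun _ => by positivity) (fun _ => by positivity)
  exact this.congr fun k => by rw [pow_add]

theorem convergesBelow_of_bound {K C : ℝ} (hK : 0 < K) {a : ℕ × ℕ → ℂ}
    (h : ∀ k, ‖a k‖ ≤ C * K ^ (k.1 + k.2)) : ConvergesBelow K⁻¹ a := by
  intro ρ h0 h1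
  have hlt : K * ρ < 1 := by
    rwa [lt_inv_comm₀ h0 hK, ← one_div, lt_div_iff₀ h0] at h1
  refine Summable.of_nonneg_of_le (fun k => by positivity) (fun k => ?_)
    ((summable_geometric_double (by positivity) hlt).mul_left C)
  rw [mul_pow, ← mul_assoc]
  exact mul_le_mul_of_nonneg_right (h k) (by positivity)

section

variable {R : ℝ} {a : ℕ × ℕ → ℂ}

theorem ConvergesBelow.summable_norm (h : ConvergesBelow R a) {x y : ℂ} (hx : ‖x‖ < R)
    (hy : ‖y‖ < R) : Summable fun k : ℕ × ℕ => ‖a k * x ^ k.1 * y ^ k.2‖ := by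
  obtain ⟨ρ, h1, h2⟩ := exists_between (max_lt hx hy)
  have hρ : 0 < ρ := (norm_nonneg x).trans_lt ((le_max_left _ _).trans_lt h1)
  refine Summable.of_nonneg_of_le (fun k => norm_nonneg _) (fun k => ?_) (h ρ hρ h2)
  rw [norm_mul, norm_mul, norm_pow, norm_pow, mul_assoc, pow_add]
  have := (le_max_left ‖x‖ ‖y‖).trans h1.le
  have := (le_max_right ‖x‖ ‖y‖).trans h1.le
  gcongr

theorem ConvergesBelow.summable (h : ConvergesBelow R a) {x y : ℂ} (hx : ‖x‖ < R)
    (hy : ‖y‖ < R) : Summable fun k : ℕ × ℕ => a k * x ^ k.1 * y ^ k.2 :=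
  (h.summable_norm hx hy).of_norm

/-- A linear weight is absorbed by passing from `ρ` to a slightly larger `ρ (1 + δ)` still below
`R`. Hence the Euler operators act on coefficients without loss of radius. -/
theorem ConvergesBelow.weight (h : ConvergesBelow R a) (α β γ : ℂ) :
    ConvergesBelow R fun k => (α * k.1 + β * k.2 + γ) * a k := by
  intro ρ h0 h1
  obtain ⟨ρ', h2, h3⟩ := exists_between h1
  obtain ⟨δ, hδ, rfl⟩ : ∃ δ > 0, ρ' = ρ * (1 + δ) :=
    ⟨ρ' / ρ - 1, by rw [gt_iff_lt, sub_pos, one_lt_div h0]; exact h2, by field_simp; ring⟩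
  refine Summable.of_nonneg_of_le (fun k => by positivity) (fun k => ?_)
    ((h _ (h0.trans h2) h3).mul_left ((‖α‖ + ‖β‖ + ‖γ‖) * (1 + 1 / δ)))
  have e1 : ‖α * k.1 + β * k.2 + γ‖ ≤ (‖α‖ + ‖β‖ + ‖γ‖) * ((k.1 + k.2 : ℕ) + 1) := by
    refine (norm_add₃_le).trans ?_
    rw [norm_mul, norm_mul, Complex.norm_natCast, Complex.norm_natCast]
    push_cast
    have := norm_nonneg α
    have := norm_nonneg β
    have := norm_nonneg γ
    have : (0 : ℝ) ≤ k.1 := by positivity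
    have : (0 : ℝ) ≤ k.2 := by positivity
    have : 0 ≤ ‖α‖ * k.2 := by positivity
    have : 0 ≤ ‖β‖ * k.1 := by positivity
    have : 0 ≤ ‖γ‖ * k.1 := by positivity
    have : 0 ≤ ‖γ‖ * k.2 := by positivity
    nlinarith
  -- Bernoulli's inequality, `(1 + δ)^N ≥ 1 + N δ`.
  have e2 : ((k.1 + k.2 : ℕ) : ℝ) + 1 ≤ (1 + 1 / δ) * (1 + δ) ^ (k.1 + k.2) := by
    have := one_add_mul_le_pow (show (-2 : ℝ) ≤ δ by linarith) (k.1 + k.2)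
    calc ((k.1 + k.2 : ℕ) : ℝ) + 1
        ≤ (1 + 1 / δ) * (1 + (k.1 + k.2 : ℕ) * δ) := by
          have h5 : (1 + 1 / δ) * (1 + ((k.1 + k.2 : ℕ) : ℝ) * δ)
            = (k.1 + k.2 : ℕ) + 1 + ((k.1 + k.2 : ℕ) * δ + 1 / δ) := by field_simp; ring
          rw [h5]
          have : 0 ≤ ((k.1 + k.2 : ℕ) : ℝ) * δ + 1 / δ := by positivity
          linarith
      _ ≤ _ := by gcongr
  rw [norm_mul, mul_pow]
  calc ‖α * k.1 + β * k.2 + γ‖ * ‖a k‖ * ρ ^ (k.1 + k.2)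
      ≤ ((‖α‖ + ‖β‖ + ‖γ‖) * ((1 + 1 / δ) * (1 + δ) ^ (k.1 + k.2))) * ‖a k‖
        * ρ ^ (k.1 + k.2) := by
        gcongr
        exact e1.trans (by gcongr)
    _ = _ := by ring

/-- The monomial `x ^ m y ^ (N - m)` as a multilinear map. -/
noncomputable def monomialMultilinear (N m : ℕ) : (ℂ × ℂ) [×N]→L[ℂ] ℂ :=
  (ContinuousMultilinearMap.mkPiAlgebra ℂ (Fin N) ℂ).compContinuousLinearMap fun i =>
    if (i : ℕ) < m then ContinuousLinearMap.fst ℂ ℂ ℂ else ContinuousLinearMap.snd ℂ ℂ ℂ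

theorem monomialMultilinear_apply (m n : ℕ) (q : ℂ × ℂ) :
    monomialMultilinear (m + n) m (fun _ => q) = q.1 ^ m * q.2 ^ n := by
  have : monomialMultilinear (m + n) m (fun _ => q)
      = ∏ i : Fin (m + n), if (i : ℕ) < m then q.1 else q.2 := by
    simp only [monomialMultilinear, ContinuousMultilinearMap.compContinuousLinearMap_apply,
      ContinuousMultilinearMap.mkPiAlgebra_apply]
    refine Finset.prod_congr rfl fun i _ => ?_
    split_ifs <;> rfl
  rw [this, Fin.prod_univ_eq_prod_range (fun i => if i < m then q.1 else q.2),
    Finset.prod_range_add]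
  congr 1
  · rw [Finset.prod_congr rfl (g := fun _ => q.1)]
    · simp
    · intro i hi
      rw [if_pos (Finset.mem_range.1 hi)]
  · simp

theorem norm_monomialMultilinear_le (N m : ℕ) : ‖monomialMultilinear N m‖ ≤ 1 := by
  refine (ContinuousMultilinearMap.norm_compContinuousLinearMap_le _ _).trans ?_
  rw [ContinuousMultilinearMap.norm_mkPiAlgebra, one_mul]
  refine Finset.prod_le_one (fun _ _ => norm_nonneg _) fun i _ => ?_
  split_ifs
  · exact ContinuousLinearMap.norm_fst_le ℂ ℂ ℂ
  · exact ContinuousLinearMap.norm_snd_le ℂ ℂ ℂ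

/-- The formal multilinear series of a double power series. -/
noncomputable def doubleFormalSeries (a : ℕ × ℕ → ℂ) : FormalMultilinearSeries ℂ (ℂ × ℂ) ℂ :=
  fun N => ∑ k ∈ antidiagonal N, a k • monomialMultilinear N k.1

theorem doubleFormalSeries_apply (a : ℕ × ℕ → ℂ) (N : ℕ) (q : ℂ × ℂ) :
    doubleFormalSeries a N (fun _ => q)
      = ∑ k ∈ antidiagonal N, a k * q.1 ^ k.1 * q.2 ^ k.2 := by
  simp only [doubleFormalSeries, sum_apply,
    smul_apply, smul_eq_mul]
  refine Finset.sum_congr rfl fun k hk => ?_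
  obtain rfl := (Finset.HasAntidiagonal.mem_antidiagonal.1 hk)
  rw [monomialMultilinear_apply, mul_assoc]

theorem norm_doubleFormalSeries_le (a : ℕ × ℕ → ℂ) (N : ℕ) :
    ‖doubleFormalSeries a N‖ ≤ ∑ k ∈ antidiagonal N, ‖a k‖ := by
  refine (norm_sum_le _ _).trans (Finset.sum_le_sum fun k _ => ?_)
  rw [norm_smul]
  exact mul_le_of_le_one_right (norm_nonneg _) (norm_monomialMultilinear_le _ _)

theorem hasSum_antidiagonal {E : Type*} [NormedAddCommGroup E] {g : ℕ × ℕ → E} {s : E}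
    (h : HasSum g s) : HasSum (fun N => ∑ k ∈ antidiagonal N, g k) s := by
  have h' := Finset.HasAntidiagonal.sigmaAntidiagonalEquivProd.hasSum_iff.2 h
  refine h'.sigma fun N => ?_
  have := hasSum_fintype fun c : antidiagonal N => g c
  rwa [Finset.univ_eq_attach, Finset.sum_attach] at this

/-- Terms are grouped by total degree. The norm on `ℂ × ℂ` is the maximum norm, so the polydisc is a
ball and each monomial has multilinear norm at most `1`. -/
theorem ConvergesBelow.hasFPowerSeriesOnBall (hR : 0 < R) (h : ConvergesBelow R a) :
    HasFPowerSeriesOnBall (doubleSeries a) (doubleFormalSeries a) 0 (ENNReal.ofReal R) := by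
  refine ⟨?_, by simpa using hR, fun {q} hq => ?_⟩
  · refine ENNReal.le_of_forall_pos_nnreal_lt fun ρ h0 h1 => ?_
    have h1' : (ρ : ℝ) < R := by
      rwa [← ENNReal.ofReal_coe_nnreal, ENNReal.ofReal_lt_ofReal_iff hR] at h1
    refine FormalMultilinearSeries.le_radius_of_summable _ ?_
    refine Summable.of_nonneg_of_le (fun N => by positivity) (fun N => ?_)
      (hasSum_antidiagonal (h ρ (by exact_mod_cast h0) h1').hasSum).summable
    calc ‖doubleFormalSeries a N‖ * (ρ : ℝ) ^ N
        ≤ (∑ k ∈ antidiagonal N, ‖a k‖) * (ρ : ℝ) ^ N := by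
          gcongr; exact norm_doubleFormalSeries_le a N
      _ = _ := by
        rw [Finset.sum_mul]
        refine Finset.sum_congr rfl fun k hk => ?_
        rw [Finset.HasAntidiagonal.mem_antidiagonal.1 hk]
  · have hq' : ‖q‖ < R := by
      simpa [Metric.mem_eball] using hq
    have := hasSum_antidiagonal (h.summable ((norm_fst_le q).trans_lt hq')
      ((norm_snd_le q).trans_lt hq')).hasSum
    simpa only [doubleFormalSeries_apply, zero_add, doubleSeries] using this

theorem ConvergesBelow.analyticAt (h : ConvergesBelow R a) {p : ℂ × ℂ} (hx : ‖p.1‖ < R)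
    (hy : ‖p.2‖ < R) : AnalyticAt ℂ (doubleSeries a) p := by
  have hR : 0 < R := (norm_nonneg _).trans_lt hx
  refine (h.hasFPowerSeriesOnBall hR).analyticAt_of_mem ?_
  rw [Metric.mem_eball, edist_zero_right, ← ofReal_norm, ENNReal.ofReal_lt_ofReal_iff hR,
    Prod.norm_def]
  exact max_lt hx hy

theorem thetaX_doubleSeries (h : ConvergesBelow R a) {p : ℂ × ℂ} (hx : ‖p.1‖ < R)
    (hy : ‖p.2‖ < R) : thetaX (doubleSeries a) p = doubleSeries (fun k => k.1 * a k) p := by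
  obtain ⟨ρ, h1, h2⟩ := exists_between (max_lt hx hy)
  have hx' := (le_max_left _ _).trans_lt h1
  have hy' := (le_max_right _ _).trans_lt h1
  have hρ : 0 < ρ := (norm_nonneg _).trans_lt hx'
  -- A majorant of the differentiated series on `|t| < ρ`; the factor `ρ⁻¹` accounts for the
  -- exponent `m - 1`.
  have hw := ((h.weight 1 0 0) ρ hρ h2).mul_right ρ⁻¹
  have hd : HasDerivAt (fun t => doubleSeries a (t, p.2))
      (∑' k : ℕ × ℕ, a k * (k.1 * p.1 ^ (k.1 - 1)) * p.2 ^ k.2) p.1 := by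
    refine hasDerivAt_tsum_of_isPreconnected (t := Metric.ball 0 ρ)
      (g := fun (k : ℕ × ℕ) t => a k * t ^ k.1 * p.2 ^ k.2)
      (g' := fun k t => a k * (k.1 * t ^ (k.1 - 1)) * p.2 ^ k.2) hw Metric.isOpen_ball
      (convex_ball _ _).isPreconnected (fun k t _ => ?_) (fun k t ht => ?_)
      (y₀ := p.1) (by simpa using hx') (h.summable hx hy) (by simpa using hx')
    · exact ((hasDerivAt_pow k.1 t).const_mul (a k)).mul_const _
    · have ht' : ‖t‖ ≤ ρ := by simpa using (Metric.mem_ball.1 ht).le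
      obtain ⟨m, n⟩ := k
      rcases m with _ | m
      · simp
      · simp only [norm_mul, norm_pow, one_mul, zero_mul, add_zero, Nat.add_sub_cancel,
          Complex.norm_natCast]
        calc ‖a (m + 1, n)‖ * (((m + 1 : ℕ) : ℝ) * ‖t‖ ^ m) * ‖p.2‖ ^ n
            ≤ ‖a (m + 1, n)‖ * (((m + 1 : ℕ) : ℝ) * ρ ^ m) * ρ ^ n := by gcongr
          _ = _ := by
            field_simp
            ring
  rw [thetaX, hd.deriv, ← tsum_mul_left, doubleSeries]
  refine tsum_congr fun k => ?_
  obtain ⟨m, n⟩ := k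
  rcases m with _ | m
  · simp
  · simp only [Nat.add_sub_cancel]
    ring

theorem doubleSeries_swap (a : ℕ × ℕ → ℂ) (p : ℂ × ℂ) :
    doubleSeries a p = doubleSeries (fun k => a k.swap) p.swap := by
  rw [doubleSeries, doubleSeries, ← (Equiv.prodComm ℕ ℕ).tsum_eq]
  refine tsum_congr fun k => ?_
  simp only [Equiv.prodComm_apply, Prod.fst_swap, Prod.snd_swap]
  ring

theorem ConvergesBelow.swap (h : ConvergesBelow R a) : ConvergesBelow R fun k => a k.swap := by
  intro ρ h0 h1
  refine ((Equiv.prodComm ℕ ℕ).summable_iff.2 (h ρ h0 h1)).congr fun k => ?_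
  simp [add_comm]

theorem thetaY_doubleSeries (h : ConvergesBelow R a) {p : ℂ × ℂ} (hx : ‖p.1‖ < R)
    (hy : ‖p.2‖ < R) : thetaY (doubleSeries a) p = doubleSeries (fun k => k.2 * a k) p := by
  have := thetaX_doubleSeries h.swap (p := p.swap) hy hx
  rw [doubleSeries_swap (fun k => k.2 * a k) p]
  simp only [Prod.snd_swap] at this ⊢
  rw [← this, thetaX, thetaY]
  congr 2
  funext t
  exact doubleSeries_swap a (p.1, t)

end

end HornH5

/-! ### Frobenius series and their recurrences. -/

namespace HornH5

open Filter Topology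

theorem isOpen_domY (ε : ℝ) : IsOpen (domY ε) :=
  (isOpen_lt continuous_fst.norm continuous_const).inter
    ((isOpen_lt continuous_snd.norm continuous_const).inter
      (Complex.isOpen_slitPlane.preimage continuous_snd))

theorem isOpen_domXY (ε : ℝ) : IsOpen (domXY ε) :=
  (isOpen_domY ε).inter (Complex.isOpen_slitPlane.preimage continuous_fst)

theorem analyticAt_cpow_const {z : ℂ} (hz : z ∈ Complex.slitPlane) (ρ : ℂ) :
    AnalyticAt ℂ (fun t : ℂ => t ^ ρ) z :=
  analyticAt_id.cpow analyticAt_const hz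

section Frobenius

variable {R : ℝ} {a : ℕ × ℕ → ℂ} {p : ℂ × ℂ}

/-- The Frobenius series `x ^ ρ y ^ σ ∑ a_{m,n} x ^ m y ^ n`. -/
noncomputable def frobenius (ρ σ : ℂ) (a : ℕ × ℕ → ℂ) (p : ℂ × ℂ) : ℂ :=
  p.1 ^ ρ * p.2 ^ σ * doubleSeries a p

theorem analyticAt_frobenius (ρ σ : ℂ) (h : ConvergesBelow R a) (hp : p ∈ domXY R) :
    AnalyticAt ℂ (frobenius ρ σ a) p :=
  (((analyticAt_cpow_const hp.2 ρ).comp analyticAt_fst).mul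
    ((analyticAt_cpow_const hp.1.2.2 σ).comp analyticAt_snd)).mul
      (h.analyticAt hp.1.1 hp.1.2.1)

theorem doubleSeries_combine (h : ConvergesBelow R a) (α β γ : ℂ) (hx : ‖p.1‖ < R)
    (hy : ‖p.2‖ < R) :
    α * doubleSeries (fun k => k.1 * a k) p + β * doubleSeries (fun k => k.2 * a k) p
      + γ * doubleSeries a p = doubleSeries (fun k => (α * k.1 + β * k.2 + γ) * a k) p := by
  have h1 : Summable fun k : ℕ × ℕ => (k.1 * a k) * p.1 ^ k.1 * p.2 ^ k.2 := by
    simpa using (h.weight 1 0 0).summable hx hy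
  have h2 : Summable fun k : ℕ × ℕ => (k.2 * a k) * p.1 ^ k.1 * p.2 ^ k.2 := by
    simpa using (h.weight 0 1 0).summable hx hy
  simp only [doubleSeries]
  rw [← tsum_mul_left, ← tsum_mul_left, ← tsum_mul_left,
    ← (h1.mul_left α).tsum_add (h2.mul_left β),
    ← ((h1.mul_left α).add (h2.mul_left β)).tsum_add ((h.summable hx hy).mul_left γ)]
  exact tsum_congr fun k => by ring

/-- The monomials `x^(m+ρ) y^(n+σ)` are joint eigenvectors of `θ_x` and `θ_y`, with eigenvalues `m +
ρ` and `n + σ`. -/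
theorem thetaLin_frobenius (ρ σ α β γ : ℂ) (h : ConvergesBelow R a) (hp : p ∈ domXY R) :
    thetaLin α β γ (frobenius ρ σ a) p
      = frobenius ρ σ (fun k => (α * (k.1 + ρ) + β * (k.2 + σ) + γ) * a k) p := by
  have hx := hp.1.1
  have hy := hp.1.2.1
  have hx0 : p.1 ≠ 0 := Complex.slitPlane_ne_zero hp.2
  have hy0 : p.2 ≠ 0 := Complex.slitPlane_ne_zero hp.1.2.2
  have d1 : DifferentiableAt ℂ (fun q : ℂ × ℂ => q.1 ^ ρ) p :=
    ((analyticAt_cpow_const hp.2 ρ).comp analyticAt_fst).differentiableAt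
  have d2 : DifferentiableAt ℂ (fun q : ℂ × ℂ => q.2 ^ σ) p :=
    ((analyticAt_cpow_const hp.1.2.2 σ).comp analyticAt_snd).differentiableAt
  have d3 : DifferentiableAt ℂ (doubleSeries a) p := (h.analyticAt hx hy).differentiableAt
  have c1 : p.1 * (ρ * p.1 ^ (ρ - 1)) = ρ * p.1 ^ ρ := by
    rw [Complex.cpow_sub _ _ hx0, Complex.cpow_one]; field_simp
  have c2 : p.2 * (σ * p.2 ^ (σ - 1)) = σ * p.2 ^ σ := by
    rw [Complex.cpow_sub _ _ hy0, Complex.cpow_one]; field_simp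
  have x1 : thetaX (fun q : ℂ × ℂ => q.1 ^ ρ) p = ρ * p.1 ^ ρ := by
    simp only [thetaX]
    have : HasDerivAt (fun t : ℂ => t ^ ρ) _ p.1 := (hasDerivAt_id p.1).cpow_const hp.2
    rw [this.deriv, ← c1]; simp
  have y1 : thetaY (fun q : ℂ × ℂ => q.1 ^ ρ) p = 0 := by simp [thetaY]
  have x2 : thetaX (fun q : ℂ × ℂ => q.2 ^ σ) p = 0 := by simp [thetaX]
  have y2 : thetaY (fun q : ℂ × ℂ => q.2 ^ σ) p = σ * p.2 ^ σ := by
    simp only [thetaY]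
    have : HasDerivAt (fun t : ℂ => t ^ σ) _ p.2 := (hasDerivAt_id p.2).cpow_const hp.1.2.2
    rw [this.deriv, ← c2]; simp
  have eX : thetaX (frobenius ρ σ a) p
      = p.1 ^ ρ * p.2 ^ σ * (ρ * doubleSeries a p + doubleSeries (fun k => k.1 * a k) p) := by
    change thetaX (fun q => q.1 ^ ρ * q.2 ^ σ * doubleSeries a q) p = _
    rw [thetaX_mul (d1.fun_mul d2) d3, thetaX_mul d1 d2, x1, x2, thetaX_doubleSeries h hx hy]
    ring
  have eY : thetaY (frobenius ρ σ a) p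
      = p.1 ^ ρ * p.2 ^ σ * (σ * doubleSeries a p + doubleSeries (fun k => k.2 * a k) p) := by
    change thetaY (fun q => q.1 ^ ρ * q.2 ^ σ * doubleSeries a q) p = _
    rw [thetaY_mul (d1.fun_mul d2) d3, thetaY_mul d1 d2, y1, y2, thetaY_doubleSeries h hx hy]
    ring
  have hc := doubleSeries_combine h α β (α * ρ + β * σ + γ) hx hy
  rw [thetaLin, eX, eY, frobenius, frobenius]
  have : (fun k : ℕ × ℕ => (α * (k.1 + ρ) + β * (k.2 + σ) + γ) * a k)
      = fun k : ℕ × ℕ => (α * k.1 + β * k.2 + (α * ρ + β * σ + γ)) * a k := by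
    funext k; ring
  rw [this, ← hc]
  ring

theorem ConvergesBelow.weight_shift (h : ConvergesBelow R a) (ρ σ α β γ : ℂ) :
    ConvergesBelow R fun k => (α * (k.1 + ρ) + β * (k.2 + σ) + γ) * a k := by
  have := h.weight α β (α * ρ + β * σ + γ)
  convert this using 3
  ring

theorem thetaLin_thetaLin_frobenius (ρ σ α β γ α' β' γ' : ℂ) (h : ConvergesBelow R a)
    (hp : p ∈ domXY R) :
    thetaLin α β γ (thetaLin α' β' γ' (frobenius ρ σ a)) p
      = frobenius ρ σ (fun k => (α * (k.1 + ρ) + β * (k.2 + σ) + γ)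
          * ((α' * (k.1 + ρ) + β' * (k.2 + σ) + γ') * a k)) p := by
  have he : thetaLin α' β' γ' (frobenius ρ σ a) =ᶠ[𝓝 p]
      frobenius ρ σ (fun k => (α' * (k.1 + ρ) + β' * (k.2 + σ) + γ') * a k) :=
    eventually_of_mem ((isOpen_domXY R).mem_nhds hp) fun q hq =>
      thetaLin_frobenius ρ σ α' β' γ' h hq
  rw [thetaLin_congr _ _ _ he, thetaLin_frobenius _ _ _ _ _ (h.weight_shift ρ σ α' β' γ') hp]

/-- The factor `x` of a Horn operator becomes an index shift. The terms with `m = 0` have no partner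
and must vanish, which is the origin of `hx0` in `isHornSolution_frobenius`. -/
theorem doubleSeries_eq_fst_mul {b d : ℕ × ℕ → ℂ} (h0 : ∀ n, b (0, n) = 0)
    (h1 : ∀ m n, b (m + 1, n) = d (m, n)) (p : ℂ × ℂ) :
    doubleSeries b p = p.1 * doubleSeries d p := by
  have hinj : Function.Injective fun k : ℕ × ℕ => (k.1 + 1, k.2) := by
    rintro ⟨m, n⟩ ⟨m', n'⟩ h; simpa using h
  rw [doubleSeries, ← hinj.tsum_eq, doubleSeries, ← tsum_mul_left]
  · refine tsum_congr fun k => ?_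
    rw [h1]; ring
  · rintro ⟨m, n⟩ hk
    rcases m with _ | m
    · simp [h0] at hk
    · exact ⟨(m, n), rfl⟩

theorem doubleSeries_eq_snd_mul {b d : ℕ × ℕ → ℂ} (h0 : ∀ m, b (m, 0) = 0)
    (h1 : ∀ m n, b (m, n + 1) = d (m, n)) (p : ℂ × ℂ) :
    doubleSeries b p = p.2 * doubleSeries d p := by
  rw [doubleSeries_swap b, doubleSeries_swap d,
    doubleSeries_eq_fst_mul (d := fun k => d k.swap) (fun n => h0 n) (fun m n => h1 n m)]
  rfl

/-- The Frobenius method for the Horn system: the two equations are first order recurrences. -/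
theorem isHornSolution_frobenius {A B c ρ σ : ℂ} (h : ConvergesBelow R a)
    (hx0 : ∀ n : ℕ, ρ * (-ρ + (n + σ) + B) * a (0, n) = 0)
    (hx1 : ∀ m n : ℕ, (m + 1 + ρ) * (-(m + 1 + ρ) + (n + σ) + B) * a (m + 1, n)
      = (2 * (m + ρ) + (n + σ) + A) * (2 * (m + ρ) + (n + σ) + A + 1) * a (m, n))
    (hy0 : ∀ m : ℕ, σ * (σ + c - 1) * a (m, 0) = 0)
    (hy1 : ∀ m n : ℕ, (n + 1 + σ) * (n + 1 + σ + c - 1) * a (m, n + 1)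
      = (2 * (m + ρ) + (n + σ) + A) * (-(m + ρ) + (n + σ) + B) * a (m, n)) :
    IsHornSolution A B c (domXY R) (frobenius ρ σ a) := by
  refine ⟨fun p hp => analyticAt_frobenius ρ σ h hp, fun p hp => ?_, fun p hp => ?_⟩
  · have hX : thetaX (thetaLin (-1) 1 B (frobenius ρ σ a)) p
        = thetaLin 1 0 0 (thetaLin (-1) 1 B (frobenius ρ σ a)) p := by simp [thetaLin]
    rw [hX, thetaLin_thetaLin_frobenius _ _ _ _ _ _ _ _ h hp,
      thetaLin_thetaLin_frobenius _ _ _ _ _ _ _ _ h hp, frobenius, frobenius,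
      doubleSeries_eq_fst_mul (d := fun k : ℕ × ℕ => (2 * (k.1 + ρ) + 1 * (k.2 + σ) + A)
          * ((2 * (k.1 + ρ) + 1 * (k.2 + σ) + (A + 1)) * a k))]
    · ring
    · intro n
      push_cast
      linear_combination hx0 n
    · intro m n
      push_cast
      linear_combination hx1 m n
  · have hY : thetaY (thetaLin 0 1 (c - 1) (frobenius ρ σ a)) p
        = thetaLin 0 1 0 (thetaLin 0 1 (c - 1) (frobenius ρ σ a)) p := by simp [thetaLin]
    rw [hY, thetaLin_thetaLin_frobenius _ _ _ _ _ _ _ _ h hp,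
      thetaLin_thetaLin_frobenius _ _ _ _ _ _ _ _ h hp, frobenius, frobenius,
      doubleSeries_eq_snd_mul (d := fun k : ℕ × ℕ => (2 * (k.1 + ρ) + 1 * (k.2 + σ) + A)
          * ((-1 * (k.1 + ρ) + 1 * (k.2 + σ) + B) * a k))]
    · ring
    · intro m
      push_cast
      linear_combination hy0 m
    · intro m n
      push_cast
      linear_combination hy1 m n

end Frobenius

end HornH5

/-! ### Growth of Pochhammer symbols. -/

namespace HornH5

open Filter Topology

section Poch

theorem poch_zero (b : ℂ) : poch b 0 = 1 := by simp [poch]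

theorem poch_succ (b : ℂ) (n : ℕ) : poch b (n + 1) = poch b n * (b + n) := by
  simp [poch, ascPochhammer_succ_eval]

theorem poch_succ_left (b : ℂ) (n : ℕ) : poch b (n + 1) = b * poch (b + 1) n := by
  simp [poch, ascPochhammer_succ_left, Polynomial.eval_comp]

theorem poch_ne_zero {b : ℂ} (hb : ∀ j : ℕ, b + j ≠ 0) (n : ℕ) : poch b n ≠ 0 := by
  induction n with
  | zero => simp [poch_zero]
  | succ n ih => rw [poch_succ]; exact mul_ne_zero ih (hb n)

/-- For an integer `M ≥ |b|` each factor satisfies `|b + j| ≤ M + j + 1`, so the product is at most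
`(M + n)! / M! = n! · binom(M + n, n)`. -/
theorem exists_norm_poch_le (b : ℂ) :
    ∃ C : ℝ, 0 < C ∧ ∀ n : ℕ, ‖poch b n‖ ≤ C * 2 ^ n * n.factorial := by
  obtain ⟨M, hM⟩ := exists_nat_ge ‖b‖
  refine ⟨2 ^ M, by positivity, fun n => ?_⟩
  have h1 : ‖poch b n‖ ≤ (M + n).descFactorial n := by
    induction n with
    | zero => simp [poch_zero]
    | succ n ih =>
      rw [poch_succ, norm_mul, ← add_assoc, Nat.succ_descFactorial_succ]
      push_cast
      rw [mul_comm]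
      refine mul_le_mul ?_ ih (norm_nonneg _) (by positivity)
      refine (norm_add_le _ _).trans ?_
      rw [Complex.norm_natCast]
      linarith
  refine h1.trans ?_
  have h2 : (M + n).choose n ≤ 2 ^ (M + n) := Nat.choose_le_two_pow _ _
  rw [Nat.descFactorial_eq_factorial_mul_choose, mul_comm, ← pow_add]
  push_cast
  gcongr
  exact_mod_cast h2

/-- Once `n ≥ 2|b| + 1`, the factor `|b + n|` is at least `(n + 1) / 2`, and induction runs. The
finitely many smaller `n` go into the constant, where nonvanishing is needed. -/
theorem exists_factorial_le_norm_poch {b : ℂ} (hb : ∀ j : ℕ, b + j ≠ 0) :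
    ∃ C : ℝ, 0 < C ∧ ∀ n : ℕ, (n.factorial : ℝ) ≤ C * 2 ^ n * ‖poch b n‖ := by
  obtain ⟨N, hN⟩ := exists_nat_ge (2 * ‖b‖ + 1)
  have hpos : ∀ n, 0 < ‖poch b n‖ := fun n => norm_pos_iff.2 (poch_ne_zero hb n)
  have hsmall : ∃ C : ℝ, 0 < C ∧ ∀ n ≤ N, (n.factorial : ℝ) ≤ C * 2 ^ n * ‖poch b n‖ := by
    refine ⟨∑ n ∈ Finset.range (N + 1), (n.factorial : ℝ) / ‖poch b n‖, ?_, fun n hn => ?_⟩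
    · exact Finset.sum_pos (fun n _ => div_pos (by positivity) (hpos n)) ⟨0, by simp⟩
    · have h1 : (n.factorial : ℝ) / ‖poch b n‖
          ≤ ∑ n ∈ Finset.range (N + 1), (n.factorial : ℝ) / ‖poch b n‖ :=
        Finset.single_le_sum (f := fun n => (n.factorial : ℝ) / ‖poch b n‖)
          (fun n _ => by positivity) (Finset.mem_range.2 (by omega))
      rw [div_le_iff₀ (hpos n)] at h1
      refine h1.trans ?_
      gcongr
      refine le_mul_of_one_le_right (Finset.sum_nonneg fun n _ => by positivity) ?_
      exact one_le_pow₀ (by norm_num)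
  obtain ⟨C, hC, h⟩ := hsmall
  refine ⟨C, hC, fun n => ?_⟩
  rcases le_total n N with hn | hn
  · exact h n hn
  · induction n, hn using Nat.le_induction with
    | base => exact h N le_rfl
    | succ n hn ih =>
      rw [poch_succ, norm_mul, Nat.factorial_succ, pow_succ]
      push_cast
      have h2 : ((n : ℝ) + 1) ≤ 2 * ‖b + n‖ := by
        have h3 : (n : ℝ) - ‖b‖ ≤ ‖b + n‖ := by
          have := norm_sub_norm_le (n : ℂ) (-b)
          rw [Complex.norm_natCast, norm_neg, sub_neg_eq_add, add_comm (n : ℂ)] at this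
          exact this
        have h4 : (N : ℝ) ≤ n := by exact_mod_cast hn
        linarith
      calc ((n : ℝ) + 1) * n.factorial ≤ (2 * ‖b + n‖) * (C * 2 ^ n * ‖poch b n‖) := by gcongr
        _ = _ := by ring

theorem poch_sub_self (b : ℂ) (n : ℕ) : poch (b - n) n = (-1) ^ n * poch (1 - b) n := by
  induction n with
  | zero => simp [poch_zero]
  | succ n ih =>
    rw [poch_succ_left, poch_succ]
    push_cast
    rw [show b - (n + 1) + 1 = b - (n : ℂ) by ring, ih]
    ring

theorem pochInt_natCast (b : ℂ) (n : ℕ) : pochInt b n = poch b n := rfl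

theorem pochInt_neg_natCast (b : ℂ) (n : ℕ) : pochInt b (-n) = (poch (b - n) n)⁻¹ := by
  rcases n with _ | n
  · simp [pochInt, poch_zero]
  · have : (-((n + 1 : ℕ) : ℤ)) = Int.negSucc n := rfl
    rw [this, pochInt]
    push_cast
    rfl

/-- `(b)_{k+1} = (b)_k (b + k)`. -/
theorem pochInt_add_one {b : ℂ} (hb : ∀ k : ℤ, b ≠ k) (k : ℤ) :
    pochInt b (k + 1) = pochInt b k * (b + k) := by
  rcases le_or_gt 0 k with hk | hk
  · lift k to ℕ using hk
    have : ((k : ℤ) + 1) = ((k + 1 : ℕ) : ℤ) := by push_cast; ring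
    rw [this, pochInt_natCast, pochInt_natCast, poch_succ]
    push_cast; rfl
  · obtain ⟨n, rfl⟩ : ∃ n : ℕ, k = -((n + 1 : ℕ) : ℤ) := ⟨(-k - 1).toNat, by push_cast; omega⟩
    have : (-((n + 1 : ℕ) : ℤ)) + 1 = -(n : ℤ) := by push_cast; ring
    rw [this, pochInt_neg_natCast, pochInt_neg_natCast, poch_succ_left, mul_inv]
    push_cast
    have h0 : b - (n + 1) ≠ 0 := by
      have := hb (n + 1 : ℤ)
      push_cast at this
      exact sub_ne_zero.2 this
    rw [show b - (n + 1) + 1 = b - (n : ℂ) by ring, ← sub_eq_add_neg, mul_right_comm,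
      inv_mul_cancel₀ h0, one_mul]

theorem add_nat_ne_zero {b : ℂ} (hb : ∀ k : ℤ, b ≠ k) (j : ℕ) : b + j ≠ 0 := by
  have := hb (-j)
  push_cast at this
  intro h
  exact this (by linear_combination h)

/-- Up to a geometric factor, `(b)_{n-m}` is bounded by `n! / m!` for either sign of `n - m`. For `n
< m` the reflection `poch_sub_self` reduces the claim to the lower bound for `(1 - b)_{m-n}`. -/
theorem exists_norm_pochInt_le {b : ℂ} (hb : ∀ k : ℤ, b ≠ k) :
    ∃ C : ℝ, 0 < C ∧ ∀ m n : ℕ, ‖pochInt b ((n : ℤ) - m)‖ * m.factorial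
      ≤ C * 4 ^ (m + n) * n.factorial := by
  obtain ⟨C₁, hC₁, h₁⟩ := exists_norm_poch_le b
  have hb' : ∀ j : ℕ, (1 - b) + j ≠ 0 := fun j h => by
    have := hb (j + 1)
    push_cast at this
    exact this (by linear_combination -h)
  obtain ⟨C₂, hC₂, h₂⟩ := exists_factorial_le_norm_poch hb'
  refine ⟨C₁ + C₂, by positivity, fun m n => ?_⟩
  rcases le_total m n with h | h
  · obtain ⟨k, rfl⟩ := Nat.exists_eq_add_of_le h
    have : ((m + k : ℕ) : ℤ) - m = k := by push_cast; ring
    rw [this, pochInt_natCast]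
    have h3 : k.factorial * m.factorial ≤ (m + k).factorial := by
      rw [mul_comm]; exact Nat.le_of_dvd (Nat.factorial_pos _)
        (Nat.factorial_mul_factorial_dvd_factorial_add m k)
    have h3' : (k.factorial : ℝ) * m.factorial ≤ (m + k).factorial := by exact_mod_cast h3
    calc ‖poch b k‖ * m.factorial ≤ C₁ * 2 ^ k * k.factorial * m.factorial := by
          gcongr; exact h₁ k
      _ = C₁ * 2 ^ k * (k.factorial * m.factorial) := by ring
      _ ≤ (C₁ + C₂) * 4 ^ (m + (m + k)) * (m + k).factorial := by
        gcongr
        · linarith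
        · calc (2 : ℝ) ^ k ≤ 4 ^ k := by gcongr; norm_num
            _ ≤ 4 ^ (m + (m + k)) := pow_le_pow_right₀ (by norm_num) (by omega)
  · obtain ⟨k, rfl⟩ := Nat.exists_eq_add_of_le h
    have : (n : ℤ) - ((n + k : ℕ) : ℤ) = -k := by push_cast; ring
    rw [this, pochInt_neg_natCast, poch_sub_self, norm_inv, norm_mul, norm_pow, norm_neg, norm_one,
      one_pow, one_mul]
    have hpos : 0 < ‖poch (1 - b) k‖ := norm_pos_iff.2 (poch_ne_zero hb' k)
    rw [inv_mul_le_iff₀ hpos]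
    have h4 : (n + k).factorial = (n + k).choose k * (n.factorial * k.factorial) := by
      rw [← Nat.add_choose_mul_factorial_mul_factorial n k]; ring
    have h5 : (n + k).choose k ≤ 2 ^ (n + k) := Nat.choose_le_two_pow _ _
    have h5' : ((n + k).choose k : ℝ) ≤ 2 ^ (n + k) := by exact_mod_cast h5
    rw [h4]
    push_cast
    calc ((n + k).choose k : ℝ) * (n.factorial * k.factorial)
        ≤ 2 ^ (n + k) * (n.factorial * (C₂ * 2 ^ k * ‖poch (1 - b) k‖)) := by
          gcongr; exact h₂ k
      _ = ‖poch (1 - b) k‖ * (C₂ * (2 ^ (n + k) * 2 ^ k) * n.factorial) := by ring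
      _ ≤ _ := by
        gcongr
        · linarith
        · calc (2 : ℝ) ^ (n + k) * 2 ^ k ≤ 2 ^ (n + k) * 2 ^ (n + k) := by
                gcongr
                · norm_num
                · omega
            _ = 4 ^ (n + k) := by rw [← mul_pow]; norm_num
            _ ≤ _ := pow_le_pow_right₀ (by norm_num) (by omega)

/-- The multinomial coefficient is `binom(2m+n, n) · binom(2m, m)`, and each binomial is bounded by
a power of `2`. -/
theorem factorial_two_mul_add_le (m n : ℕ) :
    ((2 * m + n).factorial : ℝ) ≤ 16 ^ m * 2 ^ n * (m.factorial * m.factorial * n.factorial) := by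
  have h1 : (2 * m + n).factorial
      = (2 * m + n).choose n * ((2 * m).choose m * (m.factorial * m.factorial) * n.factorial) := by
    have e2 := Nat.add_choose_mul_factorial_mul_factorial (2 * m) n
    have e1 := Nat.add_choose_mul_factorial_mul_factorial m m
    rw [← two_mul] at e1
    rw [← e2, ← e1]
    ring
  have h2 : (2 * m + n).choose n ≤ 2 ^ (2 * m + n) := Nat.choose_le_two_pow _ _
  have h3 : (2 * m).choose m ≤ 2 ^ (2 * m) := Nat.choose_le_two_pow _ _
  have h4 : (2 * m + n).factorial
      ≤ 2 ^ (2 * m + n) * (2 ^ (2 * m) * (m.factorial * m.factorial) * n.factorial) := by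
    rw [h1]; gcongr
  have h5 : ((2 * m + n).factorial : ℝ)
      ≤ 2 ^ (2 * m + n) * (2 ^ (2 * m) * (m.factorial * m.factorial) * n.factorial) := by
    exact_mod_cast h4
  refine h5.trans_eq ?_
  rw [pow_add, pow_mul, show (16 : ℝ) = 2 ^ 2 * 2 ^ 2 by norm_num, mul_pow]
  ring

end Poch

end HornH5

/-! ### Coefficients of the four series and their recurrences. -/

namespace HornH5

open Filter Topology

section Coefficients

/-- The coefficients of Horn's series `H₅(a, b, c | x, y)`. -/
noncomputable def h5Coeff (a b c : ℂ) (k : ℕ × ℕ) : ℂ :=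
  poch a (2 * k.1 + k.2) * pochInt b ((k.2 : ℤ) - (k.1 : ℤ))
    / (poch c k.2 * (k.1.factorial : ℂ) * (k.2.factorial : ℂ))

/-- The coefficients, in powers of `x` and `y`, of
`∑ (e)_{2m+3n} / ((c)_n (d)_{m+n} m! n!) (-x) ^ m (x y) ^ n`. -/
noncomputable def coneCoeff (e d c : ℂ) (k : ℕ × ℕ) : ℂ :=
  if k.2 ≤ k.1 then
    (-1) ^ (k.1 - k.2) * poch e (2 * k.1 + k.2)
      / (poch c k.2 * poch d k.1 * ((k.1 - k.2).factorial : ℂ) * (k.2.factorial : ℂ))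
  else 0

/-- All factorials cancel. The parameters affect only the constant `C₁ C₂ C₃`, while the rate `256 =
2² · 16 · 4` in `x` (and `32` in `y`) is universal; this makes `ε` independent of `r`. -/
theorem convergesBelow_h5Coeff (a : ℂ) {b c : ℂ} (hb : ∀ k : ℤ, b ≠ k)
    (hc : ∀ j : ℕ, c + j ≠ 0) : ConvergesBelow 256⁻¹ (h5Coeff a b c) := by
  obtain ⟨C₁, hC₁, h₁⟩ := exists_norm_poch_le a
  obtain ⟨C₂, hC₂, h₂⟩ := exists_norm_pochInt_le hb
  obtain ⟨C₃, hC₃, h₃⟩ := exists_factorial_le_norm_poch hc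
  refine convergesBelow_of_bound (C := C₁ * C₂ * C₃) (by norm_num) fun ⟨m, n⟩ => ?_
  have hpos : 0 < ‖poch c n‖ := norm_pos_iff.2 (poch_ne_zero hc n)
  simp only [h5Coeff, norm_div, norm_mul, Complex.norm_natCast]
  rw [div_le_iff₀ (by positivity)]
  have h4 := factorial_two_mul_add_le m n
  have hm : (0 : ℝ) < m.factorial := by positivity
  have hn : (0 : ℝ) < n.factorial := by positivity
  refine le_of_mul_le_mul_right ?_ (mul_pos hm hn)
  calc ‖poch a (2 * m + n)‖ * ‖pochInt b ((n : ℤ) - m)‖ * (m.factorial * n.factorial)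
      = ‖poch a (2 * m + n)‖ * (‖pochInt b ((n : ℤ) - m)‖ * m.factorial) * n.factorial := by ring
    _ ≤ (C₁ * 2 ^ (2 * m + n)
          * (16 ^ m * 2 ^ n * (m.factorial * m.factorial * n.factorial)))
        * (C₂ * 4 ^ (m + n) * n.factorial) * (C₃ * 2 ^ n * ‖poch c n‖) := by
        exact mul_le_mul (mul_le_mul ((h₁ _).trans (by gcongr)) (h₂ m n) (by positivity)
          (by positivity)) (h₃ n) (by positivity) (by positivity)
    _ = C₁ * C₂ * C₃ * (256 ^ m * 32 ^ n)
        * (‖poch c n‖ * m.factorial * n.factorial) * (m.factorial * n.factorial) := by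
        rw [pow_add, pow_add, pow_mul, show (256 : ℝ) = 2 ^ 2 * 16 * 4 by norm_num,
          show (32 : ℝ) = 2 * 2 * 4 * 2 by norm_num]
        simp only [mul_pow]
        ring
    _ ≤ _ := by
        rw [pow_add]
        gcongr
        norm_num

theorem convergesBelow_coneCoeff (e : ℂ) {d c : ℂ} (hd : ∀ j : ℕ, d + j ≠ 0)
    (hc : ∀ j : ℕ, c + j ≠ 0) : ConvergesBelow 256⁻¹ (coneCoeff e d c) := by
  obtain ⟨C₁, hC₁, h₁⟩ := exists_norm_poch_le e
  obtain ⟨C₂, hC₂, h₂⟩ := exists_factorial_le_norm_poch hd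
  obtain ⟨C₃, hC₃, h₃⟩ := exists_factorial_le_norm_poch hc
  refine convergesBelow_of_bound (C := C₁ * C₂ * C₃) (by norm_num) fun ⟨M, n⟩ => ?_
  rw [coneCoeff]
  split_ifs with h
  swap
  · rw [norm_zero]; positivity
  simp only at h ⊢
  have hpos : 0 < ‖poch c n‖ := norm_pos_iff.2 (poch_ne_zero hc n)
  have hpos' : 0 < ‖poch d M‖ := norm_pos_iff.2 (poch_ne_zero hd M)
  simp only [norm_div, norm_mul, Complex.norm_natCast, norm_pow, norm_neg, norm_one, one_pow,
    one_mul]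
  rw [div_le_iff₀ (by positivity)]
  have h4 := factorial_two_mul_add_le M n
  have h5 : (M.factorial : ℝ) ≤ 2 ^ M * (n.factorial * (M - n).factorial) := by
    have := Nat.choose_mul_factorial_mul_factorial h
    rw [← this, mul_assoc]
    push_cast
    gcongr
    exact_mod_cast Nat.choose_le_two_pow M n
  calc ‖poch e (2 * M + n)‖
      ≤ C₁ * 2 ^ (2 * M + n)
          * (16 ^ M * 2 ^ n * (M.factorial * M.factorial * n.factorial)) :=
        (h₁ _).trans (by gcongr)
    _ ≤ C₁ * 2 ^ (2 * M + n)
          * (16 ^ M * 2 ^ n * ((2 ^ M * (n.factorial * (M - n).factorial))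
            * (C₂ * 2 ^ M * ‖poch d M‖) * (C₃ * 2 ^ n * ‖poch c n‖))) := by
        gcongr
        · exact h₂ M
        · exact h₃ n
    _ = C₁ * C₂ * C₃ * (256 ^ M * 8 ^ n)
        * (‖poch c n‖ * ‖poch d M‖ * (M - n).factorial * n.factorial) := by
        rw [pow_add, pow_mul, show (256 : ℝ) = 2 ^ 2 * 16 * 2 * 2 by norm_num,
          show (8 : ℝ) = 2 * 2 * 2 by norm_num]
        simp only [mul_pow]
        ring
    _ ≤ _ := by
        rw [pow_add]
        gcongr
        norm_num

/-- `hσ` is the indicial equation in `y`, with roots `0` and `1 - c'`. `hcσ` says that the shift by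
`σ` turns the lower parameter `c'` into `c`: for `c' = 1/2` it yields `1/2` and `3/2`. -/
theorem isHornSolution_h5 {A B c' σ a b c : ℂ} (ha : a = A + σ) (hb' : b = B + σ)
    (hσ : σ * (σ + c' - 1) = 0)
    (hcσ : ∀ t : ℂ, (t + 1 + σ) * (t + 1 + σ + c' - 1) = (c + t) * (t + 1))
    (hb : ∀ k : ℤ, b ≠ k) (hc : ∀ j : ℕ, c + j ≠ 0) :
    IsHornSolution A B c' (domXY 256⁻¹) (frobenius 0 σ (h5Coeff a b c)) := by
  refine isHornSolution_frobenius (convergesBelow_h5Coeff a hb hc) (fun n => by simp)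
    (fun m n => ?_) (fun m => by rw [hσ, zero_mul]) (fun m n => ?_)
  · have hp : pochInt b ((n : ℤ) - m)
        = pochInt b ((n : ℤ) - (m + 1 : ℕ)) * (b + (n - (m + 1))) := by
      have := pochInt_add_one hb ((n : ℤ) - (m + 1 : ℕ))
      rw [show (n : ℤ) - (m + 1 : ℕ) + 1 = n - m by push_cast; ring] at this
      rw [this]; push_cast; ring
    have hcn := poch_ne_zero hc n
    have hm : (m.factorial : ℂ) ≠ 0 := by exact_mod_cast m.factorial_ne_zero
    have hn : (n.factorial : ℂ) ≠ 0 := by exact_mod_cast n.factorial_ne_zero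
    have hm1 : (m : ℂ) + 1 ≠ 0 := by exact_mod_cast m.succ_ne_zero
    simp only [h5Coeff]
    rw [show 2 * (m + 1) + n = 2 * m + n + 1 + 1 by ring, poch_succ, poch_succ, hp,
      Nat.factorial_succ]
    push_cast
    rw [ha, hb']
    field_simp
    ring
  · have hp : pochInt b (((n + 1 : ℕ) : ℤ) - m) = pochInt b ((n : ℤ) - m) * (b + (n - m)) := by
      have := pochInt_add_one hb ((n : ℤ) - m)
      rw [show (n : ℤ) - m + 1 = (n + 1 : ℕ) - m by push_cast; ring] at this
      rw [this]; push_cast; ring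
    have hcn := poch_ne_zero hc n
    have hcn' := hc n
    have hm : (m.factorial : ℂ) ≠ 0 := by exact_mod_cast m.factorial_ne_zero
    have hn : (n.factorial : ℂ) ≠ 0 := by exact_mod_cast n.factorial_ne_zero
    have hn1 : (n : ℂ) + 1 ≠ 0 := by exact_mod_cast n.succ_ne_zero
    simp only [h5Coeff]
    rw [hcσ n, show 2 * m + (n + 1) = 2 * m + n + 1 by ring, poch_succ, poch_succ, hp,
      Nat.factorial_succ]
    push_cast
    rw [ha, hb']
    field_simp
    ring

/-- With the exponent `ρ = σ + B` the factor `-(m + ρ) + (n + σ) + B` is `n - m`. It vanishes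
exactly at the edge of the cone `n ≤ m`, so extending the coefficients by zero outside respects both
recurrences. -/
theorem isHornSolution_cone {A B c' ρ σ e d c : ℂ} (he : e = 2 * ρ + σ + A) (hd' : d = 1 + ρ)
    (hρ : -ρ + σ + B = 0) (hσ : σ * (σ + c' - 1) = 0)
    (hcσ : ∀ t : ℂ, (t + 1 + σ) * (t + 1 + σ + c' - 1) = (c + t) * (t + 1))
    (hd : ∀ j : ℕ, d + j ≠ 0) (hc : ∀ j : ℕ, c + j ≠ 0) :
    IsHornSolution A B c' (domXY 256⁻¹) (frobenius ρ σ (coneCoeff e d c)) := by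
  refine isHornSolution_frobenius (convergesBelow_coneCoeff e hd hc) (fun n => ?_)
    (fun m n => ?_) (fun m => by rw [hσ, zero_mul]) (fun m n => ?_)
  · rcases n with _ | n
    · rw [show -ρ + (((0 : ℕ) : ℂ) + σ) + B = 0 by push_cast; linear_combination hρ]; simp
    · simp [coneCoeff]
  · rcases lt_trichotomy n (m + 1) with h | h | h
    · obtain ⟨j, rfl⟩ := Nat.exists_eq_add_of_le (Nat.lt_succ_iff.1 h)
      have hcn := poch_ne_zero hc n
      have hdn := poch_ne_zero hd (n + j)
      have hdn' := hd (n + j)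
      have hj : (j.factorial : ℂ) ≠ 0 := by exact_mod_cast j.factorial_ne_zero
      have hn : (n.factorial : ℂ) ≠ 0 := by exact_mod_cast n.factorial_ne_zero
      have hj1 : (j : ℂ) + 1 ≠ 0 := by exact_mod_cast j.succ_ne_zero
      simp only [coneCoeff]
      rw [if_pos (by omega), if_pos (by omega), show n + j + 1 - n = j + 1 by omega,
        show n + j - n = j by omega, show 2 * (n + j + 1) + n = 2 * (n + j) + n + 1 + 1 by ring,
        poch_succ, poch_succ, poch_succ, Nat.factorial_succ, pow_succ,
        show -(((n + j : ℕ) : ℂ) + 1 + ρ) + (n + σ) + B = -(j + 1) by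
          push_cast; linear_combination hρ]
      push_cast at hdn' ⊢
      rw [show (n : ℂ) + j + 1 + ρ = d + (n + j) by rw [hd']; ring,
        show 2 * ((n : ℂ) + j + ρ) + (n + σ) + A = e + (2 * (n + j) + n) by rw [he]; ring]
      field_simp
      ring
    · subst h
      rw [show -((m : ℂ) + 1 + ρ) + (((m + 1 : ℕ) : ℂ) + σ) + B = 0 by
        push_cast; linear_combination hρ]
      simp [coneCoeff]
    · simp only [coneCoeff]
      rw [if_neg (by omega), if_neg (by omega)]
      simp
  · rcases lt_trichotomy n m with h | h | h
    · obtain ⟨j, rfl⟩ := Nat.exists_eq_add_of_lt h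
      have hcn := poch_ne_zero hc n
      have hcn' := hc n
      have hdn := poch_ne_zero hd (n + j + 1)
      have hj : (j.factorial : ℂ) ≠ 0 := by exact_mod_cast j.factorial_ne_zero
      have hn : (n.factorial : ℂ) ≠ 0 := by exact_mod_cast n.factorial_ne_zero
      have hj1 : (j : ℂ) + 1 ≠ 0 := by exact_mod_cast j.succ_ne_zero
      have hn1 : (n : ℂ) + 1 ≠ 0 := by exact_mod_cast n.succ_ne_zero
      simp only [coneCoeff]
      rw [if_pos (by omega), if_pos (by omega), hcσ n, show n + j + 1 - n = j + 1 by omega,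
        show n + j + 1 - (n + 1) = j by omega,
        show 2 * (n + j + 1) + (n + 1) = 2 * (n + j + 1) + n + 1 by ring,
        poch_succ e, poch_succ c, Nat.factorial_succ, Nat.factorial_succ, pow_succ,
        show -(((n + j + 1 : ℕ) : ℂ) + ρ) + (n + σ) + B = -(j + 1) by
          push_cast; linear_combination hρ]
      push_cast
      rw [show 2 * ((n : ℂ) + j + 1 + ρ) + (n + σ) + A = e + (2 * (n + j + 1) + n) by
        rw [he]; ring]
      field_simp
    · subst h
      rw [show -((n : ℂ) + ρ) + ((n : ℂ) + σ) + B = 0 by linear_combination hρ]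
      simp [coneCoeff]
    · simp only [coneCoeff]
      rw [if_neg (by omega), if_neg (by omega)]
      simp

/-- Since `(-x)^m (x y)^n = ± x^(m+n) y^n`, this change of index carries the series of `Φ₃` and `Φ₄`
onto the cone supporting `coneCoeff`. -/
theorem injective_cone : Function.Injective fun k : ℕ × ℕ => (k.1 + k.2, k.2) := by
  rintro ⟨m, n⟩ ⟨m', n'⟩ h
  simp only [Prod.mk.injEq] at h ⊢
  omega

theorem coneCoeff_term (e d c x y : ℂ) (k : ℕ × ℕ) :
    coneCoeff e d c (k.1 + k.2, k.2) * x ^ (k.1 + k.2) * y ^ k.2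
      = poch e (2 * k.1 + 3 * k.2)
        / (poch c k.2 * poch d (k.1 + k.2) * (k.1.factorial : ℂ) * (k.2.factorial : ℂ))
        * (-x) ^ k.1 * (x * y) ^ k.2 := by
  rw [coneCoeff, if_pos (by simp)]
  simp only [Nat.add_sub_cancel]
  rw [show 2 * (k.1 + k.2) + k.2 = 2 * k.1 + 3 * k.2 by ring, neg_pow x, mul_pow, pow_add]
  ring

theorem tsum_coneCoeff (e d c x y : ℂ) :
    ∑' k : ℕ × ℕ, poch e (2 * k.1 + 3 * k.2)
        / (poch c k.2 * poch d (k.1 + k.2) * (k.1.factorial : ℂ) * (k.2.factorial : ℂ))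
        * (-x) ^ k.1 * (x * y) ^ k.2 = doubleSeries (coneCoeff e d c) (x, y) := by
  rw [doubleSeries, ← injective_cone.tsum_eq (f := fun k : ℕ × ℕ =>
    coneCoeff e d c k * (x, y).1 ^ k.1 * (x, y).2 ^ k.2)]
  · exact tsum_congr fun k => (coneCoeff_term e d c x y k).symm
  · rintro ⟨M, n⟩ hk
    by_cases h : n ≤ M
    · exact ⟨(M - n, n), by simp [h]⟩
    · simp [coneCoeff, h] at hk

end Coefficients

/-! ### The functions `Φ₁, …, Φ₄` solve the system. -/

section Solutions

variable {r : ℂ}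

theorem ne_intCast_of_two_mul (hr : ∀ k : ℤ, 2 * r ≠ k) (s : ℤ) (k : ℤ) :
    -r + s / 2 ≠ k := fun h => by
  refine hr (s - 2 * k) ?_
  push_cast
  linear_combination -2 * h

theorem Phi1_eq (r : ℂ) : Phi1 r = frobenius 0 0 (h5Coeff r (-r) (1 / 2)) := by
  funext p
  simp only [frobenius, Complex.cpow_zero, one_mul]
  rfl

theorem Phi2_eq (r : ℂ) :
    Phi2 r = frobenius 0 (1 / 2) (h5Coeff (r + 1 / 2) (-r + 1 / 2) (3 / 2)) := by
  funext p
  simp only [frobenius, Complex.cpow_zero, one_mul]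
  rfl

theorem Phi3_eq (r : ℂ) : Phi3 r = frobenius (-r) 0 (coneCoeff (-r) (1 - r) (1 / 2)) := by
  funext p
  simp only [frobenius, Complex.cpow_zero, mul_one, Phi3]
  rw [← Prod.mk.eta (p := p), ← tsum_coneCoeff]
  rfl

theorem Phi4_eq (r : ℂ) : Phi4 r
    = frobenius (-r + 1 / 2) (1 / 2) (coneCoeff (3 / 2 - r) (3 / 2 - r) (3 / 2)) := by
  funext p
  rw [frobenius, ← Prod.mk.eta (p := p), ← tsum_coneCoeff, Phi4]
  congr 1
  refine tsum_congr fun k => ?_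
  rw [Phi4Term, mul_comm (poch (3 / 2 - r) (k.1 + k.2))]

theorem half_add_ne_zero (s : ℕ) (j : ℕ) : ((2 * s + 1 : ℕ) / 2 : ℂ) + j ≠ 0 := by
  have : ((2 * s + 1 : ℕ) / 2 : ℂ) + j = ((2 * s + 1 + 2 * j : ℕ) : ℂ) / 2 := by push_cast; ring
  rw [this]
  refine div_ne_zero ?_ two_ne_zero
  exact_mod_cast (by omega : 2 * s + 1 + 2 * j ≠ 0)

theorem one_half_add_ne_zero (j : ℕ) : (1 / 2 : ℂ) + j ≠ 0 := by
  simpa using half_add_ne_zero 0 j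

theorem three_halves_add_ne_zero (j : ℕ) : (3 / 2 : ℂ) + j ≠ 0 := by
  have := half_add_ne_zero 1 j
  norm_num at this ⊢
  exact this

/-- These are the parameters of the integer-index symbols in `Φ₁`, `Φ₂` and of the denominators in
`Φ₃`, `Φ₄`; no factor of theirs may vanish. -/
theorem parameters_ne_intCast (hr : ∀ k : ℤ, 2 * r ≠ k) :
    (∀ k : ℤ, -r ≠ k) ∧ (∀ k : ℤ, -r + 1 / 2 ≠ k) ∧ (∀ k : ℤ, 1 - r ≠ k) ∧
    (∀ k : ℤ, 3 / 2 - r ≠ k) := by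
  refine ⟨fun k h => ne_intCast_of_two_mul hr 0 k ?_, fun k h => ne_intCast_of_two_mul hr 1 k ?_,
    fun k h => ne_intCast_of_two_mul hr 2 k ?_, fun k h => ne_intCast_of_two_mul hr 3 k ?_⟩ <;>
  · push_cast; linear_combination h

theorem convergesBelow_Phi (hr : ∀ k : ℤ, 2 * r ≠ k) :
    ConvergesBelow 256⁻¹ (h5Coeff r (-r) (1 / 2)) ∧
    ConvergesBelow 256⁻¹ (h5Coeff (r + 1 / 2) (-r + 1 / 2) (3 / 2)) ∧
    ConvergesBelow 256⁻¹ (coneCoeff (-r) (1 - r) (1 / 2)) ∧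
    ConvergesBelow 256⁻¹ (coneCoeff (3 / 2 - r) (3 / 2 - r) (3 / 2)) := by
  obtain ⟨h1, h2, h3, h4⟩ := parameters_ne_intCast hr
  exact ⟨convergesBelow_h5Coeff _ h1 one_half_add_ne_zero,
    convergesBelow_h5Coeff _ h2 three_halves_add_ne_zero,
    convergesBelow_coneCoeff _ (add_nat_ne_zero h3) one_half_add_ne_zero,
    convergesBelow_coneCoeff _ (add_nat_ne_zero h4) three_halves_add_ne_zero⟩

theorem summable_terms (hr : ∀ k : ℤ, 2 * r ≠ k) {x y : ℂ} (hx : ‖x‖ < 256⁻¹)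
    (hy : ‖y‖ < 256⁻¹) :
    Summable (H5Term r (-r) (1 / 2) x y) ∧
    Summable (H5Term (r + 1 / 2) (-r + 1 / 2) (3 / 2) x y) ∧
    Summable (Phi3Term r x y) ∧ Summable (Phi4Term r x y) := by
  obtain ⟨h1, h2, h3, h4⟩ := convergesBelow_Phi hr
  refine ⟨h1.summable hx hy, h2.summable hx hy, ?_, ?_⟩
  · refine ((h3.summable hx hy).comp_injective injective_cone).congr fun k => ?_
    exact coneCoeff_term _ _ _ x y k
  · refine ((h4.summable hx hy).comp_injective injective_cone).congr fun k => ?_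
    refine (coneCoeff_term _ _ _ x y k).trans ?_
    rw [Phi4Term, mul_comm (poch (3 / 2 - r) (k.1 + k.2))]

theorem isHornSolution_Phi (hr : ∀ k : ℤ, 2 * r ≠ k) (i : Fin 4) :
    IsHornSolution r (-r) (1 / 2) (domXY 256⁻¹) (Phi r i) := by
  obtain ⟨h1, h2, h3, h4⟩ := parameters_ne_intCast hr
  fin_cases i
  · change IsHornSolution _ _ _ _ (Phi1 r)
    rw [Phi1_eq]
    exact isHornSolution_h5 (by ring) (by ring) (by ring) (fun t => by ring) h1
      one_half_add_ne_zero
  · change IsHornSolution _ _ _ _ (Phi2 r)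
    rw [Phi2_eq]
    exact isHornSolution_h5 (by ring) (by ring) (by ring) (fun t => by ring) h2
      three_halves_add_ne_zero
  · change IsHornSolution _ _ _ _ (Phi3 r)
    rw [Phi3_eq]
    exact isHornSolution_cone (by ring) (by ring) (by ring) (by ring) (fun t => by ring)
      (add_nat_ne_zero h3) one_half_add_ne_zero
  · change IsHornSolution _ _ _ _ (Phi4 r)
    rw [Phi4_eq]
    exact isHornSolution_cone (by ring) (by ring) (by ring) (by ring) (fun t => by ring)
      (add_nat_ne_zero h4) three_halves_add_ne_zero

end Solutions

end HornH5

/-! ### Solving the system for higher derivatives. -/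

namespace HornH5

open Filter Topology

section Pfaffian

theorem norm_mul_le_hundredth {x t : ℂ} (hx : ‖x‖ ≤ 1 / 100) : ‖x * t‖ ≤ 1 / 100 * ‖t‖ := by
  rw [norm_mul]; gcongr

/-- The Horn system determines the pure second derivatives near the origin. -/
theorem second_order_bound {x y p q₁ q₂ s₁ s₂ s₃ s₄ : ℂ} {N : ℝ} (hx : ‖x‖ ≤ 1 / 100)
    (hy : ‖y‖ ≤ 1 / 100) (hp : ‖p‖ ≤ N) (h₁ : ‖s₁‖ ≤ N) (h₂ : ‖s₂‖ ≤ N) (h₃ : ‖s₃‖ ≤ N)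
    (h₄ : ‖s₄‖ ≤ N) (e₁ : q₁ = p + s₁ - x * (4 * q₁ + 4 * p + q₂ + s₂))
    (e₂ : q₂ = s₃ + y * (-2 * q₁ + p + q₂ + s₄)) : ‖q₁‖ ≤ 4 * N ∧ ‖q₂‖ ≤ 4 * N := by
  have k₁ : ‖q₁‖ ≤ ‖p‖ + ‖s₁‖ + 1 / 100 * (4 * ‖q₁‖ + 4 * ‖p‖ + ‖q₂‖ + ‖s₂‖) := by
    have a1 : ‖4 * q₁ + 4 * p + q₂ + s₂‖ ≤ 4 * ‖q₁‖ + 4 * ‖p‖ + ‖q₂‖ + ‖s₂‖ := by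
      refine (norm_add₄_le).trans_eq ?_
      simp
    calc ‖q₁‖ = ‖p + s₁ - x * (4 * q₁ + 4 * p + q₂ + s₂)‖ := by rw [← e₁]
      _ ≤ ‖p + s₁‖ + ‖x * (4 * q₁ + 4 * p + q₂ + s₂)‖ := norm_sub_le _ _
      _ ≤ _ := add_le_add (norm_add_le _ _) ((norm_mul_le_hundredth hx).trans (by gcongr))
  have k₂ : ‖q₂‖ ≤ ‖s₃‖ + 1 / 100 * (2 * ‖q₁‖ + ‖p‖ + ‖q₂‖ + ‖s₄‖) := by
    have a1 : ‖-2 * q₁ + p + q₂ + s₄‖ ≤ 2 * ‖q₁‖ + ‖p‖ + ‖q₂‖ + ‖s₄‖ := by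
      refine (norm_add₄_le).trans_eq ?_
      simp
    calc ‖q₂‖ = ‖s₃ + y * (-2 * q₁ + p + q₂ + s₄)‖ := by rw [← e₂]
      _ ≤ ‖s₃‖ + ‖y * (-2 * q₁ + p + q₂ + s₄)‖ := norm_add_le _ _
      _ ≤ _ := add_le_add le_rfl ((norm_mul_le_hundredth hy).trans (by gcongr))
  have := norm_nonneg q₁
  have := norm_nonneg q₂
  have := norm_nonneg p
  constructor <;> linarith

/-- The differentiated Horn system determines the third derivatives near the origin. -/
theorem third_order_bound {x y t₁ t₂ t₃ t₄ s₁ s₂ s₃ s₄ s₅ s₆ s₇ s₈ : ℂ} {N : ℝ}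
    (hx : ‖x‖ ≤ 1 / 100) (hy : ‖y‖ ≤ 1 / 100) (h₁ : ‖s₁‖ ≤ N) (h₂ : ‖s₂‖ ≤ N) (h₃ : ‖s₃‖ ≤ N)
    (h₄ : ‖s₄‖ ≤ N) (h₅ : ‖s₅‖ ≤ N) (h₆ : ‖s₆‖ ≤ N) (h₇ : ‖s₇‖ ≤ N) (h₈ : ‖s₈‖ ≤ N)
    (e₁ : t₁ = t₂ + s₁ - x * (4 * t₁ + 4 * t₂ + t₃ + s₂))
    (e₂ : t₂ = t₃ + s₃ - x * (4 * t₂ + 4 * t₃ + t₄ + s₄))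
    (e₃ : t₃ = s₅ + y * (-2 * t₁ + t₂ + t₃ + s₆))
    (e₄ : t₄ = s₇ + y * (-2 * t₂ + t₃ + t₄ + s₈)) : ‖t₂‖ ≤ 10 * N ∧ ‖t₃‖ ≤ 10 * N := by
  have kx : ∀ {q p s q₂ s' : ℂ}, q = p + s - x * (4 * q + 4 * p + q₂ + s') →
      ‖q‖ ≤ ‖p‖ + ‖s‖ + 1 / 100 * (4 * ‖q‖ + 4 * ‖p‖ + ‖q₂‖ + ‖s'‖) := fun {q p s q₂ s'} e => by
    have a1 : ‖4 * q + 4 * p + q₂ + s'‖ ≤ 4 * ‖q‖ + 4 * ‖p‖ + ‖q₂‖ + ‖s'‖ := by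
      refine (norm_add₄_le).trans_eq ?_
      simp
    calc ‖q‖ = ‖p + s - x * (4 * q + 4 * p + q₂ + s')‖ := by rw [← e]
      _ ≤ ‖p + s‖ + ‖x * (4 * q + 4 * p + q₂ + s')‖ := norm_sub_le _ _
      _ ≤ _ := add_le_add (norm_add_le _ _) ((norm_mul_le_hundredth hx).trans (by gcongr))
  have ky : ∀ {q p s q₁ s' : ℂ}, q = s + y * (-2 * q₁ + p + q + s') →
      ‖q‖ ≤ ‖s‖ + 1 / 100 * (2 * ‖q₁‖ + ‖p‖ + ‖q‖ + ‖s'‖) := fun {q p s q₁ s'} e => by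
    have a1 : ‖-2 * q₁ + p + q + s'‖ ≤ 2 * ‖q₁‖ + ‖p‖ + ‖q‖ + ‖s'‖ := by
      refine (norm_add₄_le).trans_eq ?_
      simp
    calc ‖q‖ = ‖s + y * (-2 * q₁ + p + q + s')‖ := by rw [← e]
      _ ≤ ‖s‖ + ‖y * (-2 * q₁ + p + q + s')‖ := norm_add_le _ _
      _ ≤ _ := add_le_add le_rfl ((norm_mul_le_hundredth hy).trans (by gcongr))
  -- At `x = y = 0` the equations are triangular: `t₃` and `t₄` are known, then `t₂`, then `t₁`. For
  -- `|x|, |y| ≤ 1/100` the perturbation is small enough for the norm inequalities to close.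
  have k₁ := kx e₁
  have k₂ := kx e₂
  have k₃ := ky e₃
  have k₄ := ky e₄
  have := norm_nonneg t₁
  have := norm_nonneg t₂
  have := norm_nonneg t₃
  have := norm_nonneg t₄
  constructor <;> linarith

/-- `G₁, …, G₆` stand for `θ_x²F, θ_xθ_yF, θ_y²F, θ_xF, θ_yF, F`. The undifferentiated bracket on
the right comes from `θ_x x = x`; it is absent when the derivative is in the other variable. -/
theorem thetaX_horn_x {G₁ G₂ G₃ G₄ G₅ G₆ : ℂ × ℂ → ℂ} {p : ℂ × ℂ} (b c₁ c₂ c₃ : ℂ)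
    (h₁ : DifferentiableAt ℂ G₁ p) (h₂ : DifferentiableAt ℂ G₂ p)
    (h₃ : DifferentiableAt ℂ G₃ p) (h₄ : DifferentiableAt ℂ G₄ p)
    (h₅ : DifferentiableAt ℂ G₅ p) (h₆ : DifferentiableAt ℂ G₆ p) :
    thetaX (fun q => -1 * G₁ q + G₂ q + b * G₄ q + (-1) * (q.1 * (4 * G₁ q + 4 * G₂ q + G₃ q
        + c₁ * G₄ q + c₂ * G₅ q + c₃ * G₆ q))) p
      = -thetaX G₁ p + thetaX G₂ p + b * thetaX G₄ p
        - p.1 * (4 * G₁ p + 4 * G₂ p + G₃ p + c₁ * G₄ p + c₂ * G₅ p + c₃ * G₆ p)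
        - p.1 * (4 * thetaX G₁ p + 4 * thetaX G₂ p + thetaX G₃ p + c₁ * thetaX G₄ p
          + c₂ * thetaX G₅ p + c₃ * thetaX G₆ p) := by
  simp (disch := fun_prop) only [thetaX_add, thetaX_mul, thetaX_const, thetaX_fst]
  ring

theorem thetaY_horn_x {G₁ G₂ G₃ G₄ G₅ G₆ : ℂ × ℂ → ℂ} {p : ℂ × ℂ} (b c₁ c₂ c₃ : ℂ)
    (h₁ : DifferentiableAt ℂ G₁ p) (h₂ : DifferentiableAt ℂ G₂ p)
    (h₃ : DifferentiableAt ℂ G₃ p) (h₄ : DifferentiableAt ℂ G₄ p)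
    (h₅ : DifferentiableAt ℂ G₅ p) (h₆ : DifferentiableAt ℂ G₆ p) :
    thetaY (fun q => -1 * G₁ q + G₂ q + b * G₄ q + (-1) * (q.1 * (4 * G₁ q + 4 * G₂ q + G₃ q
        + c₁ * G₄ q + c₂ * G₅ q + c₃ * G₆ q))) p
      = -thetaY G₁ p + thetaY G₂ p + b * thetaY G₄ p
        - p.1 * (4 * thetaY G₁ p + 4 * thetaY G₂ p + thetaY G₃ p + c₁ * thetaY G₄ p
          + c₂ * thetaY G₅ p + c₃ * thetaY G₆ p) := by
  simp (disch := fun_prop) only [thetaY_add, thetaY_mul, thetaY_const, thetaY_fst]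
  ring

theorem thetaX_horn_y {G₁ G₂ G₃ G₄ G₅ G₆ : ℂ × ℂ → ℂ} {p : ℂ × ℂ} (b c₁ c₂ c₃ : ℂ)
    (h₁ : DifferentiableAt ℂ G₁ p) (h₂ : DifferentiableAt ℂ G₂ p)
    (h₃ : DifferentiableAt ℂ G₃ p) (h₄ : DifferentiableAt ℂ G₄ p)
    (h₅ : DifferentiableAt ℂ G₅ p) (h₆ : DifferentiableAt ℂ G₆ p) :
    thetaX (fun q => G₃ q + b * G₅ q + (-1) * (q.2 * (-2 * G₁ q + G₂ q + G₃ q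
        + c₁ * G₄ q + c₂ * G₅ q + c₃ * G₆ q))) p
      = thetaX G₃ p + b * thetaX G₅ p
        - p.2 * (-2 * thetaX G₁ p + thetaX G₂ p + thetaX G₃ p + c₁ * thetaX G₄ p
          + c₂ * thetaX G₅ p + c₃ * thetaX G₆ p) := by
  simp (disch := fun_prop) only [thetaX_add, thetaX_mul, thetaX_const, thetaX_snd]
  ring

theorem thetaY_horn_y {G₁ G₂ G₃ G₄ G₅ G₆ : ℂ × ℂ → ℂ} {p : ℂ × ℂ} (b c₁ c₂ c₃ : ℂ)
    (h₁ : DifferentiableAt ℂ G₁ p) (h₂ : DifferentiableAt ℂ G₂ p)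
    (h₃ : DifferentiableAt ℂ G₃ p) (h₄ : DifferentiableAt ℂ G₄ p)
    (h₅ : DifferentiableAt ℂ G₅ p) (h₆ : DifferentiableAt ℂ G₆ p) :
    thetaY (fun q => G₃ q + b * G₅ q + (-1) * (q.2 * (-2 * G₁ q + G₂ q + G₃ q
        + c₁ * G₄ q + c₂ * G₅ q + c₃ * G₆ q))) p
      = thetaY G₃ p + b * thetaY G₅ p
        - p.2 * (-2 * G₁ p + G₂ p + G₃ p + c₁ * G₄ p + c₂ * G₅ p + c₃ * G₆ p)
        - p.2 * (-2 * thetaY G₁ p + thetaY G₂ p + thetaY G₃ p + c₁ * thetaY G₄ p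
          + c₂ * thetaY G₅ p + c₃ * thetaY G₆ p) := by
  simp (disch := fun_prop) only [thetaY_add, thetaY_mul, thetaY_const, thetaY_snd]
  ring

/-- The derivatives that span the Horn system: `F, θ_x F, θ_y F, θ_x θ_y F`. -/
noncomputable def jet (F : ℂ × ℂ → ℂ) : Fin 4 → ℂ × ℂ → ℂ :=
  ![F, thetaX F, thetaY F, thetaX (thetaY F)]

theorem analyticAt_jet {F : ℂ × ℂ → ℂ} {p : ℂ × ℂ} (h : AnalyticAt ℂ F p) (i : Fin 4) :
    AnalyticAt ℂ (jet F i) p := by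
  fin_cases i
  · exact h
  · exact analyticAt_thetaX h
  · exact analyticAt_thetaY h
  · exact analyticAt_thetaX (analyticAt_thetaY h)

theorem jet_sum {F : Fin 4 → ℂ × ℂ → ℂ} {p : ℂ × ℂ} (c : Fin 4 → ℂ)
    (hF : ∀ i, AnalyticAt ℂ (F i) p) (j : Fin 4) :
    jet (fun q => ∑ i, c i * F i q) j p = ∑ i, c i * jet (F i) j p := by
  have hd := fun i => (hF i).differentiableAt
  fin_cases j
  · rfl
  · exact thetaX_sum c hd
  · exact thetaY_sum c hd
  · have he : thetaY (fun q => ∑ i, c i * F i q) =ᶠ[𝓝 p] fun q => ∑ i, c i * thetaY (F i) q := by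
      have : ∀ᶠ q in 𝓝 p, ∀ i, AnalyticAt ℂ (F i) q :=
        eventually_all.2 fun i => (hF i).eventually_analyticAt
      exact this.mono fun q hq => thetaY_sum c fun i => (hq i).differentiableAt
    exact (thetaX_congr he).trans
      (thetaX_sum c fun i => (analyticAt_thetaY (hF i)).differentiableAt)

theorem norm_lin₃_le {c₁ c₂ c₃ z₁ z₂ z₃ : ℂ} {K N : ℝ} (h₁ : ‖c₁‖ ≤ K) (h₂ : ‖c₂‖ ≤ K)
    (h₃ : ‖c₃‖ ≤ K) (k₁ : ‖z₁‖ ≤ N) (k₂ : ‖z₂‖ ≤ N) (k₃ : ‖z₃‖ ≤ N) :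
    ‖c₁ * z₁ + c₂ * z₂ + c₃ * z₃‖ ≤ 3 * (K * N) := by
  have hK : 0 ≤ K := (norm_nonneg _).trans h₁
  have : ∀ {c z : ℂ}, ‖c‖ ≤ K → ‖z‖ ≤ N → ‖c * z‖ ≤ K * N := fun hc hz => by
    rw [norm_mul]; exact mul_le_mul hc hz (norm_nonneg _) hK
  refine (norm_add₃_le).trans ?_
  linarith [this h₁ k₁, this h₂ k₂, this h₃ k₃]

theorem norm_lin₁_le {c z : ℂ} {K N : ℝ} (h : ‖c‖ ≤ K) (k : ‖z‖ ≤ N) :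
    ‖c * z‖ ≤ K * N := by
  rw [norm_mul]; exact mul_le_mul h k (norm_nonneg _) ((norm_nonneg _).trans h)

end Pfaffian

end HornH5

/-! ### A solution is determined by its four-component jet. -/

namespace HornH5

open Filter Topology

/-- A quantitative Pfaffian form: the jet is closed under `θ_x` and `θ_y`. The system itself gives
`θ_x²F` and `θ_y²F`; the system differentiated once gives both derivatives of `θ_xθ_yF`. Norm bounds
suffice for uniqueness, so the connection matrices are never written out. -/
theorem IsHornSolution.norm_theta_jet_le {a b c : ℂ} {U : Set (ℂ × ℂ)} {F : ℂ × ℂ → ℂ}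
    (hU : IsOpen U) (hF : IsHornSolution a b c U F) {p : ℂ × ℂ} (hp : p ∈ U)
    (hx : ‖p.1‖ ≤ 1 / 100) (hy : ‖p.2‖ ≤ 1 / 100) {K N : ℝ} (hK : 1 ≤ K)
    (kb : ‖b‖ ≤ K) (kc : ‖c - 1‖ ≤ K) (k₁ : ‖4 * a + 2‖ ≤ K) (k₂ : ‖2 * a + 1‖ ≤ K)
    (k₃ : ‖a * (a + 1)‖ ≤ K) (k₄ : ‖2 * b - a‖ ≤ K) (k₅ : ‖a + b‖ ≤ K) (k₆ : ‖a * b‖ ≤ K)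
    (hN : ∀ i, ‖jet F i p‖ ≤ N) (i : Fin 4) :
    ‖thetaX (jet F i) p‖ ≤ 12000 * K ^ 2 * N ∧ ‖thetaY (jet F i) p‖ ≤ 12000 * K ^ 2 * N := by
  have hA := hF.analytic p hp
  have n₀ : ‖F p‖ ≤ N := hN 0
  have n₁ : ‖thetaX F p‖ ≤ N := hN 1
  have n₂ : ‖thetaY F p‖ ≤ N := hN 2
  have n₃ : ‖thetaX (thetaY F) p‖ ≤ N := hN 3
  have kc' : ‖-(c - 1)‖ ≤ K := by rwa [norm_neg]
  have hN0 : 0 ≤ N := (norm_nonneg _).trans n₀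
  have hKN : N ≤ K * N := le_mul_of_one_le_left hN0 hK
  have Ex : ∀ q ∈ U, _ := fun q hq => (horn_x_expand a b (hF.analytic q hq)).symm.trans
    (hF.eq_x q hq)
  have Ey : ∀ q ∈ U, _ := fun q hq => (horn_y_expand a b c (hF.analytic q hq)).symm.trans
    (hF.eq_y q hq)
  have ex := Ex p hp
  have ey := Ey p hp
  obtain ⟨q₁, q₂⟩ := second_order_bound (N := 3 * (K * N)) (p := thetaX (thetaY F) p)
    (q₁ := thetaX (thetaX F) p) (q₂ := thetaY (thetaY F) p)
    (s₁ := b * thetaX F p)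
    (s₂ := (4 * a + 2) * thetaX F p + (2 * a + 1) * thetaY F p + a * (a + 1) * F p)
    (s₃ := -(c - 1) * thetaY F p)
    (s₄ := (2 * b - a) * thetaX F p + (a + b) * thetaY F p + a * b * F p) hx hy
    (by linarith) ((norm_lin₁_le kb n₁).trans (by linarith))
    (norm_lin₃_le k₁ k₂ k₃ n₁ n₂ n₀)
    ((norm_lin₁_le kc' n₂).trans (by linarith))
    (norm_lin₃_le k₄ k₅ k₆ n₁ n₂ n₀)
    (by linear_combination -ex) (by linear_combination ey)
  -- `12 = 4 · 3`, from `second_order_bound` applied with `3 K N`; `M` bounds every derivative of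
  -- order at most two.
  set M := 12 * (K * N) with hM
  have hM0 : 0 ≤ M := by positivity
  have hKM : M ≤ K * M := le_mul_of_one_le_left hM0 hK
  have m₀ : ‖F p‖ ≤ M := by linarith
  have m₁ : ‖thetaX F p‖ ≤ M := by linarith
  have m₂ : ‖thetaY F p‖ ≤ M := by linarith
  have m₃ : ‖thetaX (thetaY F) p‖ ≤ M := by linarith
  have m₄ : ‖thetaX (thetaX F) p‖ ≤ M := by linarith
  have m₅ : ‖thetaY (thetaY F) p‖ ≤ M := by linarith
  have d₁ := (analyticAt_thetaX (analyticAt_thetaX hA)).differentiableAt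
  have d₂ := (analyticAt_thetaX (analyticAt_thetaY hA)).differentiableAt
  have d₃ := (analyticAt_thetaY (analyticAt_thetaY hA)).differentiableAt
  have d₄ := (analyticAt_thetaX hA).differentiableAt
  have d₅ := (analyticAt_thetaY hA).differentiableAt
  have d₆ := hA.differentiableAt
  have Ex' : (fun q => -1 * thetaX (thetaX F) q + thetaX (thetaY F) q + b * thetaX F q
      + (-1) * (q.1 * (4 * thetaX (thetaX F) q + 4 * thetaX (thetaY F) q + thetaY (thetaY F) q
        + (4 * a + 2) * thetaX F q + (2 * a + 1) * thetaY F q + a * (a + 1) * F q))) =ᶠ[𝓝 p]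
      fun _ => 0 :=
    eventually_of_mem (hU.mem_nhds hp) fun q hq => by
      have := Ex q hq
      linear_combination this
  have Ey' : (fun q => thetaY (thetaY F) q + (c - 1) * thetaY F q
      + (-1) * (q.2 * (-2 * thetaX (thetaX F) q + thetaX (thetaY F) q + thetaY (thetaY F) q
        + (2 * b - a) * thetaX F q + (a + b) * thetaY F q + a * b * F q))) =ᶠ[𝓝 p]
      fun _ => 0 :=
    eventually_of_mem (hU.mem_nhds hp) fun q hq => by
      have := Ey q hq
      linear_combination this
  have hYX : thetaY (thetaX F) =ᶠ[𝓝 p] thetaX (thetaY F) :=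
    hA.eventually_analyticAt.mono fun q hq => thetaY_thetaX hq
  have w₁ : thetaY (thetaX (thetaX F)) p = thetaX (thetaX (thetaY F)) p := by
    rw [thetaY_thetaX (analyticAt_thetaX hA), thetaX_congr hYX]
  have w₂ : thetaY (thetaX (thetaY F)) p = thetaX (thetaY (thetaY F)) p :=
    thetaY_thetaX (analyticAt_thetaY hA)
  have f₁ := (thetaX_horn_x b (4 * a + 2) (2 * a + 1) (a * (a + 1)) d₁ d₂ d₃ d₄ d₅ d₆).symm.trans
    ((thetaX_congr Ex').trans (thetaX_const 0))
  have f₂ := (thetaY_horn_x b (4 * a + 2) (2 * a + 1) (a * (a + 1)) d₁ d₂ d₃ d₄ d₅ d₆).symm.trans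
    ((thetaY_congr Ex').trans (thetaY_const 0))
  have f₃ := (thetaX_horn_y (c - 1) (2 * b - a) (a + b) (a * b) d₁ d₂ d₃ d₄ d₅ d₆).symm.trans
    ((thetaX_congr Ey').trans (thetaX_const 0))
  have f₄ := (thetaY_horn_y (c - 1) (2 * b - a) (a + b) (a * b) d₁ d₂ d₃ d₄ d₅ d₆).symm.trans
    ((thetaY_congr Ey').trans (thetaY_const 0))
  rw [w₁, w₂, hYX.self_of_nhds] at f₂ f₄
  have bx : ‖4 * thetaX (thetaX F) p + 4 * thetaX (thetaY F) p + thetaY (thetaY F) p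
      + ((4 * a + 2) * thetaX F p + (2 * a + 1) * thetaY F p + a * (a + 1) * F p)‖
      ≤ 12 * (K * M) := by
    refine (norm_add₄_le).trans ?_
    have := norm_lin₃_le k₁ k₂ k₃ m₁ m₂ m₀
    simp only [norm_mul, RCLike.norm_ofNat] at this ⊢
    linarith
  have bY : ‖-2 * thetaX (thetaX F) p + thetaX (thetaY F) p + thetaY (thetaY F) p
      + ((2 * b - a) * thetaX F p + (a + b) * thetaY F p + a * b * F p)‖
      ≤ 12 * (K * M) := by
    refine (norm_add₄_le).trans ?_
    have := norm_lin₃_le k₄ k₅ k₆ m₁ m₂ m₀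
    simp only [norm_mul, norm_neg, RCLike.norm_ofNat] at this ⊢
    linarith
  obtain ⟨t₂, t₃⟩ := third_order_bound (N := 15 * (K * M))
    (t₁ := thetaX (thetaX (thetaX F)) p) (t₂ := thetaX (thetaX (thetaY F)) p)
    (t₃ := thetaX (thetaY (thetaY F)) p) (t₄ := thetaY (thetaY (thetaY F)) p)
    (s₁ := b * thetaX (thetaX F) p)
    (s₂ := (4 * thetaX (thetaX F) p + 4 * thetaX (thetaY F) p + thetaY (thetaY F) p
      + ((4 * a + 2) * thetaX F p + (2 * a + 1) * thetaY F p + a * (a + 1) * F p))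
      + ((4 * a + 2) * thetaX (thetaX F) p + (2 * a + 1) * thetaX (thetaY F) p
        + a * (a + 1) * thetaX F p))
    (s₃ := b * thetaX (thetaY F) p)
    (s₄ := (4 * a + 2) * thetaX (thetaY F) p + (2 * a + 1) * thetaY (thetaY F) p
        + a * (a + 1) * thetaY F p)
    (s₅ := -(c - 1) * thetaX (thetaY F) p)
    (s₆ := (2 * b - a) * thetaX (thetaX F) p + (a + b) * thetaX (thetaY F) p
        + a * b * thetaX F p)
    (s₇ := -(c - 1) * thetaY (thetaY F) p)
    (s₈ := (-2 * thetaX (thetaX F) p + thetaX (thetaY F) p + thetaY (thetaY F) p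
      + ((2 * b - a) * thetaX F p + (a + b) * thetaY F p + a * b * F p))
      + ((2 * b - a) * thetaX (thetaY F) p + (a + b) * thetaY (thetaY F) p
        + a * b * thetaY F p)) hx hy
    ((norm_lin₁_le kb m₄).trans (by linarith))
    ((norm_add_le _ _).trans (by linarith [norm_lin₃_le k₁ k₂ k₃ m₄ m₃ m₁]))
    ((norm_lin₁_le kb m₃).trans (by linarith))
    ((norm_lin₃_le k₁ k₂ k₃ m₃ m₅ m₂).trans (by linarith))
    ((norm_lin₁_le kc' m₃).trans (by linarith))
    ((norm_lin₃_le k₄ k₅ k₆ m₄ m₃ m₁).trans (by linarith))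
    ((norm_lin₁_le kc' m₅).trans (by linarith))
    ((norm_add_le _ _).trans (by linarith [norm_lin₃_le k₄ k₅ k₆ m₃ m₅ m₂]))
    (by linear_combination -f₁) (by linear_combination -f₂) (by linear_combination f₃)
    (by linear_combination f₄)
  have hfin : 12000 * K ^ 2 * N = 1000 * (K * M) := by rw [hM]; ring
  rw [hfin]
  have big : M ≤ 1000 * (K * M) := by linarith
  have big' : 10 * (15 * (K * M)) ≤ 1000 * (K * M) := by linarith
  fin_cases i
  · exact ⟨m₁.trans big, m₂.trans big⟩
  · refine ⟨m₄.trans big, ?_⟩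
    change ‖thetaY (thetaX F) p‖ ≤ _
    rw [hYX.self_of_nhds]
    exact m₃.trans big
  · exact ⟨m₃.trans big, m₅.trans big⟩
  · refine ⟨t₂.trans big', ?_⟩
    change ‖thetaY (thetaX (thetaY F)) p‖ ≤ _
    rw [w₂]
    exact t₃.trans big'

/-- A solution of the Horn system near the origin is determined by its jet at a point. -/
theorem IsHornSolution.eq_zero_of_jet_eq_zero {a b c : ℂ} {U : Set (ℂ × ℂ)} {F : ℂ × ℂ → ℂ}
    (hU : IsOpen U) (hUc : IsPreconnected U) (hUs : U ⊆ domXY (1 / 100))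
    (hF : IsHornSolution a b c U F) {p₀ : ℂ × ℂ} (hp₀ : p₀ ∈ U)
    (h0 : ∀ i, jet F i p₀ = 0) : Set.EqOn F 0 U := by
  refine hF.analytic.eqOn_zero_of_preconnected_of_eventuallyEq_zero hUc hp₀ ?_
  have hx0 : 0 < ‖p₀.1‖ := norm_pos_iff.2 (Complex.slitPlane_ne_zero (hUs hp₀).2)
  have hy0 : 0 < ‖p₀.2‖ := norm_pos_iff.2 (Complex.slitPlane_ne_zero (hUs hp₀).1.2.2)
  obtain ⟨δ, hδ, hball⟩ := Metric.isOpen_iff.1 hU p₀ hp₀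
  -- With these halves, each coordinate of `p - p₀` is at most the same coordinate of any point `q`
  -- of the segment. So the derivative along the segment is bounded by `|θ_x| + |θ_y|` of the jet at
  -- `q`, without dividing by `x` or `y`.
  obtain ⟨η, hη, hη1, hη2, hη3⟩ : ∃ η > 0, η ≤ δ ∧ η ≤ ‖p₀.1‖ / 2 ∧ η ≤ ‖p₀.2‖ / 2 :=
    ⟨min δ (min (‖p₀.1‖ / 2) (‖p₀.2‖ / 2)), by positivity, min_le_left _ _,
      (min_le_right _ _).trans (min_le_left _ _), (min_le_right _ _).trans (min_le_right _ _)⟩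
  refine eventually_of_mem (Metric.ball_mem_nhds p₀ hη) fun p hp => ?_
  obtain ⟨K, hK, kb, kc, k₁, k₂, k₃, k₄, k₅, k₆⟩ : ∃ K : ℝ, 1 ≤ K ∧ ‖b‖ ≤ K ∧ ‖c - 1‖ ≤ K ∧
      ‖4 * a + 2‖ ≤ K ∧ ‖2 * a + 1‖ ≤ K ∧ ‖a * (a + 1)‖ ≤ K ∧ ‖2 * b - a‖ ≤ K ∧ ‖a + b‖ ≤ K ∧
      ‖a * b‖ ≤ K := by
    refine ⟨1 + ‖b‖ + ‖c - 1‖ + ‖4 * a + 2‖ + ‖2 * a + 1‖ + ‖a * (a + 1)‖ + ‖2 * b - a‖ + ‖a + b‖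
      + ‖a * b‖, ?_, ?_, ?_, ?_, ?_, ?_, ?_, ?_, ?_⟩ <;>
    linarith [norm_nonneg b, norm_nonneg (c - 1), norm_nonneg (4 * a + 2),
      norm_nonneg (2 * a + 1), norm_nonneg (a * (a + 1)), norm_nonneg (2 * b - a),
      norm_nonneg (a + b), norm_nonneg (a * b)]
  have hv : ‖p - p₀‖ < η := by rwa [← dist_eq_norm]
  have hγ : ∀ t ∈ Set.Icc (0 : ℝ) 1, p₀ + (t : ℂ) • (p - p₀) ∈ Metric.ball p₀ η := fun t ht => by
    rw [Metric.mem_ball, dist_eq_norm, add_sub_cancel_left, norm_smul, Complex.norm_real,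
      Real.norm_of_nonneg ht.1]
    exact (mul_le_of_le_one_left (norm_nonneg _) ht.2).trans_lt hv
  have hγU : ∀ t ∈ Set.Icc (0 : ℝ) 1, p₀ + (t : ℂ) • (p - p₀) ∈ U := fun t ht =>
    hball (Metric.ball_subset_ball hη1 (hγ t ht))
  have hderiv : ∀ t ∈ Set.Icc (0 : ℝ) 1, ∀ i, HasDerivAt
      (fun t : ℝ => jet F i (p₀ + (t : ℂ) • (p - p₀)))
      (fderiv ℂ (jet F i) (p₀ + (t : ℂ) • (p - p₀)) (p - p₀)) t := fun t ht i => by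
    have h1 : HasDerivAt (fun t : ℂ => p₀ + t • (p - p₀)) (p - p₀) (t : ℂ) := by
      simpa using ((hasDerivAt_id (t : ℂ)).smul_const (p - p₀)).const_add p₀
    have h2 := (analyticAt_jet (hF.analytic _ (hγU t ht)) i).differentiableAt.hasFDerivAt
    exact (h2.comp_hasDerivAt (t : ℂ) h1).comp_ofReal
  have hbound : ∀ t ∈ Set.Icc (0 : ℝ) 1, ∀ i,
      ‖fderiv ℂ (jet F i) (p₀ + (t : ℂ) • (p - p₀)) (p - p₀)‖
        ≤ 24000 * K ^ 2 * ‖fun i => jet F i (p₀ + (t : ℂ) • (p - p₀))‖ := fun t ht i => by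
    set q := p₀ + (t : ℂ) • (p - p₀) with hq
    have hqU : q ∈ U := hγU t ht
    have hqb := hγ t ht
    rw [← hq, Metric.mem_ball, dist_eq_norm] at hqb
    obtain ⟨b₁, b₂⟩ := hF.norm_theta_jet_le hU hqU (hUs hqU).1.1.le (hUs hqU).1.2.1.le hK kb kc
      k₁ k₂ k₃ k₄ k₅ k₆ (fun i => norm_le_pi_norm (fun i => jet F i q) i) i
    have hd := (analyticAt_jet (hF.analytic q hqU) i).differentiableAt
    rw [thetaX_eq_fderiv hd] at b₁
    rw [thetaY_eq_fderiv hd] at b₂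
    have l₁ : ‖(p - p₀).1‖ ≤ ‖q.1‖ := by
      have h1 : ‖p₀.1‖ - ‖q.1‖ ≤ ‖(q - p₀).1‖ := by
        rw [Prod.fst_sub, norm_sub_rev]; exact norm_sub_norm_le _ _
      linarith [norm_fst_le (q - p₀), norm_fst_le (p - p₀)]
    have l₂ : ‖(p - p₀).2‖ ≤ ‖q.2‖ := by
      have h1 : ‖p₀.2‖ - ‖q.2‖ ≤ ‖(q - p₀).2‖ := by
        rw [Prod.snd_sub, norm_sub_rev]; exact norm_sub_norm_le _ _
      linarith [norm_snd_le (q - p₀), norm_snd_le (p - p₀)]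
    have hsplit : fderiv ℂ (jet F i) q (p - p₀) = (p - p₀).1 * fderiv ℂ (jet F i) q (1, 0)
        + (p - p₀).2 * fderiv ℂ (jet F i) q (0, 1) := by
      have : p - p₀ = (p - p₀).1 • ((1 : ℂ), (0 : ℂ)) + (p - p₀).2 • ((0 : ℂ), (1 : ℂ)) := by
        ext <;> simp
      conv_lhs => rw [this]
      rw [map_add, map_smul, map_smul, smul_eq_mul, smul_eq_mul]
    rw [hsplit]
    refine (norm_add_le _ _).trans ?_
    rw [norm_mul] at b₁ b₂
    rw [norm_mul, norm_mul]
    have c₁ := (mul_le_mul_of_nonneg_right l₁ (norm_nonneg _)).trans b₁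
    have c₂ := (mul_le_mul_of_nonneg_right l₂ (norm_nonneg _)).trans b₂
    linarith
  -- Grönwall's inequality for the jet along the segment from `p₀` to `p`.
  have hz := eq_zero_of_abs_deriv_le_mul_abs_self_of_eq_zero_right (a := 0) (b := 1)
    (f := fun t : ℝ => fun i => jet F i (p₀ + (t : ℂ) • (p - p₀)))
    (f' := fun t : ℝ => fun i => fderiv ℂ (jet F i) (p₀ + (t : ℂ) • (p - p₀)) (p - p₀))
    (K := 24000 * K ^ 2)
    (continuousOn_pi.2 fun i t ht => (hderiv t ht i).continuousAt.continuousWithinAt)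
    (fun t ht => hasDerivWithinAt_pi.2 fun i =>
      (hderiv t ⟨ht.1, ht.2.le⟩ i).hasDerivWithinAt)
    (by funext i; simpa using h0 i)
    (fun t ht => (pi_norm_le_iff_of_nonneg (by positivity)).2 (hbound t ⟨ht.1, ht.2.le⟩))
    1 ⟨zero_le_one, le_rfl⟩
  have := congrFun hz 0
  simpa [jet] using this

end HornH5

/-! ### The root near `1` as a function of `x` and `√y`. -/

namespace HornH5

open Filter Topology

section RootBranch

open Complex (I)

theorem sqrt_sq (y : ℂ) : (y ^ (1 / 2 : ℂ)) ^ 2 = y := by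
  rw [one_div]; exact_mod_cast Complex.cpow_nat_inv_pow y two_ne_zero

theorem norm_sqrt_sq (y : ℂ) : ‖y ^ (1 / 2 : ℂ)‖ ^ 2 = ‖y‖ := by
  rw [← norm_pow, sqrt_sq]

theorem isPreconnected_ball_inter_slitPlane {ε : ℝ} (hε : 0 < ε) :
    IsPreconnected (Metric.ball (0 : ℂ) ε ∩ Complex.slitPlane) := by
  have hm : ((ε / 2 : ℝ) : ℂ) ∈ Metric.ball (0 : ℂ) ε := by
    rw [mem_ball_zero_iff, Complex.norm_real, Real.norm_of_nonneg (by positivity)]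
    linarith
  have h1 : StarConvex ℝ ((ε / 2 : ℝ) : ℂ) (Metric.ball (0 : ℂ) ε) :=
    (convex_ball (0 : ℂ) ε).starConvex hm
  have h2 := h1.inter (Complex.starConvex_ofReal_slitPlane (half_pos hε))
  have hm' : ((ε / 2 : ℝ) : ℂ) ∈ Complex.slitPlane :=
    Complex.ofReal_mem_slitPlane.2 (half_pos hε)
  exact (h2.isPathConnected ⟨hm, hm'⟩).isConnected.isPreconnected

theorem domY_eq (ε : ℝ) : domY ε
    = Metric.ball (0 : ℂ) ε ×ˢ (Metric.ball (0 : ℂ) ε ∩ Complex.slitPlane) := by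
  ext p; simp [domY]

theorem domXY_eq (ε : ℝ) : domXY ε = (Metric.ball (0 : ℂ) ε ∩ Complex.slitPlane) ×ˢ
    (Metric.ball (0 : ℂ) ε ∩ Complex.slitPlane) := by
  ext p; simp [domXY, domY]; tauto

theorem isPreconnected_domY {ε : ℝ} (hε : 0 < ε) : IsPreconnected (domY ε) := by
  rw [domY_eq]
  exact (convex_ball _ _).isPreconnected.prod (isPreconnected_ball_inter_slitPlane hε)

theorem isPreconnected_domXY {ε : ℝ} (hε : 0 < ε) : IsPreconnected (domXY ε) := by
  rw [domXY_eq]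
  exact (isPreconnected_ball_inter_slitPlane hε).prod (isPreconnected_ball_inter_slitPlane hε)

theorem mem_domXY_ofReal {ε t : ℝ} (h0 : 0 < t) (h1 : t < ε) : ((t : ℂ), (t : ℂ)) ∈ domXY ε := by
  have : ‖(t : ℂ)‖ < ε := by rwa [Complex.norm_real, Real.norm_of_nonneg h0.le]
  exact ⟨⟨this, this, Complex.ofReal_mem_slitPlane.2 h0⟩, Complex.ofReal_mem_slitPlane.2 h0⟩

/-- `v` is a holomorphic square root, as a function of `x` and `s = √y`, of the root of the quartic
near `1`. -/
structure IsRootSqrt (δ : ℝ) (v : ℂ × ℂ → ℂ) : Prop where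
  analytic : AnalyticOnNhd ℂ v (Metric.ball 0 δ)
  near : ∀ q ∈ Metric.ball (0 : ℂ × ℂ) δ, ‖v q - 1‖ ≤ 1 / 8
  root : ∀ q ∈ Metric.ball (0 : ℂ × ℂ) δ,
    q.1 * v q ^ 4 + v q ^ 2 - 1 - 2 * I * q.2 * v q = 0

/-- The implicit function theorem at `x = s = 0`, `v = 1`, where the `v`-derivative is `2`. The
quartic itself has a double root there; taking `s = √y` and `v = √f` separates the two branches. -/
theorem exists_isRootSqrt : ∃ δ : ℝ, 0 < δ ∧ ∃ v, IsRootSqrt δ v := by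
  let f : (ℂ × ℂ) × ℂ → ℂ := fun u => u.1.1 * u.2 ^ 4 + u.2 ^ 2 - 1 - 2 * I * u.1.2 * u.2
  let u : (ℂ × ℂ) × ℂ := (0, 1)
  have cdf : ContDiffAt ℂ ⊤ f u := by
    have : ContDiff ℂ ⊤ f := by fun_prop
    exact this.contDiffAt
  have hfu : f u = 0 := by simp [f, u]
  have hd : (fderiv ℂ f u ∘L .inr ℂ (ℂ × ℂ) ℂ) 1 = 2 := by
    have h1 : HasFDerivAt f (fderiv ℂ f u) u := (cdf.differentiableAt (by simp)).hasFDerivAt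
    have h2 : HasDerivAt (fun t : ℂ => ((0 : ℂ × ℂ), t)) ((0 : ℂ × ℂ), (1 : ℂ)) 1 :=
      (hasDerivAt_const 1 (0 : ℂ × ℂ)).prodMk (hasDerivAt_id 1)
    have h3 := h1.comp_hasDerivAt (1 : ℂ) h2
    have h4 : HasDerivAt (fun t : ℂ => t ^ 2 - 1) 2 1 := by
      simpa using (hasDerivAt_pow 2 (1 : ℂ)).sub_const 1
    have h5 : f ∘ (fun t : ℂ => ((0 : ℂ × ℂ), t)) = fun t : ℂ => t ^ 2 - 1 := by
      funext t; simp [f]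
    rw [h5] at h3
    exact h3.unique h4
  have hinv : (fderiv ℂ f u ∘L .inr ℂ (ℂ × ℂ) ℂ).IsInvertible := by
    refine ⟨ContinuousLinearEquiv.unitsEquivAut ℂ (Units.mk0 2 two_ne_zero), ?_⟩
    ext
    rw [hd]
    simp
  have hn : (⊤ : WithTop ℕ∞) ≠ 0 := by simp
  have hv : AnalyticAt ℂ (cdf.implicitFunction hn hinv) 0 :=
    (cdf.contDiffAt_implicitFunction hn hinv).analyticAt
  have hself : cdf.implicitFunction hn hinv 0 = 1 := cdf.implicitFunction_apply_self hn hinv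
  have heq : ∀ᶠ q in 𝓝 0, f (q, cdf.implicitFunction hn hinv q) = f u :=
    cdf.eventually_apply_implicitFunction hn hinv
  have hnear : ∀ᶠ q in 𝓝 0, ‖cdf.implicitFunction hn hinv q - 1‖ < 1 / 8 := by
    have : ContinuousAt (fun q => ‖cdf.implicitFunction hn hinv q - 1‖) 0 :=
      (hv.continuousAt.sub continuousAt_const).norm
    exact this.eventually_lt_const (by simp [hself])
  obtain ⟨δ, hδ, h⟩ := Metric.eventually_nhds_iff_ball.1
    (hv.eventually_analyticAt.and (heq.and hnear))
  refine ⟨δ, hδ, cdf.implicitFunction hn hinv, fun q hq => (h q hq).1,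
    fun q hq => (h q hq).2.2.le, fun q hq => ?_⟩
  have := (h q hq).2.1
  rwa [hfu] at this

variable {δ ε : ℝ} {v : ℂ × ℂ → ℂ}

/-- The root of the quartic with square root `v`. -/
noncomputable def rootOf (v : ℂ × ℂ → ℂ) (p : ℂ × ℂ) : ℂ := v (p.1, p.2 ^ (1 / 2 : ℂ)) ^ 2

theorem sqrt_mem_ball (hδ : 0 < δ) (h1 : ε ≤ δ) (h2 : ε ≤ δ ^ 2) {p : ℂ × ℂ} (hx : ‖p.1‖ < ε)
    (hy : ‖p.2‖ < ε) : (p.1, p.2 ^ (1 / 2 : ℂ)) ∈ Metric.ball (0 : ℂ × ℂ) δ := by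
  rw [mem_ball_zero_iff, Prod.norm_def]
  refine max_lt (hx.trans_le h1) ?_
  refine lt_of_pow_lt_pow_left₀ 2 hδ.le ?_
  rw [norm_sqrt_sq]
  exact hy.trans_le h2

theorem norm_rootOf_sub_one_lt (hv : IsRootSqrt δ v) {q : ℂ × ℂ} (hq : q ∈ Metric.ball 0 δ) :
    ‖v q ^ 2 - 1‖ < 1 := by
  have h := hv.near q hq
  have h2 : ‖v q + 1‖ ≤ 1 / 8 + 2 := by
    calc ‖v q + 1‖ = ‖(v q - 1) + 2‖ := by congr 1; ring
      _ ≤ ‖v q - 1‖ + ‖(2 : ℂ)‖ := norm_add_le _ _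
      _ ≤ _ := by simpa using h
  calc ‖v q ^ 2 - 1‖ = ‖v q - 1‖ * ‖v q + 1‖ := by rw [← norm_mul]; congr 1; ring
    _ ≤ 1 / 8 * (1 / 8 + 2) := by gcongr
    _ < 1 := by norm_num

theorem mem_slitPlane_of_norm_sub_one_lt {z : ℂ} (h : ‖z - 1‖ < 1) : z ∈ Complex.slitPlane :=
  Complex.ball_one_subset_slitPlane (by rwa [mem_ball_iff_norm])

/-- The expansion follows from `v² - (1 + 2 i s) = 2 i s (v - 1) - x v⁴`, where `v - 1 = O(|s| +
|x|)` and `|s|² = |y|`. -/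
theorem isRootBranch_rootOf (hδ : 0 < δ) (h1 : ε ≤ δ) (h2 : ε ≤ δ ^ 2) (h3 : ε ≤ 1)
    (hv : IsRootSqrt δ v) : IsRootBranch ε (rootOf v) := by
  refine ⟨fun p hp => ?_, fun p hp => ?_, ?_⟩
  · have hb := sqrt_mem_ball hδ h1 h2 hp.1 hp.2.1
    have hs : AnalyticAt ℂ (fun p : ℂ × ℂ => (p.1, p.2 ^ (1 / 2 : ℂ))) p :=
      analyticAt_fst.prod ((analyticAt_cpow_const hp.2.2 _).comp analyticAt_snd)
    exact (AnalyticAt.comp (g := v) (f := fun p : ℂ × ℂ => (p.1, p.2 ^ (1 / 2 : ℂ)))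
      (hv.analytic _ hb) hs).pow 2
  · have hb := sqrt_mem_ball hδ h1 h2 hp.1 hp.2.1
    have hr := hv.root _ hb
    have hs := sqrt_sq p.2
    rw [isQuarticRoot_iff, rootOf]
    simp only at hr
    set s := p.2 ^ (1 / 2 : ℂ)
    set w := v (p.1, s)
    have hI := Complex.I_sq
    linear_combination (p.1 * w ^ 4 + w ^ 2 - 1 + 2 * I * s * w) * hr + 4 * s ^ 2 * w ^ 2 * hI
      - 4 * w ^ 2 * hs
  · refine Asymptotics.IsBigO.of_bound 6 (eventually_of_mem self_mem_nhdsWithin fun p hp => ?_)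
    have hb := sqrt_mem_ball hδ h1 h2 hp.1 hp.2.1
    have hr := hv.root _ hb
    have hn := hv.near _ hb
    have hs := norm_sqrt_sq p.2
    have hy := hp.2.1
    rw [rootOf]
    simp only at hr
    set s := p.2 ^ (1 / 2 : ℂ)
    set w := v (p.1, s)
    have hs1 : ‖s‖ ≤ 1 := by
      refine le_of_sq_le_sq ?_ zero_le_one
      rw [hs]; linarith
    have hw : ‖w‖ ≤ 9 / 8 := by
      have := norm_le_norm_add_norm_sub' w 1
      rw [norm_one] at this
      linarith
    have hw1 : 1 ≤ ‖w + 1‖ := by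
      have : ‖(2 : ℂ)‖ ≤ ‖w + 1‖ + ‖w - 1‖ := by
        refine le_trans (le_of_eq ?_) (norm_sub_le _ _)
        congr 1; ring
      rw [Complex.norm_ofNat] at this
      linarith
    have hw4 : ‖w‖ ^ 4 ≤ 2 := by
      calc ‖w‖ ^ 4 ≤ (9 / 8) ^ 4 := by gcongr
        _ ≤ 2 := by norm_num
    have e1 : ‖w - 1‖ ≤ 3 * ‖s‖ + 2 * ‖p.1‖ := by
      calc ‖w - 1‖ ≤ ‖w - 1‖ * ‖w + 1‖ := le_mul_of_one_le_right (norm_nonneg _) hw1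
        _ = ‖2 * I * s * w - p.1 * w ^ 4‖ := by
          rw [← norm_mul]; congr 1; linear_combination hr
        _ ≤ ‖2 * I * s * w‖ + ‖p.1 * w ^ 4‖ := norm_sub_le _ _
        _ = 2 * ‖s‖ * ‖w‖ + ‖p.1‖ * ‖w‖ ^ 4 := by simp
        _ ≤ 2 * ‖s‖ * (9 / 8) + ‖p.1‖ * 2 := by gcongr
        _ ≤ _ := by linarith [norm_nonneg s]
    rw [Real.norm_of_nonneg (by positivity)]
    calc ‖w ^ 2 - (1 + 2 * I * s)‖ = ‖2 * I * s * (w - 1) - p.1 * w ^ 4‖ := by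
          congr 1; linear_combination hr
      _ ≤ ‖2 * I * s * (w - 1)‖ + ‖p.1 * w ^ 4‖ := norm_sub_le _ _
      _ = 2 * ‖s‖ * ‖w - 1‖ + ‖p.1‖ * ‖w‖ ^ 4 := by simp
      _ ≤ 2 * ‖s‖ * (3 * ‖s‖ + 2 * ‖p.1‖) + ‖p.1‖ * 2 := by gcongr
      _ = 6 * ‖s‖ ^ 2 + 4 * (‖s‖ * ‖p.1‖) + 2 * ‖p.1‖ := by ring
      _ ≤ 6 * ‖p.2‖ + 4 * (1 * ‖p.1‖) + 2 * ‖p.1‖ := by rw [hs]; gcongr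
      _ = _ := by ring

/-- One of the two square roots has `|u + 1| ≥ 1`, and `z - 1 = (u - 1) (u + 1)`. -/
theorem exists_sqrt_near_one (z : ℂ) : ∃ u : ℂ, u ^ 2 = z ∧ ‖u - 1‖ ≤ ‖z - 1‖ := by
  have key : ∀ u : ℂ, u ^ 2 = z → 1 ≤ ‖u + 1‖ → ‖u - 1‖ ≤ ‖z - 1‖ := fun u hu h => by
    calc ‖u - 1‖ ≤ ‖u - 1‖ * ‖u + 1‖ := le_mul_of_one_le_right (norm_nonneg _) h
      _ = ‖z - 1‖ := by rw [← norm_mul, ← hu]; congr 1; ring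
  have hu := sqrt_sq z
  set u := z ^ (1 / 2 : ℂ)
  by_cases h : 1 ≤ ‖u + 1‖
  · exact ⟨u, hu, key u hu h⟩
  · refine ⟨-u, by rw [neg_sq, hu], key (-u) (by rw [neg_sq, hu]) ?_⟩
    have : ‖(2 : ℂ)‖ ≤ ‖u + 1‖ + ‖-u + 1‖ := by
      refine le_trans (le_of_eq ?_) (norm_add_le _ _)
      congr 1; ring
    rw [Complex.norm_ofNat] at this
    linarith

/-- The square root of the root of the quartic is unique near `1`. -/
theorem root_sqrt_unique {x s u w : ℂ} (hx : ‖x‖ ≤ 1 / 100) (hs : ‖s‖ ≤ 1 / 100)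
    (hu : ‖u - 1‖ ≤ 1 / 8) (hw : ‖w - 1‖ ≤ 1 / 8)
    (eu : x * u ^ 4 + u ^ 2 - 1 - 2 * I * s * u = 0)
    (ew : x * w ^ 4 + w ^ 2 - 1 - 2 * I * s * w = 0) : u = w := by
  have hprod : (u - w) * (x * ((u + w) * (u ^ 2 + w ^ 2)) + (u + w) - 2 * I * s) = 0 := by
    linear_combination eu - ew
  rcases mul_eq_zero.1 hprod with h | h
  · exact sub_eq_zero.1 h
  -- The second factor is within a small distance of `2`, so it cannot vanish.
  · exfalso
    have bu : ‖u‖ ≤ 9 / 8 := by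
      have := norm_le_norm_add_norm_sub' u 1
      rw [norm_one] at this
      linarith
    have bw : ‖w‖ ≤ 9 / 8 := by
      have := norm_le_norm_add_norm_sub' w 1
      rw [norm_one] at this
      linarith
    have e2 : (2 : ℂ) = -(u - 1) - (w - 1) - x * ((u + w) * (u ^ 2 + w ^ 2)) + 2 * I * s := by
      linear_combination h
    have b1 : ‖x * ((u + w) * (u ^ 2 + w ^ 2))‖ ≤ 1 / 100 * ((9 / 8 + 9 / 8)
        * ((9 / 8) ^ 2 + (9 / 8) ^ 2)) := by
      rw [norm_mul, norm_mul]
      gcongr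
      · exact (norm_add_le _ _).trans (by gcongr)
      · refine (norm_add_le _ _).trans ?_
        rw [norm_pow, norm_pow]; gcongr
    have b2 : ‖2 * I * s‖ ≤ 2 / 100 := by simp; linarith
    have : ‖(2 : ℂ)‖ ≤ 1 / 8 + 1 / 8 + 1 / 100 * ((9 / 8 + 9 / 8)
        * ((9 / 8) ^ 2 + (9 / 8) ^ 2)) + 2 / 100 := by
      rw [e2]
      refine (norm_add_le _ _).trans (add_le_add ((norm_sub_le _ _).trans
        (add_le_add ((norm_sub_le _ _).trans (add_le_add ?_ hw)) b1)) b2)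
      rwa [norm_neg]
    rw [Complex.norm_ofNat] at this
    norm_num at this

/-- In the region `|x| < |y| < η²` the error of the expansion is `O(|s|²)`, so the term `2 i s`
decides which factor of the quartic vanishes, and `root_sqrt_unique` applies. The identity theorem
on the connected set `domY ε` does the rest. -/
theorem eqOn_rootOf (hδ : 0 < δ) (hε : 0 < ε) (h1 : ε ≤ δ) (h2 : ε ≤ δ ^ 2) (h3 : ε ≤ 1)
    (hv : IsRootSqrt δ v) {f : ℂ × ℂ → ℂ} (hf : IsRootBranch ε f) :
    Set.EqOn f (rootOf v) (domY ε) := by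
  obtain ⟨C, hC, hO⟩ := hf.expansion.exists_pos
  obtain ⟨η₀, hη₀, hb⟩ := Metric.mem_nhdsWithin_iff.1 hO.bound
  obtain ⟨η, hη, hηε, hηη, hηC, hη1⟩ : ∃ η : ℝ, 0 < η ∧ η ≤ ε ∧ η ≤ η₀ ∧ η * (32 * (1 + C)) ≤ 1 ∧
      η ≤ 1 / 100 := by
    refine ⟨min (min ε η₀) (min (1 / (32 * (1 + C))) (1 / 100)), by positivity,
      (min_le_left _ _).trans (min_le_left _ _), (min_le_left _ _).trans (min_le_right _ _), ?_,
      (min_le_right _ _).trans (min_le_right _ _)⟩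
    rw [← le_div_iff₀ (by positivity)]
    exact (min_le_right _ _).trans (min_le_left _ _)
  have hη2 : η ^ 2 ≤ η := by nlinarith
  have key : ∀ p ∈ domY ε, ‖p.1‖ < ‖p.2‖ → ‖p.2‖ < η ^ 2 → f p = rootOf v p := by
    intro p hp hxy hyη
    have hbd : ‖f p - (1 + 2 * I * p.2 ^ (1 / 2 : ℂ))‖ ≤ C * (‖p.1‖ + ‖p.2‖) := by
      have : p ∈ Metric.ball (0 : ℂ × ℂ) η₀ ∩ domY ε := by
        refine ⟨?_, hp⟩
        rw [mem_ball_zero_iff, Prod.norm_def]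
        exact max_lt (by linarith) (by linarith)
      have := hb this
      simp only [Set.mem_ofPred_eq] at this
      rwa [Real.norm_of_nonneg (by positivity)] at this
    have hq := sqrt_mem_ball hδ h1 h2 hp.1 hp.2.1
    have hr := hv.root _ hq
    have hn := hv.near _ hq
    have hs := norm_sqrt_sq p.2
    have hs' := sqrt_sq p.2
    have hz := (isQuarticRoot_iff p _).1 (hf.root p hp)
    have hy0 : 0 < ‖p.2‖ := norm_pos_iff.2 (Complex.slitPlane_ne_zero hp.2.2)
    rw [rootOf]
    simp only at hr
    set s := p.2 ^ (1 / 2 : ℂ)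
    set w := v (p.1, s)
    set z := f p
    have hsη : ‖s‖ < η := lt_of_pow_lt_pow_left₀ 2 hη.le (by rwa [hs])
    have hs0 : 0 < ‖s‖ := by
      rcases (norm_nonneg s).eq_or_lt with h | h
      · rw [← h] at hs; simp at hs; rw [← hs] at hy0; simp at hy0
      · exact h
    have hbd' : ‖z - (1 + 2 * I * s)‖ ≤ 2 * C * ‖s‖ ^ 2 := by
      refine hbd.trans ?_
      rw [hs]
      nlinarith
    have hCs : C * ‖s‖ ≤ 1 / 32 := by nlinarith
    have hz1 : ‖z - 1‖ ≤ 1 / 8 := by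
      calc ‖z - 1‖ = ‖(z - (1 + 2 * I * s)) + 2 * I * s‖ := by congr 1; ring
        _ ≤ 2 * C * ‖s‖ ^ 2 + 2 * ‖s‖ := by
          refine (norm_add_le _ _).trans (add_le_add hbd' ?_)
          simp
        _ ≤ 1 / 8 := by nlinarith
    obtain ⟨u, huz, hu⟩ : ∃ u, u ^ 2 = z ∧ ‖u - 1‖ ≤ ‖z - 1‖ := exists_sqrt_near_one z
    have hsgn : (p.1 * u ^ 4 + u ^ 2 - 1 - 2 * I * s * u)
        * (p.1 * u ^ 4 + u ^ 2 - 1 + 2 * I * s * u) = 0 := by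
      rw [← huz] at hz
      linear_combination hz - 4 * s ^ 2 * u ^ 2 * Complex.I_sq + 4 * u ^ 2 * hs'
    rcases mul_eq_zero.1 hsgn with h | h
    · have huw : u = w := root_sqrt_unique (x := p.1) (s := s) (by linarith) (by linarith)
        (hu.trans hz1) hn h hr
      rw [← huz, huw]
    -- The wrong sign of `s` would give `2 i s (u + 1) = O(|s|²)` with `|u + 1| ≥ 1`, impossible for
    -- `|s| < η`.
    · exfalso
      have hu1 : 1 ≤ ‖u + 1‖ := by
        have : ‖(2 : ℂ)‖ ≤ ‖u + 1‖ + ‖u - 1‖ := by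
          refine le_trans (le_of_eq ?_) (norm_sub_le _ _)
          congr 1; ring
        rw [Complex.norm_ofNat] at this
        linarith
      have hz2 : ‖z‖ ^ 2 ≤ 2 := by
        have : ‖z‖ ≤ 9 / 8 := by
          have := norm_le_norm_add_norm_sub' z 1
          rw [norm_one] at this
          linarith
        nlinarith [norm_nonneg z]
      have e : 2 * I * s * (u + 1) = -(p.1 * z ^ 2) - (z - (1 + 2 * I * s)) := by
        rw [← huz]; linear_combination h
      have : 2 * ‖s‖ ≤ ‖s‖ ^ 2 * 2 + 2 * C * ‖s‖ ^ 2 := by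
        calc 2 * ‖s‖ ≤ 2 * ‖s‖ * ‖u + 1‖ := le_mul_of_one_le_right (by positivity) hu1
          _ = ‖2 * I * s * (u + 1)‖ := by simp
          _ ≤ ‖p.1‖ * ‖z‖ ^ 2 + ‖z - (1 + 2 * I * s)‖ := by
            rw [e]
            refine (norm_sub_le _ _).trans ?_
            rw [norm_neg, norm_mul, norm_pow]
          _ ≤ ‖s‖ ^ 2 * 2 + 2 * C * ‖s‖ ^ 2 := by
            rw [hs] at hbd' ⊢
            gcongr
      nlinarith
  have ht : 0 < η ^ 2 / 2 := by positivity
  have hnt : ‖((η ^ 2 / 2 : ℝ) : ℂ)‖ = η ^ 2 / 2 := by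
    rw [Complex.norm_real, Real.norm_of_nonneg ht.le]
  have hp1 : ((0 : ℂ), ((η ^ 2 / 2 : ℝ) : ℂ)) ∈ domY ε :=
    ⟨by simpa using hε, by rw [hnt]; linarith, Complex.ofReal_mem_slitPlane.2 ht⟩
  refine hf.analytic.eqOn_of_preconnected_of_eventuallyEq
    (isRootBranch_rootOf hδ h1 h2 h3 hv).analytic (isPreconnected_domY hε) hp1 ?_
  have o1 : ∀ᶠ p : ℂ × ℂ in 𝓝 ((0 : ℂ), ((η ^ 2 / 2 : ℝ) : ℂ)), ‖p.1‖ < ‖p.2‖ := by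
    refine ContinuousAt.eventually_lt (by fun_prop) (by fun_prop) ?_
    simp only [norm_zero, hnt]; exact ht
  have o2 : ∀ᶠ p : ℂ × ℂ in 𝓝 ((0 : ℂ), ((η ^ 2 / 2 : ℝ) : ℂ)), ‖p.2‖ < η ^ 2 := by
    refine ContinuousAt.eventually_lt (by fun_prop) (by fun_prop) ?_
    simp only [hnt]; linarith
  filter_upwards [(isOpen_domY ε).mem_nhds hp1, o1, o2] with p a1 a2 a3 using key p a1 a2 a3

end RootBranch

end HornH5

/-! ### Monodromy in `x`. -/

namespace HornH5

open Filter Topology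

section Monodromy

open Complex (I)

theorem exp_mem_slitPlane_of_abs_im_lt {t : ℂ} (h : |t.im| < Real.pi) :
    Complex.exp t ∈ Complex.slitPlane := by
  rw [Complex.mem_slitPlane_iff_arg]
  refine ⟨?_, Complex.exp_ne_zero t⟩
  obtain ⟨h1, h2⟩ := abs_lt.1 h
  rw [← Complex.log_im, Complex.log_exp h1 h2.le]
  exact h2.ne

theorem exp_two_pi_mul_sq_ne_one {α : ℂ} (hα : ∀ k : ℤ, 2 * α ≠ k) :
    Complex.exp (2 * Real.pi * I * α) ^ 2 ≠ 1 := by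
  rw [← Complex.exp_nat_mul]
  intro h
  obtain ⟨n, hn⟩ := Complex.exp_eq_one_iff.1 h
  apply hα n
  have h0 := Complex.two_pi_I_ne_zero
  apply mul_right_cancel₀ h0
  rw [← hn]
  push_cast
  ring

/-- Powers of `x` whose exponents differ by non-integers are independent over germs of holomorphic
functions: turn around the origin once and twice. -/
theorem eq_zero_of_monodromy {R : ℝ} {α : ℂ} {E₁ E₂ E₃ : ℂ → ℂ} (hR : 0 < R)
    (hα : ∀ k : ℤ, 2 * α ≠ k)
    (h₁ : AnalyticOnNhd ℂ E₁ (Metric.ball 0 R)) (h₂ : AnalyticOnNhd ℂ E₂ (Metric.ball 0 R))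
    (h₃ : AnalyticOnNhd ℂ E₃ (Metric.ball 0 R))
    (h : ∀ x ∈ Metric.ball (0 : ℂ) R, x ∈ Complex.slitPlane →
      E₁ x + x ^ α * E₂ x + x ^ (α + 1 / 2) * E₃ x = 0) :
    ∀ x ∈ Metric.ball (0 : ℂ) R, E₁ x = 0 ∧ E₂ x = 0 ∧ E₃ x = 0 := by
  -- In the coordinate `t = log x` the relation holds near a real point, inside the strip `|Im t| <
  -- π`, and extends to the whole half-plane by the identity theorem. There `t` may be shifted by
  -- `2πi`.
  set H : Set ℂ := {t | t.re < Real.log R} with hH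
  have hHc : IsPreconnected H := (convex_halfSpace_re_lt _).isPreconnected
  have hexp : ∀ t ∈ H, Complex.exp t ∈ Metric.ball (0 : ℂ) R := fun t ht => by
    rw [mem_ball_zero_iff, Complex.norm_exp]
    exact (Real.lt_log_iff_exp_lt hR).1 ht
  let g : ℂ → ℂ := fun t => E₁ (Complex.exp t) + Complex.exp (α * t) * E₂ (Complex.exp t)
    + Complex.exp ((α + 1 / 2) * t) * E₃ (Complex.exp t)
  have hcomp : ∀ {E : ℂ → ℂ}, AnalyticOnNhd ℂ E (Metric.ball 0 R) → ∀ t ∈ H,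
      AnalyticAt ℂ (fun t => E (Complex.exp t)) t := fun hE t ht =>
    AnalyticAt.comp (hE _ (hexp t ht)) analyticAt_id.cexp
  have hlin : ∀ β t : ℂ, AnalyticAt ℂ (fun t => Complex.exp (β * t)) t := fun β t =>
    (analyticAt_const.mul analyticAt_id).cexp
  have hg : AnalyticOnNhd ℂ g H := fun t ht =>
    ((hcomp h₁ t ht).add ((hlin _ t).mul (hcomp h₂ t ht))).add ((hlin _ t).mul (hcomp h₃ t ht))
  have hg0 : ∀ t ∈ H, g t = 0 := by
    have ht0 : ((Real.log R - 1 : ℝ) : ℂ) ∈ H := by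
      change (((Real.log R - 1 : ℝ) : ℂ)).re < Real.log R
      rw [Complex.ofReal_re]; linarith
    refine hg.eqOn_zero_of_preconnected_of_eventuallyEq_zero hHc ht0 ?_
    have o1 : ∀ᶠ t : ℂ in 𝓝 ((Real.log R - 1 : ℝ) : ℂ), |t.im| < Real.pi := by
      refine ContinuousAt.eventually_lt
        (Complex.continuous_im.abs.continuousAt) continuousAt_const ?_
      simp [Real.pi_pos]
    have o2 : H ∈ 𝓝 ((Real.log R - 1 : ℝ) : ℂ) :=
      (isOpen_lt Complex.continuous_re continuous_const).mem_nhds ht0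
    filter_upwards [o1, o2] with t a1 a2
    have hs := exp_mem_slitPlane_of_abs_im_lt a1
    have hl : Complex.log (Complex.exp t) = t :=
      Complex.log_exp (abs_lt.1 a1).1 (abs_lt.1 a1).2.le
    have := h _ (hexp t a2) hs
    rw [Complex.cpow_def_of_ne_zero (Complex.exp_ne_zero t),
      Complex.cpow_def_of_ne_zero (Complex.exp_ne_zero t), hl, mul_comm t, mul_comm t] at this
    exact this
  have hne : ∀ x ∈ Metric.ball (0 : ℂ) R, x ≠ 0 → E₁ x = 0 ∧ E₂ x = 0 ∧ E₃ x = 0 := by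
    intro x hx hx0
    set t := Complex.log x with ht
    have hxt : Complex.exp t = x := Complex.exp_log hx0
    have htH : t ∈ H := by
      change t.re < Real.log R
      rw [Complex.log_re]
      exact Real.log_lt_log (norm_pos_iff.2 hx0) (mem_ball_zero_iff.1 hx)
    have hshift : ∀ s : ℂ, s ∈ H → s + 2 * Real.pi * I ∈ H := fun s hs => by
      change (s + 2 * Real.pi * I).re < Real.log R
      have : (s + 2 * Real.pi * I).re = s.re := by simp
      rw [this]; exact hs
    set ω := Complex.exp (2 * Real.pi * I * α) with hω
    have hω2 : ω ^ 2 ≠ 1 := exp_two_pi_mul_sq_ne_one hα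
    have hω0 : ω ≠ 0 := Complex.exp_ne_zero _
    have s1 : ∀ s : ℂ, Complex.exp (α * (s + 2 * Real.pi * I)) = ω * Complex.exp (α * s) :=
      fun s => by rw [hω, ← Complex.exp_add]; congr 1; ring
    have s2 : ∀ s : ℂ, Complex.exp ((α + 1 / 2) * (s + 2 * Real.pi * I))
        = -ω * Complex.exp ((α + 1 / 2) * s) := fun s => by
      have : (α + 1 / 2) * (s + 2 * Real.pi * I)
          = 2 * Real.pi * I * α + (α + 1 / 2) * s + Real.pi * I := by ring
      rw [this, Complex.exp_add, Complex.exp_pi_mul_I, Complex.exp_add, hω]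
      ring
    have s0 : ∀ s : ℂ, Complex.exp (s + 2 * Real.pi * I) = Complex.exp s :=
      Complex.exp_periodic
    -- Write `A`, `B` for the last two terms. Each turn multiplies `A` by `ω` and `B` by `-ω` and
    -- fixes `E₁ x`. Zero and two turns give `(1 - ω²) E₁ x = 0`; one turn then separates `A` from
    -- `B`.
    have e0 := hg0 t htH
    have e1 := hg0 _ (hshift t htH)
    have e2 := hg0 _ (hshift _ (hshift t htH))
    simp only [g, s0, s1, s2, hxt] at e0 e1 e2
    set A := Complex.exp (α * t) * E₂ x with hA
    set B := Complex.exp ((α + 1 / 2) * t) * E₃ x with hB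
    have k1 : E₁ x = 0 := by
      have : (1 - ω ^ 2) * E₁ x = 0 := by linear_combination e2 - ω ^ 2 * e0
      exact (mul_eq_zero.1 this).resolve_left (sub_ne_zero.2 (Ne.symm hω2))
    have k2 : A = 0 := by
      have : 2 * ω * A = 0 := by linear_combination e1 + ω * e0 - (1 + ω) * k1
      exact (mul_eq_zero.1 this).resolve_left (mul_ne_zero two_ne_zero hω0)
    have k3 : B = 0 := by linear_combination e0 - k1 - k2
    exact ⟨k1, (mul_eq_zero.1 k2).resolve_left (Complex.exp_ne_zero _),
      (mul_eq_zero.1 k3).resolve_left (Complex.exp_ne_zero _)⟩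
  have hzero : ∀ {E : ℂ → ℂ}, AnalyticOnNhd ℂ E (Metric.ball 0 R) →
      (∀ x ∈ Metric.ball (0 : ℂ) R, x ≠ 0 → E x = 0) → E 0 = 0 := fun {E} hE hz => by
    have hc : Tendsto E (𝓝[≠] 0) (𝓝 (E 0)) :=
      (hE 0 (Metric.mem_ball_self hR)).continuousAt.tendsto.mono_left nhdsWithin_le_nhds
    refine tendsto_nhds_unique hc (tendsto_const_nhds.congr' ?_)
    filter_upwards [self_mem_nhdsWithin,
      mem_nhdsWithin_of_mem_nhds (Metric.ball_mem_nhds (0 : ℂ) hR)] with x a1 a2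
    exact (hz x a2 a1).symm
  intro x hx
  by_cases hx0 : x = 0
  · subst hx0
    exact ⟨hzero h₁ fun x hx h0 => (hne x hx h0).1, hzero h₂ fun x hx h0 => (hne x hx h0).2.1,
      hzero h₃ fun x hx h0 => (hne x hx h0).2.2⟩
  · exact hne x hx hx0

end Monodromy

/-! ### Independence of the four solutions and the basis theorem. -/

section Basis

open Complex (I)

theorem doubleSeries_zero (a : ℕ × ℕ → ℂ) : doubleSeries a (0, 0) = a (0, 0) := by
  rw [doubleSeries, tsum_eq_single (0, 0)]
  · simp
  · rintro ⟨m, n⟩ hk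
    rcases m with _ | m
    · rcases n with _ | n
      · exact absurd rfl hk
      · simp
    · simp

theorem doubleSeries_coneCoeff_zero_left (e d c y : ℂ) :
    doubleSeries (coneCoeff e d c) (0, y) = 1 := by
  rw [doubleSeries, tsum_eq_single (0, 0)]
  · simp [coneCoeff, poch_zero]
  · rintro ⟨m, n⟩ hk
    rcases m with _ | m
    · rcases n with _ | n
      · exact absurd rfl hk
      · simp [coneCoeff]
    · simp

theorem h5Coeff_zero (a b c : ℂ) : h5Coeff a b c (0, 0) = 1 := by
  simp [h5Coeff, poch_zero, pochInt]

theorem sq_mem_slitPlane {s : ℂ} (hs : 0 < s.re) : s ^ 2 ∈ Complex.slitPlane := by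
  rw [Complex.mem_slitPlane_iff, sq, Complex.mul_re, Complex.mul_im]
  by_cases h : s.im = 0
  · left; rw [h]; simpa using mul_pos hs hs
  · right
    have : s.re * s.im ≠ 0 := mul_ne_zero hs.ne' h
    intro h'
    apply this
    linarith

theorem sqrt_of_sq {s : ℂ} (hs : 0 < s.re) : (s ^ 2) ^ (1 / 2 : ℂ) = s := by
  rw [one_div]; exact Complex.sq_cpow_two_inv hs

theorem sqrt_re_pos {y : ℂ} (hy : y ∈ Complex.slitPlane) : 0 < (y ^ (1 / 2 : ℂ)).re := by
  rw [Complex.cpow_def_of_ne_zero (Complex.slitPlane_ne_zero hy), Complex.exp_re]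
  refine mul_pos (Real.exp_pos _) (Real.cos_pos_of_mem_Ioo ?_)
  have him : (Complex.log y * (1 / 2)).im = y.arg / 2 := by
    rw [← Complex.log_im]
    simp [Complex.mul_im]
    ring
  rw [him]
  have h1 := Complex.neg_pi_lt_arg y
  have h2 := (Complex.arg_le_pi y).lt_of_ne (Complex.mem_slitPlane_iff_arg.1 hy).1
  constructor <;> linarith

variable {r : ℂ} {ε : ℝ}

/-- A combination of the four Frobenius series that is holomorphic in `x` and `√y` at the origin
involves only the first two of them. -/
theorem coefficients_of_holomorphic (hr : ∀ k : ℤ, 2 * r ≠ k) (hε : 0 < ε) (hε' : ε ≤ 256⁻¹)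
    {g : ℂ → ℂ → ℂ} {c : Fin 4 → ℂ}
    (hgx : ∀ s : ℂ, ‖s‖ ^ 2 < ε → AnalyticOnNhd ℂ (fun x => g x s) (Metric.ball 0 ε))
    (hgs : AnalyticAt ℂ (fun s => g 0 s) 0)
    (h : ∀ x ∈ Metric.ball (0 : ℂ) ε, x ∈ Complex.slitPlane → ∀ s : ℂ, ‖s‖ ^ 2 < ε → 0 < s.re →
      g x s = ∑ i, c i * Phi r i (x, s ^ 2)) :
    c 0 = g 0 0 ∧ c 1 = deriv (fun s => g 0 s) 0 ∧ c 2 = 0 ∧ c 3 = 0 ∧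
    ∀ x ∈ Metric.ball (0 : ℂ) ε, ∀ s : ℂ, ‖s‖ ^ 2 < ε → 0 < s.re →
      g x s = c 0 * Phi1 r (x, s ^ 2) + c 1 * Phi2 r (x, s ^ 2) := by
  obtain ⟨a1, a2, a3, a4⟩ := convergesBelow_Phi hr
  set P1 := doubleSeries (h5Coeff r (-r) (1 / 2)) with hP1
  set P2 := doubleSeries (h5Coeff (r + 1 / 2) (-r + 1 / 2) (3 / 2)) with hP2
  set P3 := doubleSeries (coneCoeff (-r) (1 - r) (1 / 2)) with hP3
  set P4 := doubleSeries (coneCoeff (3 / 2 - r) (3 / 2 - r) (3 / 2)) with hP4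
  have f1 : ∀ x s : ℂ, Phi1 r (x, s ^ 2) = P1 (x, s ^ 2) := fun x s => by
    simp [Phi1_eq, frobenius, hP1]
  have f2 : ∀ x s : ℂ, 0 < s.re → Phi2 r (x, s ^ 2) = s * P2 (x, s ^ 2) := fun x s hs => by
    rw [Phi2_eq, frobenius]
    simp only [Complex.cpow_zero, one_mul]
    rw [sqrt_of_sq hs]
  have f3 : ∀ x s : ℂ, Phi3 r (x, s ^ 2) = x ^ (-r) * P3 (x, s ^ 2) := fun x s => by
    simp [Phi3_eq, frobenius, hP3]
  have f4 : ∀ x s : ℂ, 0 < s.re →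
      Phi4 r (x, s ^ 2) = x ^ (-r + 1 / 2) * (s * P4 (x, s ^ 2)) := fun x s hs => by
    rw [Phi4_eq, frobenius]
    simp only
    rw [sqrt_of_sq hs, mul_assoc]
  have hnx : ∀ {a : ℕ × ℕ → ℂ}, ConvergesBelow 256⁻¹ a → ∀ s : ℂ, ‖s‖ ^ 2 < ε →
      AnalyticOnNhd ℂ (fun x => doubleSeries a (x, s ^ 2)) (Metric.ball 0 ε) :=
    fun {a} ha s hs x hx => by
    have hb : AnalyticAt ℂ (doubleSeries a) (x, s ^ 2) :=
      ha.analyticAt ((mem_ball_zero_iff.1 hx).trans_le hε')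
        (by rw [norm_pow]; exact hs.trans_le hε')
    exact AnalyticAt.comp (g := doubleSeries a) (f := fun x => (x, s ^ 2)) hb
      (analyticAt_id.prod analyticAt_const)
  -- For fixed `s` the monodromy argument applies in `x` with `α = -r`. Its conclusion holds on the
  -- whole disc, including the cut.
  have key : ∀ s : ℂ, ‖s‖ ^ 2 < ε → 0 < s.re → ∀ x ∈ Metric.ball (0 : ℂ) ε,
      (c 0 * P1 (x, s ^ 2) + c 1 * s * P2 (x, s ^ 2) - g x s = 0) ∧ c 2 * P3 (x, s ^ 2) = 0 ∧
      c 3 * s * P4 (x, s ^ 2) = 0 := by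
    intro s hs hs'
    have hα : ∀ k : ℤ, 2 * -r ≠ k := fun k hk => hr (-k) (by push_cast; linear_combination -hk)
    refine eq_zero_of_monodromy hε hα ?_ ?_ ?_ fun x hx hx' => ?_
    · exact fun x hx => ((analyticAt_const.mul (hnx a1 s hs x hx)).add
        (analyticAt_const.mul (hnx a2 s hs x hx))).sub (hgx s hs x hx)
    · exact fun x hx => analyticAt_const.mul (hnx a3 s hs x hx)
    · exact fun x hx => analyticAt_const.mul (hnx a4 s hs x hx)
    · have := h x hx hx' s hs hs'
      rw [Fin.sum_univ_four] at this
      change g x s = c 0 * Phi1 r (x, s ^ 2) + c 1 * Phi2 r (x, s ^ 2) + c 2 * Phi3 r (x, s ^ 2)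
        + c 3 * Phi4 r (x, s ^ 2) at this
      rw [f1, f2 x s hs', f3, f4 x s hs'] at this
      rw [this]
      ring
  have hformula : ∀ x ∈ Metric.ball (0 : ℂ) ε, ∀ s : ℂ, ‖s‖ ^ 2 < ε → 0 < s.re →
      g x s = c 0 * P1 (x, s ^ 2) + c 1 * s * P2 (x, s ^ 2) := fun x hx s hs hs' => by
    linear_combination -(key s hs hs' x hx).1
  have h0 : (0 : ℂ) ∈ Metric.ball (0 : ℂ) ε := Metric.mem_ball_self hε
  have hreal : ∀ t : ℝ, 0 < t → t < ε → ‖(t : ℂ)‖ ^ 2 < ε ∧ 0 < (t : ℂ).re := fun t h1 h2 => by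
    rw [Complex.norm_real, Real.norm_of_nonneg h1.le, Complex.ofReal_re]
    have : ε < 1 := hε'.trans_lt (by norm_num)
    exact ⟨by nlinarith, h1⟩
  -- At `x = 0` the cone series equal `1`, so any one `s ≠ 0` yields `c 2 = c 3 = 0`.
  obtain ⟨hs1, hs2⟩ := hreal (ε / 2) (half_pos hε) (half_lt_self hε)
  obtain ⟨-, z3, z4⟩ := key _ hs1 hs2 0 h0
  rw [hP3, doubleSeries_coneCoeff_zero_left, mul_one] at z3
  rw [hP4, doubleSeries_coneCoeff_zero_left, mul_one] at z4
  have hs0 : ((ε / 2 : ℝ) : ℂ) ≠ 0 := by exact_mod_cast (half_pos hε).ne'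
  have hQ : ∀ {a : ℕ × ℕ → ℂ}, ConvergesBelow 256⁻¹ a →
      AnalyticAt ℂ (fun s : ℂ => doubleSeries a (0, s ^ 2)) 0 := fun {a} ha => by
    have hb : AnalyticAt ℂ (doubleSeries a) (0, (0 : ℂ) ^ 2) :=
      ha.analyticAt (by simp) (by simp)
    exact AnalyticAt.comp (g := doubleSeries a) (f := fun s : ℂ => (0, s ^ 2)) hb
      (analyticAt_const.prod (analyticAt_id.pow 2))
  have hQ' : ∀ {a : ℕ × ℕ → ℂ}, ConvergesBelow 256⁻¹ a →
      HasDerivAt (fun s : ℂ => doubleSeries a (0, s ^ 2)) 0 0 := fun {a} ha => by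
    have hb : AnalyticAt ℂ (fun y : ℂ => doubleSeries a (0, y)) ((0 : ℂ) ^ 2) :=
      AnalyticAt.comp (g := doubleSeries a) (f := fun y : ℂ => (0, y))
        (ha.analyticAt (by simp) (by simp)) (analyticAt_const.prod analyticAt_id)
    have := hb.differentiableAt.hasDerivAt.comp (0 : ℂ) (hasDerivAt_pow 2 (0 : ℂ))
    exact this.congr_deriv (by simp)
  have hψ : AnalyticAt ℂ (fun s : ℂ => c 0 * P1 (0, s ^ 2) + c 1 * s * P2 (0, s ^ 2)) 0 :=
    (analyticAt_const.mul (hQ a1)).add ((analyticAt_const.mul analyticAt_id).mul (hQ a2))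
  -- The formula is known only for `Re s > 0`. Positive reals accumulate at `0`, so it holds near `s
  -- = 0`, and the first two Taylor coefficients give `c 0` and `c 1`.
  have hev : (fun s => g 0 s) =ᶠ[𝓝 0] fun s : ℂ => c 0 * P1 (0, s ^ 2) + c 1 * s * P2 (0, s ^ 2) := by
    refine (hgs.frequently_eq_iff_eventually_eq hψ).1 ?_
    have ht : Tendsto (fun t : ℝ => (t : ℂ)) (𝓝[>] 0) (𝓝[≠] 0) := by
      refine tendsto_nhdsWithin_iff.2 ⟨?_, ?_⟩
      · exact (Complex.continuous_ofReal.tendsto' 0 0 rfl).mono_left nhdsWithin_le_nhds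
      · filter_upwards [self_mem_nhdsWithin] with t ht
        have : (t : ℂ) ≠ 0 := by exact_mod_cast (ne_of_gt ht)
        exact this
    refine ht.frequently (Eventually.frequently ?_)
    filter_upwards [Ioo_mem_nhdsGT hε] with t ht
    obtain ⟨k1, k2⟩ := hreal t ht.1 ht.2
    exact hformula 0 h0 t k1 k2
  have v1 : P1 (0, 0) = 1 := by rw [hP1, doubleSeries_zero, h5Coeff_zero]
  have v2 : P2 (0, 0) = 1 := by rw [hP2, doubleSeries_zero, h5Coeff_zero]
  have hd : HasDerivAt (fun s : ℂ => c 0 * P1 (0, s ^ 2) + c 1 * s * P2 (0, s ^ 2)) (c 1) 0 := by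
    have := ((hQ' a1).const_mul (c 0)).fun_add
      (((hasDerivAt_id (0 : ℂ)).const_mul (c 1)).fun_mul (hQ' a2))
    refine this.congr_deriv ?_
    simp only [ne_eq, OfNat.ofNat_ne_zero, not_false_eq_true, zero_pow]
    rw [show doubleSeries (h5Coeff (r + 1 / 2) (-r + 1 / 2) (3 / 2)) (0, 0) = 1 from v2]
    ring
  refine ⟨?_, ?_, z3, (mul_eq_zero.1 z4).resolve_right hs0, fun x hx s hs hs' => ?_⟩
  · have := hev.self_of_nhds
    simp only [ne_eq, OfNat.ofNat_ne_zero, not_false_eq_true, zero_pow, v1] at this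
    rw [this]; ring
  · rw [hev.deriv_eq, hd.deriv]
  · rw [hformula x hx s hs hs', f1, f2 x s hs']; ring

theorem domXY_mono {ε ε' : ℝ} (h : ε ≤ ε') : domXY ε ⊆ domXY ε' :=
  fun _ hp => ⟨⟨hp.1.1.trans_le h, hp.1.2.1.trans_le h, hp.1.2.2⟩, hp.2⟩

/-- A relation on `U` continues to the connected set `domXY ε`; then `coefficients_of_holomorphic`
applies with `g = 0`. -/
theorem linearIndependent_Phi (hr : ∀ k : ℤ, 2 * r ≠ k) (hε : 0 < ε) (hε' : ε ≤ 256⁻¹)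
    {U : Set (ℂ × ℂ)} (hU : IsOpen U) (hne : U.Nonempty) (hUs : U ⊆ domXY ε) {c : Fin 4 → ℂ}
    (h : ∀ p ∈ U, ∑ i, c i * Phi r i p = 0) : c = 0 := by
  obtain ⟨p₀, hp₀⟩ := hne
  have hsol := (IsHornSolution.sum (isHornSolution_Phi hr) c).mono (domXY_mono hε')
  have hz := hsol.analytic.eqOn_zero_of_preconnected_of_eventuallyEq_zero
    (isPreconnected_domXY hε) (hUs hp₀) (eventually_of_mem (hU.mem_nhds hp₀) h)
  obtain ⟨k0, k1, k2, k3, -⟩ := coefficients_of_holomorphic (g := fun _ _ => 0) (c := c) hr hε hε'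
    (fun _ _ _ _ => analyticAt_const) analyticAt_const (fun x hx hx' s hs hs' => by
      refine (hz (x := (x, s ^ 2)) ⟨⟨mem_ball_zero_iff.1 hx, ?_, sq_mem_slitPlane hs'⟩, hx'⟩).symm
      rw [norm_pow]; exact hs)
  funext i
  fin_cases i
  · exact k0
  · simpa using k1
  · exact k2
  · exact k3

/-- `Φ₁, …, Φ₄` form a basis of the holomorphic solutions on a connected open set. -/
theorem existsUnique_coefficients (hr : ∀ k : ℤ, 2 * r ≠ k) (hε : 0 < ε) (hε' : ε ≤ 256⁻¹)
    {U : Set (ℂ × ℂ)} (hU : IsOpen U) (hUc : IsConnected U) (hUs : U ⊆ domXY ε) {F : ℂ × ℂ → ℂ}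
    (hF : IsHornSolution r (-r) (1 / 2) U F) :
    ∃! c : Fin 4 → ℂ, ∀ p ∈ U, F p = ∑ i, c i * Phi r i p := by
  obtain ⟨p₀, hp₀⟩ := hUc.nonempty
  have hΦ : ∀ i, IsHornSolution r (-r) (1 / 2) U (Phi r i) := fun i =>
    (isHornSolution_Phi hr i).mono (hUs.trans (domXY_mono hε'))
  have hU' : U ⊆ domXY (1 / 100) :=
    hUs.trans (domXY_mono (hε'.trans (by norm_num)))
  -- The Wronskian matrix of the `Φᵢ` at `p₀`. Jet uniqueness and independence make it injective,
  -- hence surjective, so some combination has the same jet as `F`.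
  let T : (Fin 4 → ℂ) →ₗ[ℂ] (Fin 4 → ℂ) :=
    Matrix.mulVecLin (Matrix.of fun j i => jet (Phi r i) j p₀)
  have hT : ∀ c j, T c j = jet (fun q => ∑ i, c i * Phi r i q) j p₀ := fun c j => by
    rw [jet_sum c (fun i => (hΦ i).analytic p₀ hp₀)]
    simp only [T, Matrix.mulVecLin_apply, Matrix.mulVec, dotProduct, Matrix.of_apply]
    exact Finset.sum_congr rfl fun i _ => mul_comm _ _
  have hinj : Function.Injective T := by
    rw [injective_iff_map_eq_zero]
    intro c hc
    refine linearIndependent_Phi hr hε hε' hU ⟨p₀, hp₀⟩ hUs ?_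
    exact (IsHornSolution.sum hΦ c).eq_zero_of_jet_eq_zero hU hUc.isPreconnected hU' hp₀
      fun j => by rw [← hT, hc]; rfl
  obtain ⟨c, hc⟩ := (LinearMap.injective_iff_surjective.1 hinj) fun j => jet F j p₀
  have hjet : ∀ j, jet (fun q => F q - ∑ i, c i * Phi r i q) j p₀ = 0 := by
    intro j
    have hs := jet_sum (F := ![F, fun q => ∑ i, c i * Phi r i q, F, F]) (p := p₀) ![1, -1, 0, 0]
      (fun i => by
        fin_cases i
        · exact hF.analytic p₀ hp₀
        · exact (IsHornSolution.sum hΦ c).analytic p₀ hp₀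
        · exact hF.analytic p₀ hp₀
        · exact hF.analytic p₀ hp₀) j
    have hfun : (fun q => ∑ i, (![1, -1, 0, 0] : Fin 4 → ℂ) i
        * (![F, fun q => ∑ i, c i * Phi r i q, F, F] : Fin 4 → ℂ × ℂ → ℂ) i q)
        = fun q => F q - ∑ i, c i * Phi r i q := by
      funext q
      rw [Fin.sum_univ_four]
      simp only [Matrix.cons_val]
      ring
    rw [hfun] at hs
    rw [hs, Fin.sum_univ_four]
    simp only [Matrix.cons_val]
    rw [← hT, hc]
    ring
  have hz := (hF.sub hU (IsHornSolution.sum hΦ c)).eq_zero_of_jet_eq_zero hU hUc.isPreconnected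
    hU' hp₀ hjet
  refine ⟨c, fun p hp => sub_eq_zero.1 (hz hp), fun c' hc' => ?_⟩
  refine sub_eq_zero.1 (linearIndependent_Phi hr hε hε' hU ⟨p₀, hp₀⟩ hUs (c := c' - c) ?_)
  intro p hp
  simp only [Pi.sub_apply, sub_mul, Finset.sum_sub_distrib]
  rw [← hc' p hp]
  exact hz hp

end Basis

/-! ### Identification of `f ^ r`. -/

section RootPowerFormula

open Complex (I)

variable {r : ℂ} {δ ε : ℝ} {v : ℂ × ℂ → ℂ}

/-- At `x = 0` the equation is `v² - 1 - 2 i s v = 0`. So `v = 1` at `s = 0`, the alternative `-1`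
being too far from `1`, and differentiating there gives `v' = i`. -/
theorem hasDerivAt_rootSqrt_power (hδ : 0 < δ) (hv : IsRootSqrt δ v) (r : ℂ) :
    (v (0, 0) ^ 2) ^ r = 1 ∧ AnalyticAt ℂ (fun s => (v (0, s) ^ 2) ^ r) 0 ∧
    HasDerivAt (fun s => (v (0, s) ^ 2) ^ r) (2 * I * r) 0 := by
  have h0 : ((0 : ℂ), (0 : ℂ)) ∈ Metric.ball (0 : ℂ × ℂ) δ := Metric.mem_ball_self hδ
  have hv0 : v (0, 0) = 1 := by
    have hr := hv.root _ h0
    have hn := hv.near _ h0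
    have hp : (v (0, 0) - 1) * (v (0, 0) + 1) = 0 := by
      simp only [zero_mul, mul_zero] at hr
      linear_combination hr
    rcases mul_eq_zero.1 hp with h | h
    · exact sub_eq_zero.1 h
    · rw [eq_neg_of_add_eq_zero_left h] at hn
      norm_num at hn
  have ha : AnalyticAt ℂ (fun s => v (0, s)) 0 :=
    AnalyticAt.comp (g := v) (f := fun s : ℂ => ((0 : ℂ), s)) (hv.analytic _ h0)
      (analyticAt_const.prod analyticAt_id)
  have hd := ha.differentiableAt.hasDerivAt
  set d := deriv (fun s => v (0, s)) 0
  have hdI : d = I := by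
    have e1 : HasDerivAt (fun s : ℂ => v (0, s) ^ 2 - 1 - 2 * I * s * v (0, s)) _ 0 :=
      ((hd.fun_pow 2).sub_const 1).fun_sub (((hasDerivAt_id (0 : ℂ)).const_mul (2 * I)).fun_mul hd)
    have hev : (fun s : ℂ => v (0, s) ^ 2 - 1 - 2 * I * s * v (0, s)) =ᶠ[𝓝 0] fun _ => 0 := by
      have hc : Tendsto (fun s : ℂ => ((0 : ℂ), s)) (𝓝 0) (𝓝 0) :=
        Continuous.tendsto' (by fun_prop) _ _ rfl
      filter_upwards [hc.eventually (Metric.ball_mem_nhds (0 : ℂ × ℂ) hδ)] with s hs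
      have := hv.root _ hs
      simp only [zero_mul, zero_add] at this
      exact this
    have := e1.unique ((hasDerivAt_const (0 : ℂ) (0 : ℂ)).congr_of_eventuallyEq hev)
    rw [hv0] at this
    norm_num at this
    linear_combination this / 2
  have hslit : v (0, 0) ^ 2 ∈ Complex.slitPlane := by rw [hv0]; simp
  refine ⟨by rw [hv0]; simp, (ha.pow 2).cpow analyticAt_const hslit, ?_⟩
  have := (hd.fun_pow 2).cpow_const (c := r) hslit
  refine this.congr_deriv ?_
  rw [hv0, hdI]
  simp
  ring

/-- The basis theorem needs `x` off the cut, but the resulting formula does not: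
`coefficients_of_holomorphic` returns it on the full disc in `x`, hence on `domY ε`. -/
theorem root_power_formula (hr : ∀ k : ℤ, 2 * r ≠ k) (hδ : 0 < δ) (hε : 0 < ε) (h1 : ε ≤ δ)
    (h2 : ε ≤ δ ^ 2) (hε' : ε ≤ 256⁻¹) (hv : IsRootSqrt δ v) {f : ℂ × ℂ → ℂ}
    (hf : IsRootBranch ε f) :
    IsHornSolution r (-r) (1 / 2) (domY ε) (fun p => f p ^ r) ∧
    ∀ p ∈ domY ε, f p ^ r = Phi1 r p + 2 * I * r * Phi2 r p := by
  have h3 : ε ≤ 1 := hε'.trans (by norm_num)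
  have heq := eqOn_rootOf hδ hε h1 h2 h3 hv hf
  have hslit : ∀ p ∈ domY ε, f p ∈ Complex.slitPlane := fun p hp => by
    rw [heq hp]
    exact mem_slitPlane_of_norm_sub_one_lt
      (norm_rootOf_sub_one_lt hv (sqrt_mem_ball hδ h1 h2 hp.1 hp.2.1))
  have hsol : IsHornSolution r (-r) (1 / 2) (domY ε) (fun p => f p ^ r) := by
    refine (isHornSolution_root_power r (domY ε) f (fun p => Complex.log (f p)) (isOpen_domY ε)
      hf.analytic hf.root (fun p hp => (hf.analytic p hp).clog (hslit p hp))
      fun p hp => Complex.exp_log (Complex.slitPlane_ne_zero (hslit p hp))).congr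
        (isOpen_domY ε) fun p hp => ?_
    rw [Complex.cpow_def_of_ne_zero (Complex.slitPlane_ne_zero (hslit p hp)), mul_comm]
  refine ⟨hsol, ?_⟩
  have hconn : IsConnected (domXY ε) :=
    ⟨⟨_, mem_domXY_ofReal (half_pos hε) (half_lt_self hε)⟩, isPreconnected_domXY hε⟩
  obtain ⟨c, hc, -⟩ := existsUnique_coefficients hr hε hε' (isOpen_domXY ε) hconn subset_rfl
    (hsol.mono fun p hp => hp.1)
  obtain ⟨v0, va, vd⟩ := hasDerivAt_rootSqrt_power hδ hv r
  have hball : ∀ x ∈ Metric.ball (0 : ℂ) ε, ∀ s : ℂ, ‖s‖ ^ 2 < ε →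
      (x, s) ∈ Metric.ball (0 : ℂ × ℂ) δ := fun x hx s hs => by
    rw [mem_ball_zero_iff, Prod.norm_def]
    refine max_lt ((mem_ball_zero_iff.1 hx).trans_le h1) ?_
    exact lt_of_pow_lt_pow_left₀ 2 hδ.le (hs.trans_le h2)
  have hfs : ∀ x ∈ Metric.ball (0 : ℂ) ε, ∀ s : ℂ, ‖s‖ ^ 2 < ε → 0 < s.re →
      f (x, s ^ 2) = v (x, s) ^ 2 := fun x hx s hs hs' => by
    have hp : (x, s ^ 2) ∈ domY ε :=
      ⟨mem_ball_zero_iff.1 hx, by rw [norm_pow]; exact hs, sq_mem_slitPlane hs'⟩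
    rw [heq hp, rootOf]
    simp only
    rw [sqrt_of_sq hs']
  obtain ⟨c0, c1, -, -, hform⟩ := coefficients_of_holomorphic (c := c)
    (g := fun x s => (v (x, s) ^ 2) ^ r) hr hε hε'
    (fun s hs x hx => by
      have hb := hball x hx s hs
      have ha : AnalyticAt ℂ (fun x => v (x, s)) x :=
        AnalyticAt.comp (g := v) (f := fun x : ℂ => (x, s)) (hv.analytic _ hb)
          (analyticAt_id.prod analyticAt_const)
      exact (ha.pow 2).cpow analyticAt_const
        (mem_slitPlane_of_norm_sub_one_lt (norm_rootOf_sub_one_lt hv hb)))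
    va (fun x hx hx' s hs hs' => by
      have hp : (x, s ^ 2) ∈ domXY ε :=
        ⟨⟨mem_ball_zero_iff.1 hx, by rw [norm_pow]; exact hs, sq_mem_slitPlane hs'⟩, hx'⟩
      have := hc _ hp
      rw [hfs x hx s hs hs'] at this
      exact this)
  intro p hp
  have hx : p.1 ∈ Metric.ball (0 : ℂ) ε := mem_ball_zero_iff.2 hp.1
  have hs : ‖p.2 ^ (1 / 2 : ℂ)‖ ^ 2 < ε := by rw [norm_sqrt_sq]; exact hp.2.1
  have hs' := sqrt_re_pos hp.2.2
  have := hform _ hx _ hs hs'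
  rw [← hfs _ hx _ hs hs', sqrt_sq, c0, c1, vd.deriv, v0, one_mul] at this
  exact this

end RootPowerFormula

end HornH5

theorem mainTheorem9 :
    -- any branch of `f ^ r`, for any holomorphic root `f` on any open set, solves the system
    (∀ (r : ℂ) (U : Set (ℂ × ℂ)) (f L : ℂ × ℂ → ℂ), IsOpen U →
      AnalyticOnNhd ℂ f U → (∀ p ∈ U, HornH5.IsQuarticRoot p (f p)) →
      AnalyticOnNhd ℂ L U → (∀ p ∈ U, Complex.exp (L p) = f p) →
      HornH5.IsHornSolution r (-r) (1 / 2) U (fun p => Complex.exp (r * L p))) ∧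
    ∃ ε : ℝ, 0 < ε ∧
      -- the branch of the root near the origin exists and is unique
      (∃ f : ℂ × ℂ → ℂ, HornH5.IsRootBranch ε f) ∧
      (∀ f g : ℂ × ℂ → ℂ, HornH5.IsRootBranch ε f → HornH5.IsRootBranch ε g →
        Set.EqOn f g (HornH5.domY ε)) ∧
      ∀ r : ℂ, (∀ k : ℤ, 2 * r ≠ (k : ℂ)) →
        -- convergence of the four series
        (∀ x y : ℂ, ‖x‖ < ε → ‖y‖ < ε →
          Summable (HornH5.H5Term r (-r) (1 / 2) x y) ∧
          Summable (HornH5.H5Term (r + 1 / 2) (-r + 1 / 2) (3 / 2) x y) ∧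
          Summable (HornH5.Phi3Term r x y) ∧
          Summable (HornH5.Phi4Term r x y)) ∧
        -- `Φ₁, …, Φ₄` form a basis of the local solution space, which has rank 4
        (∀ U : Set (ℂ × ℂ), IsOpen U → IsConnected U → U ⊆ HornH5.domXY ε →
          (∀ i, HornH5.IsHornSolution r (-r) (1 / 2) U (HornH5.Phi r i)) ∧
          ∀ F : ℂ × ℂ → ℂ, HornH5.IsHornSolution r (-r) (1 / 2) U F →
            ∃! c : Fin 4 → ℂ, ∀ p ∈ U, F p = ∑ i, c i * HornH5.Phi r i p) ∧
        -- `f ^ r` solves the system and equals `Φ₁ + 2ir Φ₂`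
        ∀ f : ℂ × ℂ → ℂ, HornH5.IsRootBranch ε f →
          HornH5.IsHornSolution r (-r) (1 / 2) (HornH5.domY ε) (fun p => f p ^ r) ∧
          ∀ p ∈ HornH5.domY ε,
            f p ^ r = HornH5.Phi1 r p + 2 * Complex.I * r * HornH5.Phi2 r p := by
  refine ⟨HornH5.isHornSolution_root_power, ?_⟩
  obtain ⟨δ, hδ, v, hv⟩ := HornH5.exists_isRootSqrt
  -- `δ²` because `|√y|² = |y|`, and `256⁻¹` for the series; neither involves `r`.
  obtain ⟨ε, hε, h1, h2, h3⟩ : ∃ ε : ℝ, 0 < ε ∧ ε ≤ δ ∧ ε ≤ δ ^ 2 ∧ ε ≤ 256⁻¹ :=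
    ⟨min δ (min (δ ^ 2) 256⁻¹), by positivity, min_le_left _ _,
      (min_le_right _ _).trans (min_le_left _ _), (min_le_right _ _).trans (min_le_right _ _)⟩
  have h4 : ε ≤ 1 := h3.trans (by norm_num)
  refine ⟨ε, hε, ⟨_, HornH5.isRootBranch_rootOf hδ h1 h2 h4 hv⟩, fun f g hf hg => ?_,
    fun r hr => ⟨fun x y hx hy => ?_, fun U hU hUc hUs => ⟨fun i => ?_, fun F hF => ?_⟩,
      fun f hf => HornH5.root_power_formula hr hδ hε h1 h2 h3 hv hf⟩⟩
  · exact (HornH5.eqOn_rootOf hδ hε h1 h2 h4 hv hf).trans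
      (HornH5.eqOn_rootOf hδ hε h1 h2 h4 hv hg).symm
  · exact HornH5.summable_terms hr (hx.trans_le h3) (hy.trans_le h3)
  · exact (HornH5.isHornSolution_Phi hr i).mono (hUs.trans (HornH5.domXY_mono h3))
  · exact HornH5.existsUnique_coefficients hr hε h3 hU hUc hUs hF
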